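/- Let $N\ge 2$ and $D\ge 0$ be integers. For $p\ge 0$ write $p=(N-1)n_p+r_p$ with $0\le r_p\le N-2$, and let $Y^N_p$ be the Young diagram with $p$ cells having $n_p$ rows of $N-1$ cells followed (if $r_p\ne 0$) by one row of $r_p$ cells. The indices of a covariant tensor of degree $p$ on $\mathbb{R}^D$ are assigned to the cells of $Y^N_p$, in such a way that if a new index is put in front of the $p$ indices of a tensor of degree $p$, the new index occupies the cell by which $Y^N_{p+1}$ exceeds $Y^N_p$ and the other indices keep their cells. Let $\mathbf{Y}_p$ be the corresponding Young symmetrizer on tensors of degree $p$ (symmetrization along the rows, followed by antisymmetrization along the columns, divided by the product of the hook lengths of $Y^N_p$). Let $\Omega^p_N(\mathbb{R}^D)$ be the real vector space of smooth covariant tensor fields of degree $p$ on $\mathbb{R}^D$ whose value at every point lies in the image of $\mathbf{Y}_p$, let $\Omega^p_N(\mathbb{R}^D)=0$ for $p<0$, and let $d=\mathbf{Y}_{p+1}\circ\partial:\Omega^p_N(\mathbb{R}^D)\to\Omega^{p+1}_N(\mathbb{R}^D)$, where $(\partial T)_{\mu_1\cdots\mu_{p+1}}=\partial_{\mu_1}T_{\mu_2\cdots\mu_{p+1}}$.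 For $1\le k\le N-1$ and $p\ge 0$ let $$H^p_{(k)}(\Omega_N(\mathbb{R}^D))=\frac{\mathrm{Ker}\bigl(d^k:\Omega^p_N(\mathbb{R}^D)\to\Omega^{p+k}_N(\mathbb{R}^D)\bigr)}{d^{N-k}\bigl(\Omega^{p+k-N}_N(\mathbb{R}^D)\bigr)} .$$ Then for every $k\in\{1,\dots,N-1\}$: 1. $H^{(N-1)n}_{(k)}(\Omega_N(\mathbb{R}^D))=0$ for all $n\ge 1$; 2. $H^0_{(k)}(\Omega_N(\mathbb{R}^D))$ is the space of real polynomial functions on $\mathbb{R}^D$ of degree strictly less than $k$; that is, sending the class of a function $f\in\mathrm{Ker}\,d^k\subset\Omega^0_N(\mathbb{R}^D)=C^\infty(\mathbb{R}^D)$ to $f$ itself is a well-defined linear isomorphism from $H^0_{(k)}(\Omega_N(\mathbb{R}^D))$ onto that space. -/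

import Mathlib

set_option maxSynthPendingDepth 3

open scoped ContDiff

namespace YoungComplex

/-- The Young diagram `Y^N_p = ((N-1)^n, r)`, where `p = (N-1) n + r` is the division of `p` by
`N - 1`: it has `n` rows of `N - 1` cells, followed by a row of `r` cells (absent if `r = 0`). -/
def diagram (N p : ℕ) : YoungDiagram :=
  YoungDiagram.ofRowLens (List.replicate (p / (N - 1)) (N - 1) ++ [p % (N - 1)]) (by
    rw [List.sortedGE_iff_pairwise, List.pairwise_append]
    refine ⟨List.pairwise_replicate.2 (Or.inr le_rfl), List.pairwise_singleton _ _, ?_⟩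
    intro a ha b hb
    rw [List.mem_replicate] at ha
    rw [List.mem_singleton] at hb
    obtain ⟨h0, rfl⟩ := ha
    subst hb
    rcases Nat.eq_zero_or_pos (N - 1) with h | h
    · simp [h] at h0
    · exact (Nat.mod_lt _ h).le)

/-- The cell number `c` (counting from `0`) of the diagrams `Y^N_p`, `c < p`, in the row by row
order: it lies in row `c / (N-1)` and column `c % (N-1)`. -/
def cell (N c : ℕ) : ℕ × ℕ := (c / (N - 1), c % (N - 1))

theorem mem_diagram_iff (N p i j : ℕ) :
    (i, j) ∈ (diagram N p).cells ↔
      (i < p / (N - 1) ∧ j < N - 1) ∨ (i = p / (N - 1) ∧ j < p % (N - 1)) := by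
  rw [diagram, YoungDiagram.mem_cells, YoungDiagram.mem_ofRowLens]
  rcases lt_trichotomy i (p / (N - 1)) with h | h | h
  · simp [h, h.ne, h.trans (Nat.lt_succ_self _)]
  · subst h
    simp
  · simp [h.not_gt, h.ne', Nat.not_lt.2 (Nat.succ_le_of_lt h), -not_lt]

theorem cell_mem_diagram (N p c : ℕ) (h : c < p) : cell N c ∈ (diagram N p).cells := by
  rw [cell, mem_diagram_iff]
  rcases Nat.eq_zero_or_pos (N - 1) with h0 | h0
  · simp [h0, h]
  · rcases (Nat.div_le_div_right (c := N - 1) h.le).lt_or_eq with h1 | h1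
    · exact Or.inl ⟨h1, Nat.mod_lt _ h0⟩
    · refine Or.inr ⟨h1, ?_⟩
      have e1 := Nat.div_add_mod c (N - 1)
      have e2 := Nat.div_add_mod p (N - 1)
      rw [h1] at e1
      omega

theorem numbering_bijective (N p : ℕ) :
    Function.Bijective (fun i : Fin p =>
      (⟨cell N (Fin.rev i), cell_mem_diagram N p _ (Fin.rev i).isLt⟩ :
        {c // c ∈ (diagram N p).cells})) := by
  constructor
  · intro a b hab
    have h := Subtype.ext_iff.1 hab
    simp only [cell, Prod.mk.injEq] at h
    have e1 := Nat.div_add_mod (Fin.rev a : ℕ) (N - 1)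
    have e2 := Nat.div_add_mod (Fin.rev b : ℕ) (N - 1)
    rw [h.1, h.2, e2] at e1
    exact Fin.rev_injective (Fin.ext e1.symm)
  · rintro ⟨⟨i, j⟩, hc⟩
    have hc' := (mem_diagram_iff N p i j).1 hc
    have e2 := Nat.div_add_mod p (N - 1)
    have key : (N - 1) * i + j < p ∧ cell N ((N - 1) * i + j) = (i, j) := by
      rcases Nat.eq_zero_or_pos (N - 1) with h0 | h0
      · simp only [h0, Nat.div_zero, Nat.mod_zero, Nat.not_lt_zero, false_and, false_or] at hc'
        simp [cell, h0, hc'.1, hc'.2]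
      · have hj : j < N - 1 := by
          rcases hc' with h | h
          · exact h.2
          · exact h.2.trans (Nat.mod_lt _ h0)
        refine ⟨?_, ?_⟩
        · rcases hc' with h | h
          · have := Nat.mul_le_mul_left (N - 1) (Nat.succ_le_of_lt h.1)
            rw [Nat.mul_succ] at this
            omega
          · rw [h.1]; omega
        · simp only [cell, Prod.mk.injEq]
          rw [Nat.mul_add_div h0, Nat.mul_add_mod, Nat.div_eq_of_lt hj, Nat.mod_eq_of_lt hj]
          simp
    refine ⟨Fin.rev ⟨_, key.1⟩, ?_⟩
    apply Subtype.ext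
    simpa using key.2

/-- The numbering of the cells of `Y^N_p` by the tensor indices `μ 0, …, μ (p-1)`. The indices run
through the cells backwards, so that when a new index is put in front of the old ones
(degree `p` to degree `p + 1`), it occupies the cell by which `Y^N_{p+1}` exceeds `Y^N_p`, and the
old indices stay in their cells. -/
noncomputable def numbering (N p : ℕ) : Fin p ≃ {c // c ∈ (diagram N p).cells} :=
  Equiv.ofBijective _ (numbering_bijective N p)

/-- Covariant tensors of degree `p` on `ℝ^D`, by their components `T_{μ_1 … μ_p}`. -/
abbrev Tensor (D p : ℕ) : Type := (Fin p → Fin D) → ℝ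

/-- The action of a permutation of the indices on tensors. -/
def permute (D : ℕ) {p : ℕ} (σ : Equiv.Perm (Fin p)) : Tensor D p →ₗ[ℝ] Tensor D p :=
  LinearMap.funLeft ℝ ℝ (fun μ : Fin p → Fin D => μ ∘ σ)

section Symmetrizer

variable {μ : YoungDiagram} {p : ℕ}

/-- The permutations of the indices that preserve the rows of the tableau `t`. -/
def rowPerms (t : Fin p ≃ {c // c ∈ μ.cells}) : Finset (Equiv.Perm (Fin p)) :=
  {σ | ∀ i, (t (σ i)).1.1 = (t i).1.1}

/-- The permutations of the indices that preserve the columns of the tableau `t`. -/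
def colPerms (t : Fin p ≃ {c // c ∈ μ.cells}) : Finset (Equiv.Perm (Fin p)) :=
  {σ | ∀ i, (t (σ i)).1.2 = (t i).1.2}

/-- The hook length of a cell of a Young diagram. -/
def hookLength (μ : YoungDiagram) (c : ℕ × ℕ) : ℕ :=
  (μ.rowLen c.1 - c.2) + (μ.colLen c.2 - c.1) - 1

/-- The Young symmetrizer of the tableau `t` of shape `μ`: symmetrize along the rows, then
antisymmetrize along the columns, and divide by the product of the hook lengths (with this factor
it is the Young projector; for a single column it is the usual antisymmetrizer). -/
noncomputable def youngSymmetrizer (D : ℕ) (t : Fin p ≃ {c // c ∈ μ.cells}) :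
    Tensor D p →ₗ[ℝ] Tensor D p :=
  ((∏ c ∈ μ.cells, hookLength μ c : ℕ) : ℝ)⁻¹ •
    ((∑ σ ∈ colPerms t, ((Equiv.Perm.sign σ : ℤ) : ℝ) • permute D σ) ∘ₗ
      (∑ τ ∈ rowPerms t, permute D τ))

end Symmetrizer

/-- The Young symmetrizer on tensors of degree `p` for `Y^N_p`. -/
noncomputable def symY (N D p : ℕ) : Tensor D p →ₗ[ℝ] Tensor D p :=
  youngSymmetrizer D (numbering N p)

/-- `Ω_N^p(ℝ^D)`: the smooth covariant tensor fields of degree `p` on `ℝ^D` that have, at every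
point, the Young symmetry type `Y^N_p`. -/
noncomputable def Omega (N D p : ℕ) : Submodule ℝ ((Fin D → ℝ) → Tensor D p) where
  carrier := {T | ContDiff ℝ ∞ T ∧ ∀ x, T x ∈ LinearMap.range (symY N D p)}
  zero_mem' := ⟨contDiff_const, fun _ => Submodule.zero_mem _⟩
  add_mem' h₁ h₂ := ⟨h₁.1.add h₂.1, fun x => Submodule.add_mem _ (h₁.2 x) (h₂.2 x)⟩
  smul_mem' c _ h := ⟨contDiff_const.smul h.1, fun x => Submodule.smul_mem _ c (h.2 x)⟩

/-- `∂T`, with components `(∂T)_{μ_1 … μ_{p+1}} = ∂_{μ_1} T_{μ_2 … μ_{p+1}}`. -/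
noncomputable def partialD {D p : ℕ} (T : (Fin D → ℝ) → Tensor D p) :
    (Fin D → ℝ) → Tensor D (p + 1) :=
  fun x μ => fderiv ℝ T x (Pi.single (μ 0) 1) (Fin.tail μ)

theorem contDiff_partialD {D p : ℕ} {T : (Fin D → ℝ) → Tensor D p} (hT : ContDiff ℝ ∞ T) :
    ContDiff ℝ ∞ (partialD T) := by
  rw [contDiff_pi]
  intro μ
  have h : ContDiff ℝ ∞ (fun x => fderiv ℝ T x (Pi.single (μ 0) 1)) :=
    (hT.fderiv_right (m := ∞) (by simp)).clm_apply contDiff_const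
  exact (contDiff_pi.1 h) (Fin.tail μ)

/-- The differential `d = 𝐘_{p+1} ∘ ∂ : Ω_N^p(ℝ^D) → Ω_N^{p+1}(ℝ^D)`. -/
noncomputable def d (N D p : ℕ) : Omega N D p →ₗ[ℝ] Omega N D (p + 1) where
  toFun T := ⟨fun x => symY N D (p + 1) (partialD T.1 x),
    (LinearMap.toContinuousLinearMap (symY N D (p + 1))).contDiff.comp (contDiff_partialD T.2.1),
    fun _ => LinearMap.mem_range_self _ _⟩
  map_add' S T := by
    apply Subtype.ext
    funext x
    have hS := S.2.1.differentiable (by simp) x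
    have hT := T.2.1.differentiable (by simp) x
    have h : partialD (S.1 + T.1) x = partialD S.1 x + partialD T.1 x := by
      funext μ
      simp [partialD, fderiv_add hS hT]
    change symY N D (p + 1) (partialD (S.1 + T.1) x) = _
    rw [h, map_add]
    rfl
  map_smul' c T := by
    apply Subtype.ext
    funext x
    have hT := T.2.1.differentiable (by simp) x
    have h : partialD (c • T.1) x = c • partialD T.1 x := by
      funext μ
      simp [partialD, fderiv_const_smul hT]
    change symY N D (p + 1) (partialD (c • T.1) x) = _
    rw [h, map_smul]
    rfl

/-- The iterated differential `d^j : Ω_N^p(ℝ^D) → Ω_N^{p+j}(ℝ^D)`. -/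
noncomputable def dPow (N D p : ℕ) : (j : ℕ) → (Omega N D p →ₗ[ℝ] Omega N D (p + j))
  | 0 => LinearMap.id
  | j + 1 => d N D (p + j) ∘ₗ dPow N D p j

/-- `Ker (d^k : Ω_N^p(ℝ^D) → Ω_N^{p+k}(ℝ^D))`. -/
noncomputable def kerPow (N D k p : ℕ) : Submodule ℝ (Omega N D p) :=
  LinearMap.ker (dPow N D p k)

/-- `d^j (Ω_N^{p-j}(ℝ^D))`, a subspace of `Ω_N^p(ℝ^D)`; it is zero if `p < j`, as there are no
tensor fields of negative degree. -/
noncomputable def imPow (N D j p : ℕ) : Submodule ℝ (Omega N D p) :=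
  ⨆ (q : ℕ) (h : q + j = p), h ▸ LinearMap.range (dPow N D q j)

/-- The generalized cohomology
`H^p_{(k)}(Ω_N(ℝ^D)) = Ker (d^k : Ω_N^p → Ω_N^{p+k}) / d^{N-k}(Ω_N^{p+k-N})`. -/
abbrev Cohomology (N D k p : ℕ) : Type :=
  kerPow N D k p ⧸ (imPow N D (N - k) p).submoduleOf (kerPow N D k p)

/-- The class in `H^p_{(k)}` of an element of `Ker d^k`. -/
noncomputable def toCohomology (N D k p : ℕ) : kerPow N D k p →ₗ[ℝ] Cohomology N D k p :=
  ((imPow N D (N - k) p).submoduleOf (kerPow N D k p)).mkQ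

/-- The real polynomial functions on `ℝ^D` of degree less than `k` (the condition that every
monomial that occurs has degree less than `k` also makes sense for the zero polynomial). -/
noncomputable def polyFunctions (D k : ℕ) : Submodule ℝ ((Fin D → ℝ) → ℝ) where
  carrier := {f | ∃ P : MvPolynomial (Fin D) ℝ,
    (∀ m ∈ P.support, m.degree < k) ∧ ∀ x, f x = MvPolynomial.eval x P}
  zero_mem' := ⟨0, by simp, by simp⟩
  add_mem' := by
    rintro f g ⟨P, hP, hf⟩ ⟨Q, hQ, hg⟩
    classical
    refine ⟨P + Q, fun m hm => ?_, fun x => by simp [hf, hg]⟩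
    rcases Finset.mem_union.1 (MvPolynomial.support_add hm) with h | h
    · exact hP m h
    · exact hQ m h
  smul_mem' := by
    rintro c f ⟨P, hP, hf⟩
    exact ⟨c • P, fun m hm => hP m (MvPolynomial.support_smul hm), fun x => by
      simp [hf, MvPolynomial.smul_eval]⟩

end YoungComplex

/-! Put M = N - 1, and let S and A be the unnormalized symmetrization along rows and
antisymmetrization along columns. As there are only M columns, A kills every tensor that is
symmetric in M + 1 indices. Modulo such tensors, exchanges with the full rows reduce S σ S to a
multiple of S for every permutation σ (`exists_symSum_perm_sub_mem`). Hence A S is idempotent up to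
a nonzero factor, and the symmetrizer in degree p + 1 absorbs the one in degree p
(`IsFrame.exists_absorb`). So d^j T is a nonzero multiple of A S applied to the tensor of j-th
derivatives of T (`exists_components_dPow`).

In degree M n the diagram is a rectangle. The row-symmetric tensor W = S T is made a multiform: its
components become coefficients in an exterior algebra with one family of generators per column.
There the exterior derivatives d_a of the columns, the contractions K_a with the Euler vector field,
the derivations E_ab between columns and the Euler operator L generate an action of gl(1|M). The
rectangle makes E_ab act on W as n δ_ab, and d^k T = 0 makes all k-fold products of the d_a vanish
on W (`Fock.embed_mem_closedInvariants`).

Exactness is then algebra (`SuperRep.mem_dRange_of_mem_closedInvariants`). Let j = M + 1 - k = N - k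
and let X = ∑ d_{c_1} ⋯ d_{c_j} K_{c_j} ⋯ K_{c_1}, with values in the j-fold images of the d_a. For
a word d_I of length l < k, descending induction on l shows that d_I X and ∏_{s<j} (M - l - s)(L + n
+ s) d_I agree on such vectors modulo (l + j)-fold images. The numbers M - l - s do not vanish, and
L + n + s is inverted, as n ≥ 1, by averages ∫ t^m f(tx) dt. The case l = 0 puts W among the j-fold
images. Reading off coefficients, A W is a combination of permuted tensors of j-th derivatives, and
straightening moves the derivative indices into the last row (`youngOp_perm_gradIter_mem_range`); so
T lies in the image of d^j.

In degree 0 nothing is divided out. The k ≤ M derivatives fill one row, so there is nothing to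
antisymmetrize, and d^k f = 0 says that all partial derivatives of order k vanish, that is, f is a
polynomial of degree less than k. -/

namespace YoungComplex

open Equiv (swap)

/-! ### Symmetrization, antisymmetrization and straightening. -/

section Permutations

variable {D p : ℕ} {F : Type} [AddCommGroup F] [Module ℝ F]

/-- The action of a permutation of the indices on tensors with values in a real vector space. -/
def perm (σ : Equiv.Perm (Fin p)) : ((Fin p → Fin D) → F) →ₗ[ℝ] ((Fin p → Fin D) → F) :=
  LinearMap.funLeft ℝ F (fun μ : Fin p → Fin D => μ ∘ σ)

theorem perm_apply (σ : Equiv.Perm (Fin p)) (T : (Fin p → Fin D) → F) (μ : Fin p → Fin D) :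
    perm σ T μ = T (μ ∘ σ) := rfl

theorem perm_mul (σ τ : Equiv.Perm (Fin p)) (T : (Fin p → Fin D) → F) :
    perm (σ * τ) T = perm σ (perm τ T) := rfl

theorem perm_one (T : (Fin p → Fin D) → F) : perm 1 T = T := rfl

/-- The permutations of the indices that preserve a labelling of them. -/
def fiberPerms (f : Fin p → ℕ) : Finset (Equiv.Perm (Fin p)) := {σ | ∀ i, f (σ i) = f i}

section

variable {f : Fin p → ℕ} {σ τ : Equiv.Perm (Fin p)}

theorem mem_fiberPerms : σ ∈ fiberPerms f ↔ ∀ i, f (σ i) = f i := by simp [fiberPerms]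

theorem one_mem_fiberPerms : 1 ∈ fiberPerms f := mem_fiberPerms.2 fun _ => rfl

theorem mul_mem_fiberPerms (hσ : σ ∈ fiberPerms f) (hτ : τ ∈ fiberPerms f) :
    σ * τ ∈ fiberPerms f := by
  rw [mem_fiberPerms] at *
  intro i
  rw [Equiv.Perm.mul_apply, hσ, hτ]

theorem inv_mem_fiberPerms (hσ : σ ∈ fiberPerms f) : σ⁻¹ ∈ fiberPerms f := by
  rw [mem_fiberPerms] at *
  intro i
  rw [← hσ, Equiv.Perm.inv_def, Equiv.apply_symm_apply]

theorem inv_mem_fiberPerms_iff : σ⁻¹ ∈ fiberPerms f ↔ σ ∈ fiberPerms f :=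
  ⟨fun h => by simpa using inv_mem_fiberPerms h, inv_mem_fiberPerms⟩

theorem mul_mem_fiberPerms_iff (hτ : τ ∈ fiberPerms f) :
    σ * τ ∈ fiberPerms f ↔ σ ∈ fiberPerms f :=
  ⟨fun h => by simpa using mul_mem_fiberPerms h (inv_mem_fiberPerms hτ),
    fun h => mul_mem_fiberPerms h hτ⟩

theorem mul_mem_fiberPerms_iff' (hτ : τ ∈ fiberPerms f) :
    τ * σ ∈ fiberPerms f ↔ σ ∈ fiberPerms f :=
  ⟨fun h => by simpa using mul_mem_fiberPerms (inv_mem_fiberPerms hτ) h,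
    fun h => mul_mem_fiberPerms hτ h⟩

theorem swap_mem_fiberPerms {a b : Fin p} (h : f a = f b) : swap a b ∈ fiberPerms f := by
  rw [mem_fiberPerms]
  intro i
  rw [Equiv.swap_apply_def]
  split_ifs with h1 h2
  · rw [h1, h]
  · rw [h2, h]
  · rfl

end

/-- The symmetrization over the fibers of a labelling of the indices. -/
def symSum (f : Fin p → ℕ) : ((Fin p → Fin D) → F) →ₗ[ℝ] ((Fin p → Fin D) → F) :=
  ∑ σ ∈ fiberPerms f, perm σ

/-- The antisymmetrization over the fibers of a labelling of the indices. -/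
def altSum (f : Fin p → ℕ) : ((Fin p → Fin D) → F) →ₗ[ℝ] ((Fin p → Fin D) → F) :=
  ∑ σ ∈ fiberPerms f, ((Equiv.Perm.sign σ : ℤ) : ℝ) • perm σ

variable (f : Fin p → ℕ) (T : (Fin p → Fin D) → F)

theorem symSum_apply : symSum f T = ∑ σ ∈ fiberPerms f, perm σ T := by simp [symSum]

theorem altSum_apply :
    altSum f T = ∑ σ ∈ fiberPerms f, ((Equiv.Perm.sign σ : ℤ) : ℝ) • perm σ T := by simp [altSum]

variable {f}

theorem symSum_perm {τ : Equiv.Perm (Fin p)} (hτ : τ ∈ fiberPerms f) :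
    symSum f (perm τ T) = symSum f T := by
  rw [symSum_apply, symSum_apply]
  exact Finset.sum_equiv (Equiv.mulRight τ) (fun σ => (mul_mem_fiberPerms_iff hτ).symm)
    fun σ _ => (perm_mul _ _ _).symm

theorem perm_symSum {τ : Equiv.Perm (Fin p)} (hτ : τ ∈ fiberPerms f) :
    perm τ (symSum f T) = symSum f T := by
  rw [symSum_apply, map_sum]
  exact Finset.sum_equiv (Equiv.mulLeft τ) (fun σ => (mul_mem_fiberPerms_iff' hτ).symm)
    fun σ _ => (perm_mul _ _ _).symm

theorem sign_mul_self_real (τ : Equiv.Perm (Fin p)) :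
    ((Equiv.Perm.sign τ : ℤ) : ℝ) * ((Equiv.Perm.sign τ : ℤ) : ℝ) = 1 := by
  exact_mod_cast Int.units_coe_mul_self _

theorem altSum_perm {τ : Equiv.Perm (Fin p)} (hτ : τ ∈ fiberPerms f) :
    altSum f (perm τ T) = ((Equiv.Perm.sign τ : ℤ) : ℝ) • altSum f T := by
  rw [altSum_apply, altSum_apply, Finset.smul_sum]
  refine Finset.sum_equiv (Equiv.mulRight τ) (fun σ => (mul_mem_fiberPerms_iff hτ).symm)
    fun σ _ => ?_
  rw [Equiv.coe_mulRight, perm_mul, smul_smul, Equiv.Perm.sign_mul]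
  push_cast
  rw [mul_left_comm, sign_mul_self_real, mul_one]

theorem perm_altSum {τ : Equiv.Perm (Fin p)} (hτ : τ ∈ fiberPerms f) :
    perm τ (altSum f T) = ((Equiv.Perm.sign τ : ℤ) : ℝ) • altSum f T := by
  rw [altSum_apply, map_sum, Finset.smul_sum]
  refine Finset.sum_equiv (Equiv.mulLeft τ) (fun σ => (mul_mem_fiberPerms_iff' hτ).symm)
    fun σ _ => ?_
  rw [Equiv.coe_mulLeft, map_smul, perm_mul, smul_smul, Equiv.Perm.sign_mul]
  push_cast
  rw [← mul_assoc, sign_mul_self_real, one_mul]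

theorem card_fiberPerms_ne_zero : ((fiberPerms f).card : ℝ) ≠ 0 :=
  Nat.cast_ne_zero.2 (Finset.card_ne_zero_of_mem one_mem_fiberPerms)

theorem symSum_of_invariant {T : (Fin p → Fin D) → F} (h : ∀ τ ∈ fiberPerms f, perm τ T = T) :
    symSum f T = ((fiberPerms f).card : ℝ) • T := by
  rw [symSum_apply, Finset.sum_congr rfl h, Finset.sum_const, Nat.cast_smul_eq_nsmul]

theorem altSum_of_alternating {T : (Fin p → Fin D) → F}
    (h : ∀ τ ∈ fiberPerms f, perm τ T = ((Equiv.Perm.sign τ : ℤ) : ℝ) • T) :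
    altSum f T = ((fiberPerms f).card : ℝ) • T := by
  rw [altSum_apply]
  have h1 : ∀ τ ∈ fiberPerms f, ((Equiv.Perm.sign τ : ℤ) : ℝ) • perm τ T = T := by
    intro τ hτ
    rw [h τ hτ, smul_smul, sign_mul_self_real, one_smul]
  rw [Finset.sum_congr rfl h1, Finset.sum_const, Nat.cast_smul_eq_nsmul]

theorem symSum_symSum : symSum f (symSum f T) = ((fiberPerms f).card : ℝ) • symSum f T :=
  symSum_of_invariant fun _ hτ => perm_symSum T hτ

theorem altSum_altSum : altSum f (altSum f T) = ((fiberPerms f).card : ℝ) • altSum f T :=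
  altSum_of_alternating fun _ hτ => perm_altSum T hτ

/-- A tensor is symmetric in a set of indices. -/
def SymmetricOn (Z : Finset (Fin p)) (T : (Fin p → Fin D) → F) : Prop :=
  ∀ a ∈ Z, ∀ b ∈ Z, perm (swap a b) T = T

/-- The span of the tensors that are symmetric in more than `M` indices. -/
def overSymmetric (M : ℕ) : Submodule ℝ ((Fin p → Fin D) → F) :=
  Submodule.span ℝ {T | ∃ Z : Finset (Fin p), Z.card = M + 1 ∧ SymmetricOn Z T}

variable {T} {M : ℕ}

theorem SymmetricOn.mem_overSymmetric {Z : Finset (Fin p)} (h : SymmetricOn Z T)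
    (hZ : Z.card = M + 1) : T ∈ overSymmetric M :=
  Submodule.subset_span ⟨Z, hZ, h⟩

theorem SymmetricOn.perm {Z : Finset (Fin p)} (h : SymmetricOn Z T) (σ : Equiv.Perm (Fin p)) :
    SymmetricOn (Z.map σ.toEmbedding) (perm σ T) := by
  intro a ha b hb
  rw [Finset.mem_map_equiv] at ha hb
  have h1 : swap a b * σ = σ * swap (σ.symm a) (σ.symm b) := by
    rw [Equiv.mul_swap_eq_swap_mul, Equiv.apply_symm_apply, Equiv.apply_symm_apply]
  rw [← perm_mul, h1, perm_mul, h _ ha _ hb]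

theorem perm_mem_overSymmetric (σ : Equiv.Perm (Fin p)) (hT : T ∈ overSymmetric M) :
    perm σ T ∈ overSymmetric M := by
  refine (Submodule.span_le (p := (overSymmetric M).comap (perm σ))).2 ?_ hT
  rintro U ⟨Z, hZ, h⟩
  exact (h.perm σ).mem_overSymmetric (by rw [Finset.card_map, hZ])

theorem symSum_mem_overSymmetric (f : Fin p → ℕ) (hT : T ∈ overSymmetric M) :
    symSum f T ∈ overSymmetric M := by
  rw [symSum_apply]
  exact Submodule.sum_mem _ fun σ _ => perm_mem_overSymmetric σ hT

/-- Pigeonhole: among M + 1 symmetric indices two have the same label, and their transposition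
multiplies the antisymmetrization by both 1 and -1. -/
theorem altSum_eq_zero (hf : ∀ i, f i < M) (hT : T ∈ overSymmetric M) : altSum f T = 0 := by
  refine (Submodule.span_le (p := LinearMap.ker (altSum f))).2 ?_ hT
  rintro U ⟨Z, hZ, h⟩
  obtain ⟨a, ha, b, hb, hab, hfab⟩ := Finset.exists_ne_map_eq_of_card_lt_of_maps_to
    (s := Z) (t := Finset.range M) (by simp [hZ]) (f := f) (fun i _ => by simpa using hf i)
  have h1 := altSum_perm U (swap_mem_fiberPerms hfab)
  rw [h a ha b hb, Equiv.Perm.sign_swap hab] at h1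
  have h2 : (2 : ℝ) • altSum f U = 0 := by
    rw [two_smul]
    nth_rewrite 1 [h1]
    simp
  exact (smul_eq_zero.1 h2).resolve_left two_ne_zero

/-- The permutations that fix the indices outside a set. -/
def supportedPerms (Z : Finset (Fin p)) : Finset (Equiv.Perm (Fin p)) := {σ | ∀ i ∉ Z, σ i = i}

theorem mem_supportedPerms {Z : Finset (Fin p)} {σ : Equiv.Perm (Fin p)} :
    σ ∈ supportedPerms Z ↔ ∀ i ∉ Z, σ i = i := by simp [supportedPerms]

theorem apply_mem_of_mem_supportedPerms {Z : Finset (Fin p)} {σ : Equiv.Perm (Fin p)}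
    (hσ : σ ∈ supportedPerms Z) {i : Fin p} (hi : i ∈ Z) : σ i ∈ Z := by
  by_contra h
  have h1 := mem_supportedPerms.1 hσ _ h
  exact h ((σ.injective h1).symm ▸ hi)

theorem inv_apply_mem_of_mem_supportedPerms {Z : Finset (Fin p)} {σ : Equiv.Perm (Fin p)}
    (hσ : σ ∈ supportedPerms Z) {i : Fin p} (hi : i ∈ Z) : σ.symm i ∈ Z := by
  by_contra h
  have h1 := mem_supportedPerms.1 hσ _ h
  rw [Equiv.apply_symm_apply] at h1
  exact h (h1 ▸ hi)

theorem symmetricOn_sum_supportedPerms (Z : Finset (Fin p)) (T : (Fin p → Fin D) → F) :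
    SymmetricOn Z (∑ π ∈ supportedPerms Z, perm π T) := by
  intro a ha b hb
  rw [map_sum]
  refine Finset.sum_equiv (Equiv.mulLeft (swap a b)) (fun σ => ?_) fun σ _ => (perm_mul _ _ _).symm
  rw [mem_supportedPerms, mem_supportedPerms]
  refine forall₂_congr fun i hi => ?_
  rw [Equiv.coe_mulLeft, Equiv.Perm.mul_apply]
  have hia : i ≠ a := fun h => hi (h ▸ ha)
  have hib : i ≠ b := fun h => hi (h ▸ hb)
  rw [← Equiv.apply_eq_iff_eq (swap a b), Equiv.swap_apply_of_ne_of_ne hia hib]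

/-- The exchange relation between a row with `M` cells and a further cell. -/
theorem sum_symSum_swap_mem {B : Finset (Fin p)} (hB : B.card = M)
    (hBf : supportedPerms B ⊆ fiberPerms f) {b : Fin p} (hb : b ∉ B)
    (T : (Fin p → Fin D) → F) :
    ∑ π ∈ supportedPerms (insert b B), symSum f (perm (swap (π.symm b) b) T) ∈ overSymmetric M := by
  have h1 : ∀ π ∈ supportedPerms (insert b B),
      symSum f (perm (swap (π.symm b) b) T) = symSum f (perm π T) := by
    intro π hπ
    -- This product fixes b, so it only permutes the row B and is absorbed by the symmetrization.
    have h2 : π * swap (π.symm b) b ∈ fiberPerms f := by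
      refine hBf (mem_supportedPerms.2 fun i hi => ?_)
      by_cases hib : i = b
      · rw [hib, Equiv.Perm.mul_apply, Equiv.swap_apply_right, Equiv.apply_symm_apply]
      · have hiZ : i ∉ insert b B := by simp [hib, hi]
        have h3 := mem_supportedPerms.1 hπ i hiZ
        rw [Equiv.Perm.mul_apply, Equiv.swap_apply_of_ne_of_ne _ hib, h3]
        rintro rfl
        exact hiZ (inv_apply_mem_of_mem_supportedPerms hπ (Finset.mem_insert_self _ _))
    rw [← symSum_perm _ h2, ← perm_mul, mul_assoc, Equiv.swap_mul_self, mul_one]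
  rw [Finset.sum_congr rfl h1, ← map_sum]
  exact symSum_mem_overSymmetric f ((symmetricOn_sum_supportedPerms _ T).mem_overSymmetric
    (by rw [Finset.card_insert_of_notMem hb, hB]))

theorem supportedPerms_fiber_subset (f : Fin p → ℕ) (i : ℕ) :
    supportedPerms {x | f x = i} ⊆ fiberPerms f := by
  intro σ hσ
  rw [mem_fiberPerms]
  intro x
  by_cases hx : f x = i
  · have := apply_mem_of_mem_supportedPerms hσ (i := x) (by simpa using hx)
    simp only [Finset.mem_filter, Finset.mem_univ, true_and] at this
    rw [this, hx]
  · rw [mem_supportedPerms.1 hσ x (by simpa using hx)]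

theorem card_filter_comp_perm (f : Fin p → ℕ) (σ : Equiv.Perm (Fin p)) (i : ℕ) :
    (Finset.univ.filter fun x => f (σ x) = i).card = (Finset.univ.filter fun x => f x = i).card :=
  Finset.card_equiv σ (by simp)

/-- Straightening: modulo tensors symmetric in more than `M` indices, the symmetrization of any
permutation of a symmetrized tensor is a multiple of this tensor. -/
theorem exists_symSum_perm_sub_mem (f : Fin p → ℕ)
    (hf : ∀ x y, (Finset.univ.filter fun z => f z = f x).card ≠ M →
      (Finset.univ.filter fun z => f z = f y).card ≠ M → f x = f y) (σ : Equiv.Perm (Fin p)) :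
    ∃ c : ℝ, ∀ (D : ℕ) (F : Type) [AddCommGroup F] [Module ℝ F] (W : (Fin p → Fin D) → F),
      (∀ τ ∈ fiberPerms f, perm τ W = W) → symSum f (perm σ W) - c • W ∈ overSymmetric M := by
  -- Induction on the number of indices that σ brings in from another row.
  induction h : (Finset.univ.filter fun x => f (σ.symm x) ≠ f x).card using Nat.strong_induction_on
    generalizing σ with
  | _ m ih =>
    by_cases hσ : ∀ x, f (σ.symm x) = f x
    · refine ⟨(fiberPerms f).card, fun D F _ _ W hW => ?_⟩
      rw [hW σ (inv_mem_fiberPerms_iff.1 (mem_fiberPerms.2 hσ)), symSum_of_invariant hW, sub_self]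
      exact Submodule.zero_mem _
    -- The exchange needs a full row i that σ leaves towards some b. One of the two rows met by a
    -- misplaced x is full. If it is the row that x comes from, take b = x; if it is the row that x
    -- enters, counting shows that σ also carries an index out of it.
    obtain ⟨i, b, hi, hbi, hgb⟩ : ∃ i b, (Finset.univ.filter fun z => f z = i).card = M ∧
        f b ≠ i ∧ f (σ.symm b) = i := by
      push Not at hσ
      obtain ⟨x, hx⟩ := hσ
      by_cases h1 : (Finset.univ.filter fun z => f z = f (σ.symm x)).card = M
      · exact ⟨_, x, h1, hx.symm, rfl⟩
      by_cases h2 : (Finset.univ.filter fun z => f z = f x).card = M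
      · refine ⟨f x, ?_⟩
        by_contra hcon
        push Not at hcon
        have h3 : (Finset.univ.filter fun z => f (σ.symm z) = f x) ⊂
            (Finset.univ.filter fun z => f z = f x) := by
          refine ⟨fun z hz => ?_, fun hsub => ?_⟩
          · simp only [Finset.mem_filter, Finset.mem_univ, true_and] at hz ⊢
            by_contra h4
            exact hcon z h2 h4 hz
          · have := hsub (show x ∈ Finset.univ.filter fun z => f z = f x by simp)
            simp only [Finset.mem_filter, Finset.mem_univ, true_and] at this
            exact hx this
        exact (Finset.card_lt_card h3).ne (card_filter_comp_perm f σ.symm (f x))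
      · exact absurd (hf _ _ h1 h2) hx
    set B : Finset (Fin p) := Finset.univ.filter fun z => f z = i with hBdef
    have hb : b ∉ B := by simpa [hBdef] using hbi
    -- The constants are fixed before `D`, `F` and `W`, so that the final one is universal; 0 is a
    -- filler for the π that do not matter.
    have key : ∀ π : Equiv.Perm (Fin p), ∃ c : ℝ, π ∈ supportedPerms (insert b B) →
        f (σ.symm (π.symm b)) ≠ i →
        ∀ (D : ℕ) (F : Type) [AddCommGroup F] [Module ℝ F] (W : (Fin p → Fin D) → F),
        (∀ τ ∈ fiberPerms f, perm τ W = W) →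
        symSum f (perm (swap (π.symm b) b) (perm σ W)) - c • W ∈ overSymmetric M := by
      intro π
      by_cases hπ : π ∈ supportedPerms (insert b B) ∧ f (σ.symm (π.symm b)) ≠ i
      · have hzb : π.symm b ≠ b := fun h => hπ.2 (by rw [h]; exact hgb)
        have hzB : f (π.symm b) = i := by
          have := inv_apply_mem_of_mem_supportedPerms hπ.1 (Finset.mem_insert_self b B)
          simpa [hBdef] using (Finset.mem_insert.1 this).resolve_left hzb
        have hlt : (Finset.univ.filter fun x => f ((swap (π.symm b) b * σ).symm x) ≠ f x).card < m := by
          rw [← h]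
          refine Finset.card_lt_card ⟨fun x hx => ?_, fun hsub => ?_⟩
          · rw [Finset.mem_filter] at hx ⊢
            refine ⟨hx.1, ?_⟩
            replace hx : f (σ.symm (swap (π.symm b) b x)) ≠ f x := hx.2
            by_cases h1 : x = π.symm b
            · rw [h1, hzB]; exact hπ.2
            by_cases h2 : x = b
            · rw [h2, hgb]; exact hbi.symm
            · rwa [Equiv.swap_apply_of_ne_of_ne h1 h2] at hx
          · refine (Finset.mem_filter.1 (hsub (Finset.mem_filter.2
              ⟨Finset.mem_univ (π.symm b), ?_⟩))).2 ?_
            · rw [hzB]; exact hπ.2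
            · change f (σ.symm (swap (π.symm b) b (π.symm b))) = _
              rw [Equiv.swap_apply_left, hgb, hzB]
        obtain ⟨c, hc⟩ := ih _ hlt _ rfl
        exact ⟨c, fun _ _ D F _ _ W hW => hc D F W hW⟩
      · exact ⟨0, fun h1 h2 => absurd ⟨h1, h2⟩ hπ⟩
    choose c hc using key
    -- In the exchange relation, the terms of `P₁` (the identity among them) all equal the wanted
    -- one, by the row symmetry of `W`. Those of `P₂` put b's source into its row and fall under the
    -- induction.
    set P₁ := (supportedPerms (insert b B)).filter fun π => f (σ.symm (π.symm b)) = i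
    set P₂ := (supportedPerms (insert b B)).filter fun π => ¬ f (σ.symm (π.symm b)) = i
    have hP₁ : (P₁.card : ℝ) ≠ 0 := by
      refine Nat.cast_ne_zero.2 (Finset.card_ne_zero_of_mem (a := 1) ?_)
      exact Finset.mem_filter.2 ⟨mem_supportedPerms.2 fun _ _ => rfl, hgb⟩
    refine ⟨- ((P₁.card : ℝ)⁻¹ * ∑ π ∈ P₂, c π), fun D F _ _ W hW => ?_⟩
    have h1 := sum_symSum_swap_mem hi (supportedPerms_fiber_subset f i) hb (perm σ W)
    rw [← Finset.sum_filter_add_sum_filter_not _ fun π => f (σ.symm (π.symm b)) = i] at h1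
    have h2 : ∀ π ∈ P₁, symSum f (perm (swap (π.symm b) b) (perm σ W)) = symSum f (perm σ W) := by
      intro π hπ
      have h3 : swap (π.symm b) b * σ = σ * swap (σ.symm (π.symm b)) (σ.symm b) := by
        rw [Equiv.mul_swap_eq_swap_mul, Equiv.apply_symm_apply, Equiv.apply_symm_apply]
      rw [← perm_mul, h3, perm_mul, hW]
      exact swap_mem_fiberPerms (by rw [hgb]; exact (Finset.mem_filter.1 hπ).2)
    rw [Finset.sum_congr rfl h2, Finset.sum_const, ← Nat.cast_smul_eq_nsmul ℝ] at h1
    have h4 : ∑ π ∈ P₂, (symSum f (perm (swap (π.symm b) b) (perm σ W)) - c π • W) ∈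
        overSymmetric M := Submodule.sum_mem _ fun π hπ =>
      hc π (Finset.mem_filter.1 hπ).1 (Finset.mem_filter.1 hπ).2 D F W hW
    have h5 := Submodule.smul_mem _ (P₁.card : ℝ)⁻¹ (Submodule.sub_mem _ h1 h4)
    convert h5 using 1
    rw [Finset.sum_sub_distrib, ← Finset.sum_smul]
    change _ = (P₁.card : ℝ)⁻¹ • ((P₁.card : ℝ) • symSum f (perm σ W) + ∑ π ∈ P₂, _ - _)
    rw [add_comm ((P₁.card : ℝ) • _), add_sub_sub_cancel, smul_add, smul_smul, smul_smul, inv_mul_cancel₀ hP₁, one_smul,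
      neg_smul, sub_neg_eq_add]

/-- Straightening of the permuted copies of a tensor that is symmetric in a set of indices
contained in a row with `M` cells. -/
theorem symSum_perm_mem_sup (f : Fin p → ℕ) {i : ℕ}
    (hi : (Finset.univ.filter fun z => f z = i).card = M) {X : Finset (Fin p)}
    (hX : ∀ x ∈ X, f x = i) (hT : SymmetricOn X T) (σ : Equiv.Perm (Fin p)) :
    symSum f (perm σ T) ∈ overSymmetric M ⊔
      Submodule.span ℝ {U | ∃ τ : Equiv.Perm (Fin p), (∀ x ∈ X, τ x = x) ∧
        U = symSum f (perm τ T)} := by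
  set V := overSymmetric M ⊔ Submodule.span ℝ {U | ∃ τ : Equiv.Perm (Fin p),
    (∀ x ∈ X, τ x = x) ∧ U = symSum f (perm τ T)} with hV
  -- Two inductions: exchanges first bring the images of X into row i, then transpositions within
  -- the row make σ fix X pointwise.
  induction h : (X.filter fun x => f (σ x) ≠ i).card using Nat.strong_induction_on
    generalizing σ with
  | _ m ih =>
    by_cases hσ : ∀ x ∈ X, f (σ x) = i
    · clear ih h
      induction h : (X.filter fun x => σ x ≠ x).card using Nat.strong_induction_on
        generalizing σ with
      | _ m ih =>
        by_cases hfix : ∀ x ∈ X, σ x = x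
        · exact Submodule.mem_sup_right (Submodule.subset_span ⟨σ, hfix, rfl⟩)
        push Not at hfix
        obtain ⟨x, hxX, hx⟩ := hfix
        have hs : swap x (σ x) ∈ fiberPerms f := swap_mem_fiberPerms (by rw [hX x hxX, hσ x hxX])
        rw [← symSum_perm _ hs, ← perm_mul]
        refine ih _ ?_ _ (fun y hy => ?_) rfl
        · rw [← h]
          refine Finset.card_lt_card ⟨fun y hy => ?_, fun hsub => ?_⟩
          · rw [Finset.mem_filter] at hy ⊢
            refine ⟨hy.1, fun hy' => hy.2 ?_⟩
            rw [Equiv.Perm.mul_apply, hy']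
            refine Equiv.swap_apply_of_ne_of_ne (fun h1 => hx (h1 ▸ hy')) fun h1 => hx ?_
            rw [h1, Equiv.apply_eq_iff_eq] at hy'
            exact hy'
          · exact (Finset.mem_filter.1 (hsub (Finset.mem_filter.2 ⟨hxX, hx⟩))).2
              (Equiv.swap_apply_right _ _)
        · rw [Equiv.Perm.mul_apply, mem_fiberPerms.1 hs, hσ y hy]
    push Not at hσ
    obtain ⟨x, hxX, hx⟩ := hσ
    set B : Finset (Fin p) := Finset.univ.filter fun z => f z = i with hBdef
    have hb : σ x ∉ B := by simpa [hBdef] using hx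
    have h1 := sum_symSum_swap_mem hi (supportedPerms_fiber_subset f i) hb (perm σ T)
    -- The terms in which x is exchanged with an element of X are all equal, by the symmetry of `T`
    -- in X. In the others one more element of X gets into row i.
    rw [← Finset.sum_filter_add_sum_filter_not _ fun π => σ.symm (π.symm (σ x)) ∈ X] at h1
    set P₁ := (supportedPerms (insert (σ x) B)).filter fun π => σ.symm (π.symm (σ x)) ∈ X
    have hP₁ : (P₁.card : ℝ) ≠ 0 := by
      refine Nat.cast_ne_zero.2 (Finset.card_ne_zero_of_mem (a := 1) ?_)
      refine Finset.mem_filter.2 ⟨mem_supportedPerms.2 fun _ _ => rfl, ?_⟩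
      change σ.symm (σ x) ∈ X
      rwa [Equiv.symm_apply_apply]
    have h2 : ∀ π ∈ P₁, symSum f (perm (swap (π.symm (σ x)) (σ x)) (perm σ T)) =
        symSum f (perm σ T) := by
      intro π hπ
      have h3 : swap (π.symm (σ x)) (σ x) * σ = σ * swap (σ.symm (π.symm (σ x))) x := by
        rw [Equiv.mul_swap_eq_swap_mul, Equiv.apply_symm_apply]
      rw [← perm_mul, h3, perm_mul, hT _ (Finset.mem_filter.1 hπ).2 _ hxX]
    rw [Finset.sum_congr rfl h2, Finset.sum_const, ← Nat.cast_smul_eq_nsmul ℝ] at h1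
    refine (Submodule.smul_mem_iff _ hP₁).1 ((Submodule.add_mem_iff_left _ ?_).1
      (Submodule.mem_sup_left (T := Submodule.span ℝ {U | ∃ τ : Equiv.Perm (Fin p),
        (∀ x ∈ X, τ x = x) ∧ U = symSum f (perm τ T)}) h1))
    refine Submodule.sum_mem _ fun π hπ => ?_
    obtain ⟨hπ, hπX⟩ := Finset.mem_filter.1 hπ
    have hzb : π.symm (σ x) ≠ σ x := fun h => hπX (by rw [h]; simpa using hxX)
    have hzB : f (π.symm (σ x)) = i := by
      have := inv_apply_mem_of_mem_supportedPerms hπ (Finset.mem_insert_self (σ x) B)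
      simpa [hBdef] using (Finset.mem_insert.1 this).resolve_left hzb
    rw [← perm_mul]
    refine ih _ ?_ _ rfl
    rw [← h]
    refine Finset.card_lt_card ⟨fun y hy => ?_, fun hsub => ?_⟩
    · rw [Finset.mem_filter] at hy ⊢
      refine ⟨hy.1, ?_⟩
      by_cases hyx : y = x
      · rw [hyx]; exact hx
      · rw [Equiv.Perm.mul_apply, Equiv.swap_apply_of_ne_of_ne (fun h3 => hπX (by rw [← h3]; simpa using hy.1))
          (fun h3 => hyx (σ.injective h3))] at hy
        exact hy.2
    · refine (Finset.mem_filter.1 (hsub (Finset.mem_filter.2 ⟨hxX, hx⟩))).2 ?_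
      rw [Equiv.Perm.mul_apply, Equiv.swap_apply_right, hzB]

end Permutations

/-! ### Young symmetrizers: idempotence and absorption. -/

section Young

variable {p M : ℕ}

/-- The pairing of two tensors. -/
def pairing {D : ℕ} (T U : (Fin p → Fin D) → ℝ) : ℝ := ∑ μ, T μ * U μ

variable {D : ℕ}

theorem pairing_self_eq_zero {T : (Fin p → Fin D) → ℝ} (h : pairing T T = 0) : T = 0 := by
  funext μ
  have := (Finset.sum_eq_zero_iff_of_nonneg fun ν _ => mul_self_nonneg (T ν)).1 h μ
    (Finset.mem_univ μ)
  simpa using this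

theorem pairing_perm (σ : Equiv.Perm (Fin p)) (T U : (Fin p → Fin D) → ℝ) :
    pairing (perm σ T) U = pairing T (perm σ⁻¹ U) := by
  refine Fintype.sum_equiv (Equiv.arrowCongr σ.symm (Equiv.refl _)) _ _ fun μ => ?_
  have h : (Equiv.arrowCongr σ.symm (Equiv.refl (Fin D))) μ = μ ∘ σ := by
    funext i; simp [Equiv.arrowCongr]
  rw [h, perm_apply, perm_apply]
  congr 2
  funext i
  simp

theorem pairing_symSum (f : Fin p → ℕ) (T U : (Fin p → Fin D) → ℝ) :
    pairing (symSum f T) U = pairing T (symSum f U) := by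
  have h1 : pairing (symSum f T) U = ∑ σ ∈ fiberPerms f, pairing (perm σ T) U := by
    simp only [pairing, symSum_apply, Finset.sum_apply, Finset.sum_mul]
    rw [Finset.sum_comm]
  have h2 : pairing T (symSum f U) = ∑ σ ∈ fiberPerms f, pairing T (perm σ U) := by
    simp only [pairing, symSum_apply, Finset.sum_apply, Finset.mul_sum]
    rw [Finset.sum_comm]
  rw [h1, h2]
  exact Finset.sum_equiv (Equiv.inv _) (fun σ => inv_mem_fiberPerms_iff.symm)
    fun σ _ => pairing_perm σ T U

theorem pairing_altSum (f : Fin p → ℕ) (T U : (Fin p → Fin D) → ℝ) :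
    pairing (altSum f T) U = pairing T (altSum f U) := by
  have h1 : pairing (altSum f T) U =
      ∑ σ ∈ fiberPerms f, ((Equiv.Perm.sign σ : ℤ) : ℝ) * pairing (perm σ T) U := by
    simp only [pairing, altSum_apply, Finset.sum_apply, Finset.sum_mul, Finset.mul_sum,
      Pi.smul_apply, smul_eq_mul, mul_assoc]
    rw [Finset.sum_comm]
  have h2 : pairing T (altSum f U) =
      ∑ σ ∈ fiberPerms f, ((Equiv.Perm.sign σ : ℤ) : ℝ) * pairing T (perm σ U) := by
    simp only [pairing, altSum_apply, Finset.sum_apply, Finset.mul_sum,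
      Pi.smul_apply, smul_eq_mul, mul_left_comm]
    rw [Finset.sum_comm]
  rw [h1, h2]
  refine Finset.sum_equiv (Equiv.inv _) (fun σ => inv_mem_fiberPerms_iff.symm) fun σ _ => ?_
  rw [pairing_perm, Equiv.inv_apply, Equiv.Perm.sign_inv]

/-- The product of an antisymmetrizer and a symmetrizer whose groups meet trivially is not zero. -/
theorem exists_altSum_symSum_ne_zero {row col : Fin p → ℕ}
    (hinj : ∀ a b, row a = row b → col a = col b → a = b) :
    ∃ T : (Fin p → Fin p) → ℝ, altSum col (symSum row T) ≠ 0 := by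
  -- With as many index values as indices, the basis tensor of `id` detects permutations: the value
  -- at `id` of its image under στ is 1 if στ = 1 and 0 otherwise.
  refine ⟨Pi.single id 1, fun h => ?_⟩
  have h1 : ∀ σ ∈ fiberPerms col, ∀ τ ∈ fiberPerms row,
      perm σ (perm τ (Pi.single id (1 : ℝ))) (id : Fin p → Fin p) =
        if σ = 1 ∧ τ = 1 then 1 else 0 := by
    intro σ hσ τ hτ
    rw [← perm_mul, perm_apply, Pi.single_apply]
    congr 1
    rw [eq_iff_iff]
    constructor
    · intro h2
      have h3 : ∀ i, σ (τ i) = i := fun i => congrFun h2 i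
      have h4 : ∀ i, τ i = i := by
        intro i
        refine hinj _ _ (mem_fiberPerms.1 hτ i) ?_
        rw [← mem_fiberPerms.1 hσ (τ i), h3]
      exact ⟨Equiv.ext fun i => by simpa [h4] using h3 i, Equiv.ext h4⟩
    · rintro ⟨rfl, rfl⟩
      rfl
  have h2 := congrFun h id
  rw [altSum_apply, Finset.sum_apply] at h2
  simp only [Pi.smul_apply, symSum_apply, map_sum, Finset.sum_apply, smul_eq_mul] at h2
  rw [Finset.sum_congr rfl fun σ hσ => by rw [Finset.sum_congr rfl (h1 σ hσ)]] at h2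
  rw [Finset.sum_eq_single 1] at h2
  · rw [Finset.sum_eq_single 1] at h2
    · simp at h2
    · intro τ _ hτ; simp [hτ]
    · intro h3; exact absurd one_mem_fiberPerms h3
  · intro σ _ hσ; simp [hσ]
  · intro h3; exact absurd one_mem_fiberPerms h3

/-- Labellings of the indices by the rows and columns of a Young diagram that has `M` columns, all
of its rows but one having `M` cells. -/
structure IsFrame (M : ℕ) (row col : Fin p → ℕ) : Prop where
  col_lt : ∀ i, col i < M
  row_full : ∀ x y, (Finset.univ.filter fun z => row z = row x).card ≠ M →
    (Finset.univ.filter fun z => row z = row y).card ≠ M → row x = row y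
  inj : ∀ a b, row a = row b → col a = col b → a = b

/-- Straightening each term of A gives the constant. It is the same for all `D` and `F`, so it can
be tested on real tensors with `D = p`: were it zero, A S A S would vanish. Since A and S are
self-adjoint for a definite pairing and are multiples of projections, this forces A S A = 0, then S
A = 0, then A S = 0. -/
theorem IsFrame.exists_const {row col : Fin p → ℕ} (h : IsFrame M row col) :
    ∃ c : ℝ, c ≠ 0 ∧ ∀ (D : ℕ) (F : Type) [AddCommGroup F] [Module ℝ F]
      (W : (Fin p → Fin D) → F),
      symSum row (altSum col (symSum row W)) - c • symSum row W ∈ overSymmetric M := by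
  choose c hc using exists_symSum_perm_sub_mem row h.row_full
  have key : ∀ (D : ℕ) (F : Type) [AddCommGroup F] [Module ℝ F] (W : (Fin p → Fin D) → F),
      symSum row (altSum col (symSum row W)) -
        (∑ σ ∈ fiberPerms col, ((Equiv.Perm.sign σ : ℤ) : ℝ) * c σ) • symSum row W ∈
          overSymmetric M := by
    intro D F _ _ W
    rw [altSum_apply, map_sum, Finset.sum_smul, ← Finset.sum_sub_distrib]
    refine Submodule.sum_mem _ fun σ _ => ?_
    rw [map_smul, mul_smul, ← smul_sub]
    exact Submodule.smul_mem _ _ (hc σ D F _ fun τ hτ => perm_symSum W hτ)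
  refine ⟨_, fun h0 => ?_, key⟩
  obtain ⟨T, hT⟩ := exists_altSum_symSum_ne_zero h.inj
  refine hT ?_
  have h1 : ∀ W : (Fin p → Fin p) → ℝ,
      altSum col (symSum row (altSum col (symSum row W))) = 0 := by
    intro W
    have := altSum_eq_zero h.col_lt (key p ℝ W)
    rwa [h0, zero_smul, sub_zero] at this
  have h2 : ∀ W : (Fin p → Fin p) → ℝ, altSum col (symSum row (altSum col W)) = 0 := by
    intro W
    apply pairing_self_eq_zero
    rw [pairing_altSum, pairing_symSum, pairing_altSum, altSum_altSum]
    simp [h1, pairing]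
  have h3 : ∀ W : (Fin p → Fin p) → ℝ, symSum row (altSum col W) = 0 := by
    intro W
    apply pairing_self_eq_zero
    rw [pairing_symSum, pairing_altSum, symSum_symSum]
    simp [h2, pairing]
  apply pairing_self_eq_zero
  rw [pairing_altSum, pairing_symSum, altSum_altSum]
  simp [h3, pairing]

/-- The permutation of `p + 1` indices that acts on the last `p` of them. -/
def liftPerm (σ : Equiv.Perm (Fin p)) : Equiv.Perm (Fin (p + 1)) :=
  Equiv.Perm.decomposeFin.symm (0, σ)

@[simp] theorem liftPerm_zero (σ : Equiv.Perm (Fin p)) : liftPerm σ 0 = 0 := by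
  simp [liftPerm]

@[simp] theorem liftPerm_succ (σ : Equiv.Perm (Fin p)) (i : Fin p) :
    liftPerm σ i.succ = (σ i).succ := by
  simp [liftPerm]

theorem exists_eq_liftPerm {σ : Equiv.Perm (Fin (p + 1))} (h : σ 0 = 0) : ∃ τ, σ = liftPerm τ := by
  obtain ⟨⟨q, τ⟩, rfl⟩ := Equiv.Perm.decomposeFin.symm.surjective σ
  rw [Equiv.Perm.decomposeFin_symm_apply_zero] at h
  exact ⟨τ, by rw [liftPerm, h]⟩

variable {F : Type} [AddCommGroup F] [Module ℝ F]

/-- The tensor of degree `p + 1` with given components for every value of the first index. -/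
def consTensor (V : Fin D → (Fin p → Fin D) → F) : (Fin (p + 1) → Fin D) → F :=
  fun μ => V (μ 0) (Fin.tail μ)

theorem perm_liftPerm_consTensor (σ : Equiv.Perm (Fin p)) (V : Fin D → (Fin p → Fin D) → F) :
    perm (liftPerm σ) (consTensor V) = consTensor fun ν => perm σ (V ν) := by
  funext μ
  simp only [perm_apply, consTensor, Function.comp_apply, liftPerm_zero]
  congr 1

theorem consTensor_sum {F : Type} [AddCommGroup F] {ι : Type*} (s : Finset ι)
    (V : ι → Fin D → (Fin p → Fin D) → F) :
    consTensor (fun ν => ∑ i ∈ s, V i ν) = ∑ i ∈ s, consTensor (V i) := by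
  funext μ
  simp [consTensor, Finset.sum_apply]

theorem consTensor_smul (c : ℝ) (V : Fin D → (Fin p → Fin D) → F) :
    consTensor (fun ν => c • V ν) = c • consTensor V := rfl

theorem consTensor_sub {F : Type} [AddCommGroup F] (V W : Fin D → (Fin p → Fin D) → F) :
    consTensor (fun ν => V ν - W ν) = consTensor V - consTensor W := rfl

/-- The symmetric sets may differ with the value of the first index, so V is split into pieces
supported on one value. -/
theorem consTensor_mem_overSymmetric {V : Fin D → (Fin p → Fin D) → F}
    (hV : ∀ ν, V ν ∈ overSymmetric M) : consTensor V ∈ overSymmetric M := by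
  classical
  have h1 : ∀ (ν : Fin D) (U : (Fin p → Fin D) → F), U ∈ overSymmetric M →
      consTensor (Pi.single (M := fun _ => (Fin p → Fin D) → F) ν U) ∈ overSymmetric M := by
    intro ν U hU
    induction hU using Submodule.span_induction with
    | mem U hU =>
      obtain ⟨Z, hZ, h⟩ := hU
      refine SymmetricOn.mem_overSymmetric (Z := Z.map (Fin.succEmb p)) ?_
        (by rw [Finset.card_map, hZ])
      intro a ha b hb
      obtain ⟨a, ha', rfl⟩ := Finset.mem_map.1 ha
      obtain ⟨b, hb', rfl⟩ := Finset.mem_map.1 hb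
      have h2 : swap (Fin.succEmb p a) (Fin.succEmb p b) = liftPerm (swap a b) := by
        ext i
        refine Fin.cases ?_ (fun i => ?_) i
        · rw [liftPerm_zero, Equiv.swap_apply_of_ne_of_ne] <;> simp [Fin.succ_ne_zero, eq_comm]
        · rw [liftPerm_succ, Fin.coe_succEmb, Equiv.swap_apply_def, Equiv.swap_apply_def]
          simp only [Fin.succ_inj]
          split_ifs <;> rfl
      rw [h2, perm_liftPerm_consTensor]
      congr 1
      funext ν'
      by_cases hν : ν' = ν
      · subst hν
        simp [h a ha' b hb']
      · simp [hν]
    | zero => rw [Pi.single_zero]; exact Submodule.zero_mem _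
    | add U U' _ _ h h' => rw [Pi.single_add]; exact Submodule.add_mem _ h h'
    | smul c U _ h => rw [Pi.single_smul]; exact Submodule.smul_mem _ c h
  have h2 : V = ∑ ν, Pi.single ν (V ν) := (Finset.univ_sum_single V).symm
  have h3 : consTensor V = ∑ ν, consTensor (Pi.single (M := fun _ => (Fin p → Fin D) → F)
      ν (V ν)) := by
    conv_lhs => rw [h2]
    rw [← consTensor_sum]
    congr 1
    funext ν
    simp
  rw [h3]
  exact Submodule.sum_mem _ fun ν _ => h1 ν _ (hV ν)

theorem liftPerm_mem_fiberPerms {f : Fin (p + 1) → ℕ} {g : Fin p → ℕ}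
    (h : ∀ i : Fin p, f i.succ = g i) {σ : Equiv.Perm (Fin p)} :
    liftPerm σ ∈ fiberPerms f ↔ σ ∈ fiberPerms g := by
  rw [mem_fiberPerms, mem_fiberPerms]
  constructor
  · intro h1 i
    have := h1 i.succ
    rwa [liftPerm_succ, h, h] at this
  · intro h1 i
    refine Fin.cases (by simp) (fun i => ?_) i
    rw [liftPerm_succ, h, h, h1]

/-- Old indices keep their rows, so the smaller row group lifts into the larger one and is absorbed
by it. -/
theorem symSum_consTensor_symSum {f : Fin (p + 1) → ℕ} {g : Fin p → ℕ}
    (h : ∀ i : Fin p, f i.succ = g i) (V : Fin D → (Fin p → Fin D) → F) :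
    symSum f (consTensor fun ν => symSum g (V ν)) =
      ((fiberPerms g).card : ℝ) • symSum f (consTensor V) := by
  simp only [symSum_apply g]
  rw [consTensor_sum, map_sum]
  have h1 : ∀ σ ∈ fiberPerms g, symSum f (consTensor fun ν => perm σ (V ν)) =
      symSum f (consTensor V) := by
    intro σ hσ
    rw [← perm_liftPerm_consTensor, symSum_perm _ ((liftPerm_mem_fiberPerms h).2 hσ)]
  rw [Finset.sum_congr rfl h1, Finset.sum_const, Nat.cast_smul_eq_nsmul]

/-- The Young symmetrizer of a larger diagram absorbs the one of a smaller diagram. -/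
theorem IsFrame.exists_absorb {row col : Fin p → ℕ} (h : IsFrame M row col)
    {row' col' : Fin (p + 1) → ℕ} (h' : IsFrame M row' col')
    (hrow : ∀ i : Fin p, row' i.succ = row i) :
    ∃ c : ℝ, c ≠ 0 ∧ ∀ (D : ℕ) (F : Type) [AddCommGroup F] [Module ℝ F]
      (V : Fin D → (Fin p → Fin D) → F),
      altSum col' (symSum row' (consTensor fun ν => altSum col (symSum row (V ν)))) =
        c • altSum col' (symSum row' (consTensor V)) := by
  obtain ⟨c, hc0, hc⟩ := h.exists_const
  refine ⟨c, hc0, fun D F _ _ V => ?_⟩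
  have hcard := card_fiberPerms_ne_zero (f := row)
  -- The error term S A S V - c S V is over-symmetric. It stays so with a new index in front and
  -- after the larger row symmetrization, so the larger antisymmetrizer kills it.
  have h1 := altSum_eq_zero h'.col_lt (symSum_mem_overSymmetric row'
    (consTensor_mem_overSymmetric fun ν => hc D F (V ν)))
  rw [consTensor_sub, consTensor_smul, map_sub, map_sub, map_smul, map_smul,
    symSum_consTensor_symSum hrow, symSum_consTensor_symSum hrow, map_smul, map_smul, smul_comm c,
    ← smul_sub] at h1
  exact sub_eq_zero.1 ((smul_eq_zero.1 h1).resolve_left hcard)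

/-- Young symmetrizers are idempotent up to a factor. -/
theorem IsFrame.exists_idempotent {row col : Fin p → ℕ} (h : IsFrame M row col) :
    ∃ c : ℝ, c ≠ 0 ∧ ∀ (D : ℕ) (F : Type) [AddCommGroup F] [Module ℝ F]
      (V : (Fin p → Fin D) → F),
      altSum col (symSum row (altSum col (symSum row V))) =
        c • altSum col (symSum row V) := by
  obtain ⟨c, hc0, hc⟩ := h.exists_const
  refine ⟨c, hc0, fun D F _ _ V => ?_⟩
  have h1 := altSum_eq_zero h.col_lt (hc D F V)
  rwa [map_sub, map_smul, sub_eq_zero] at h1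

end Young

/-! ### Rows and columns of the diagrams `Y^N_p`. -/

section Labels

variable (M p : ℕ)

/-- The row of the cell of an index. -/
def rowOf (i : Fin p) : ℕ := (Fin.rev i : ℕ) / M

/-- The column of the cell of an index. -/
def colOf (i : Fin p) : ℕ := (Fin.rev i : ℕ) % M

variable {M p}

theorem rowOf_succ (i : Fin p) : rowOf M (p + 1) i.succ = rowOf M p i := by
  simp [rowOf, Fin.rev_succ]

theorem card_rowOf_eq (hM : 0 < M) {r : ℕ} (hr : (r + 1) * M ≤ p) :
    (Finset.univ.filter fun i : Fin p => rowOf M p i = r).card = M := by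
  have h1 : (Finset.univ.filter fun i : Fin p => rowOf M p i = r).card =
      (Finset.Ico (r * M) (r * M + M)).card := by
    refine Finset.card_bij (fun i _ => (Fin.rev i : ℕ)) (fun i hi => ?_) (fun i _ j _ hij => ?_)
      (fun k hk => ?_)
    · have hi' : (Fin.rev i : ℕ) / M = r := (Finset.mem_filter.1 hi).2
      rw [Nat.div_eq_iff hM] at hi'
      rw [Finset.mem_Ico]
      omega
    · exact Fin.rev_injective (Fin.ext hij)
    · rw [Finset.mem_Ico] at hk
      have hkp : k < p := by
        rw [add_mul, one_mul] at hr
        omega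
      refine ⟨Fin.rev ⟨k, hkp⟩, ?_, by simp⟩
      rw [Finset.mem_filter]
      refine ⟨Finset.mem_univ _, ?_⟩
      rw [rowOf, Fin.rev_rev, Nat.div_eq_iff hM]
      change r * M ≤ k ∧ k ≤ r * M + M - 1
      omega
  rw [h1, Nat.card_Ico]
  omega

theorem rowOf_le (i : Fin p) : rowOf M p i ≤ p / M := by
  rw [rowOf]
  exact Nat.div_le_div_right (Fin.rev i).isLt.le

theorem isFrame_rowOf (hM : 0 < M) (p : ℕ) : IsFrame M (rowOf M p) (colOf M p) where
  col_lt i := Nat.mod_lt _ hM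
  row_full := by
    have h : ∀ x, (Finset.univ.filter fun z => rowOf M p z = rowOf M p x).card ≠ M →
        rowOf M p x = p / M := by
      intro x hx
      refine le_antisymm (rowOf_le x) (Nat.le_of_not_lt fun hlt => hx (card_rowOf_eq hM ?_))
      exact (Nat.le_div_iff_mul_le hM).1 hlt
    intro x y hx hy
    rw [h x hx, h y hy]
  inj a b hr hc := by
    have h1 := Nat.div_add_mod (Fin.rev a : ℕ) M
    have h2 := Nat.div_add_mod (Fin.rev b : ℕ) M
    rw [rowOf, rowOf] at hr
    rw [colOf, colOf] at hc
    rw [hr, hc, h2] at h1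
    exact (Fin.rev_injective (Fin.ext h1)).symm

end Labels

/-! ### The algebraic core: exactness from the relations of gl(1|M). -/

/-- Operators on a real vector space with the commutation relations of the Lie superalgebra
`gl(1|M)`: `d c` and `K c` are odd, `E a b` and `L` are even. -/
structure SuperRep (M : ℕ) (A : Type*) [AddCommGroup A] [Module ℝ A] where
  d : Fin M → Module.End ℝ A
  K : Fin M → Module.End ℝ A
  E : Fin M → Fin M → Module.End ℝ A
  L : Module.End ℝ A
  d_d : ∀ a b w, d a (d b w) = - d b (d a w)
  K_K : ∀ a b w, K a (K b w) = - K b (K a w)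
  d_K : ∀ a b w, d a (K b w) = (if a = b then L w else 0) + E a b w - K b (d a w)
  E_d : ∀ a b c w, E a b (d c w) = d c (E a b w) + if b = c then d a w else 0
  E_K : ∀ a b c w, E a b (K c w) = K c (E a b w) - if a = c then K b w else 0
  L_d : ∀ c w, L (d c w) = d c (L w) - d c w
  L_K : ∀ c w, L (K c w) = K c (L w) + K c w
  L_E : ∀ a b w, L (E a b w) = E a b (L w)

namespace SuperRep

variable {M : ℕ} {A : Type*} [AddCommGroup A] [Module ℝ A] (X : SuperRep M A)

/-- The composition of the operators `d c`, `c` in a list. -/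
def dWord (I : List (Fin M)) : Module.End ℝ A := (I.map X.d).prod

/-- The composition of the operators `K c`, `c` in a list. -/
def kWord (I : List (Fin M)) : Module.End ℝ A := (I.map X.K).prod

@[simp] theorem dWord_nil (w : A) : X.dWord [] w = w := rfl

@[simp] theorem dWord_cons (c : Fin M) (I : List (Fin M)) (w : A) :
    X.dWord (c :: I) w = X.d c (X.dWord I w) := by simp [dWord]

@[simp] theorem kWord_nil (w : A) : X.kWord [] w = w := rfl

@[simp] theorem kWord_cons (c : Fin M) (I : List (Fin M)) (w : A) :
    X.kWord (c :: I) w = X.K c (X.kWord I w) := by simp [kWord]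

/-- The operator `∑ c, d c ∘ K c`. -/
def Q : Module.End ℝ A := ∑ c, X.d c * X.K c

theorem Q_apply (w : A) : X.Q w = ∑ c, X.d c (X.K c w) := by simp [Q]

/-- The span of the images of the `s`-fold products of the operators `d c`. -/
def dRange : ℕ → Submodule ℝ A
  | 0 => ⊤
  | s + 1 => ⨆ c, (dRange s).map (X.d c)

theorem d_mem_dRange {s : ℕ} {w : A} (c : Fin M) (hw : w ∈ X.dRange s) :
    X.d c w ∈ X.dRange (s + 1) :=
  Submodule.mem_iSup_of_mem c (Submodule.mem_map_of_mem hw)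

theorem dRange_succ_induction {s : ℕ} (P : Submodule ℝ A)
    (h : ∀ c, ∀ w ∈ X.dRange s, X.d c w ∈ P) : X.dRange (s + 1) ≤ P := by
  refine iSup_le fun c => ?_
  rintro _ ⟨w, hw, rfl⟩
  exact h c w hw

theorem L_mem_dRange {s : ℕ} : ∀ {w : A}, w ∈ X.dRange s → X.L w ∈ X.dRange s := by
  induction s with
  | zero => intro w _; exact Submodule.mem_top
  | succ s ih =>
    intro w hw
    refine X.dRange_succ_induction ((X.dRange (s + 1)).comap X.L) (fun c w hw => ?_) hw
    rw [Submodule.mem_comap, X.L_d]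
    exact Submodule.sub_mem _ (X.d_mem_dRange c (ih hw)) (X.d_mem_dRange c hw)

theorem E_mem_dRange {s : ℕ} (a b : Fin M) :
    ∀ {w : A}, w ∈ X.dRange s → X.E a b w ∈ X.dRange s := by
  induction s with
  | zero => intro w _; exact Submodule.mem_top
  | succ s ih =>
    intro w hw
    refine X.dRange_succ_induction ((X.dRange (s + 1)).comap (X.E a b)) (fun c w hw => ?_) hw
    rw [Submodule.mem_comap, X.E_d]
    refine Submodule.add_mem _ (X.d_mem_dRange c (ih hw)) ?_
    split_ifs
    · exact X.d_mem_dRange a hw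
    · exact Submodule.zero_mem _

/-- By K d = L + E - d K, moving K inwards either cancels one d or passes it, while L and E preserve
the filtration. -/
theorem K_mem_dRange {s : ℕ} (b : Fin M) :
    ∀ {w : A}, w ∈ X.dRange (s + 1) → X.K b w ∈ X.dRange s := by
  induction s with
  | zero => intro w _; exact Submodule.mem_top
  | succ s ih =>
    intro w hw
    refine X.dRange_succ_induction ((X.dRange (s + 1)).comap (X.K b)) (fun c w hw => ?_) hw
    rw [Submodule.mem_comap]
    have h : X.K b (X.d c w) = (if c = b then X.L w else 0) + X.E c b w - X.d c (X.K b w) := by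
      rw [X.d_K]; abel
    rw [h]
    refine Submodule.sub_mem _ (Submodule.add_mem _ ?_ (X.E_mem_dRange _ _ hw))
      (X.d_mem_dRange c (ih hw))
    split_ifs
    · exact X.L_mem_dRange hw
    · exact Submodule.zero_mem _

theorem dWord_mem_dRange {s : ℕ} {w : A} (I : List (Fin M)) (hw : w ∈ X.dRange s) :
    X.dWord I w ∈ X.dRange (I.length + s) := by
  induction I with
  | nil => simpa using hw
  | cons c I ih =>
    rw [dWord_cons, List.length_cons, Nat.add_right_comm]
    exact X.d_mem_dRange c ih

/-- The vectors on which `E a b` acts as `n` times the identity matrix. -/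
def invariants (n : ℝ) : Submodule ℝ A where
  carrier := {w | ∀ a b, X.E a b w = if a = b then n • w else 0}
  zero_mem' a b := by simp
  add_mem' := by
    intro v w hv hw a b
    rw [map_add, hv, hw]
    split_ifs <;> simp
  smul_mem' := by
    intro c w hw a b
    rw [map_smul, hw]
    split_ifs
    · rw [smul_comm]
    · rw [smul_zero]

variable {X} {n : ℝ} {T : A}

theorem L_dWord (I : List (Fin M)) (w : A) :
    X.L (X.dWord I w) = X.dWord I (X.L w) - (I.length : ℝ) • X.dWord I w := by
  induction I with
  | nil => simp
  | cons c I ih =>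
    simp only [dWord_cons, X.L_d, ih, map_sub, map_smul, List.length_cons]
    push_cast
    module

theorem L_kWord (I : List (Fin M)) (w : A) :
    X.L (X.kWord I w) = X.kWord I (X.L w) + (I.length : ℝ) • X.kWord I w := by
  induction I with
  | nil => simp
  | cons c I ih =>
    simp only [kWord_cons, X.L_K, ih, map_add, map_smul, List.length_cons]
    push_cast
    module

/-- E acts on T by the scalar n; each letter that E passes lowers this by 1, because the d
anticommute. -/
theorem sum_d_E_dWord (hT : T ∈ X.invariants n) (I : List (Fin M)) (a : Fin M) :
    ∑ c, X.d c (X.E a c (X.dWord I T)) = (n - I.length) • X.d a (X.dWord I T) := by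
  induction I with
  | nil =>
    have : ∀ c, X.d c (X.E a c T) = if a = c then n • X.d c T else 0 := by
      intro c; rw [hT a c]; split_ifs <;> simp
    simp [this]
  | cons x I ih =>
    have h : ∀ c, X.d c (X.E a c (X.dWord (x :: I) T)) =
        - X.d x (X.d c (X.E a c (X.dWord I T))) +
          if c = x then X.d x (X.d a (X.dWord I T)) else 0 := by
      intro c
      rw [dWord_cons, X.E_d, map_add, X.d_d]
      split_ifs with hc
      · rw [hc]
      · simp
    rw [Finset.sum_congr rfl fun c _ => h c, Finset.sum_add_distrib, Finset.sum_neg_distrib,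
      ← map_sum, ih, Finset.sum_ite_eq', dWord_cons, X.d_d a x]
    simp only [Finset.mem_univ, if_true, map_smul, List.length_cons]
    push_cast
    module

theorem sum_K_E_kWord (hT : T ∈ X.invariants n) (I : List (Fin M)) (a : Fin M) :
    ∑ c, X.K c (X.E c a (X.kWord I T)) = (n + I.length) • X.K a (X.kWord I T) := by
  induction I with
  | nil =>
    have : ∀ c, X.K c (X.E c a T) = if c = a then n • X.K c T else 0 := by
      intro c; rw [hT c a]; split_ifs <;> simp
    simp [this]
  | cons x I ih =>
    have h : ∀ c, X.K c (X.E c a (X.kWord (x :: I) T)) =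
        - X.K x (X.K c (X.E c a (X.kWord I T))) -
          if c = x then X.K x (X.K a (X.kWord I T)) else 0 := by
      intro c
      rw [kWord_cons, X.E_K, map_sub, X.K_K]
      split_ifs with hc
      · rw [hc]
      · simp
    rw [Finset.sum_congr rfl fun c _ => h c, Finset.sum_sub_distrib, Finset.sum_neg_distrib,
      ← map_sum, ih, Finset.sum_ite_eq', kWord_cons, X.K_K a x]
    simp only [Finset.mem_univ, if_true, map_smul, List.length_cons]
    push_cast
    module

theorem Q_d (a : Fin M) (w : A) :
    X.Q (X.d a w) = X.d a (X.Q w) + X.d a (X.L w) + ∑ c, X.d c (X.E a c w) := by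
  have h : ∀ c, X.d c (X.K c (X.d a w)) =
      X.d a (X.d c (X.K c w)) + (if a = c then X.d a (X.L w) else 0) + X.d c (X.E a c w) := by
    intro c
    have h1 : X.K c (X.d a w) = (if a = c then X.L w else 0) + X.E a c w - X.d a (X.K c w) := by
      rw [X.d_K]; abel
    rw [h1, map_sub, map_add, X.d_d c a]
    split_ifs with hc
    · subst hc; abel
    · simp; abel
  rw [Q_apply, Finset.sum_congr rfl fun c _ => h c]
  simp [Finset.sum_add_distrib, Q_apply]

theorem Q_K (a : Fin M) (w : A) :
    X.Q (X.K a w) = X.K a (X.Q w) - X.L (X.K a w) + (M : ℝ) • X.K a w -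
      ∑ c, X.K c (X.E c a w) := by
  have h : ∀ c, X.d c (X.K c (X.K a w)) =
      X.K a (X.d c (X.K c w)) - (if c = a then X.L (X.K a w) else 0) + X.K a w -
        X.K c (X.E c a w) := by
    intro c
    rw [X.K_K c a, map_neg, X.d_K c a, X.E_K, if_pos rfl]
    split_ifs with hc
    · subst hc; abel
    · abel
  rw [Q_apply, Finset.sum_congr rfl fun c _ => h c]
  simp only [Finset.sum_add_distrib, Finset.sum_sub_distrib, Q_apply, map_sum, Finset.sum_ite_eq',
    Finset.mem_univ, if_true, Finset.sum_const, Finset.card_univ, Fintype.card_fin]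
  rw [Nat.cast_smul_eq_nsmul]

/-- On invariants, Q passes a word in the d up to a polynomial in L. Therefore Q preserves the
condition of being annihilated by all words of length k. -/
theorem Q_dWord (hT : T ∈ X.invariants n) (I : List (Fin M)) :
    X.Q (X.dWord I T) = X.dWord I (X.Q T + (I.length : ℝ) • X.L T +
      ((I.length : ℝ) * (n - I.length + 1)) • T) := by
  induction I with
  | nil => simp
  | cons x I ih =>
    rw [dWord_cons, Q_d, ih, sum_d_E_dWord hT, L_dWord]
    simp only [dWord_cons, map_add, map_sub, map_smul, List.length_cons]
    push_cast
    module

/-- The scalar (depending on `L`) by which `Q` is shifted when it passes `r` operators `K c`. -/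
def shift (X : SuperRep M A) (n : ℝ) (r : ℕ) : Module.End ℝ A :=
  (r : ℝ) • (X.L + (n - M + r) • 1)

theorem Q_kWord (hT : T ∈ X.invariants n) (I : List (Fin M)) :
    X.Q (X.kWord I T) = X.kWord I (X.Q T - X.shift n I.length T) := by
  induction I with
  | nil => simp [shift]
  | cons x I ih =>
    rw [kWord_cons, Q_K, ih, sum_K_E_kWord hT, X.L_K, L_kWord]
    simp only [shift, kWord_cons, map_add, map_sub, map_smul, List.length_cons,
      LinearMap.smul_apply, LinearMap.add_apply, Module.End.one_apply]
    push_cast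
    module

theorem L_mem_invariants (hT : T ∈ X.invariants n) : X.L T ∈ X.invariants n := by
  intro a b
  rw [← X.L_E, hT]
  split_ifs <;> simp

/-- Q commutes with the E: the corrections from d and from K cancel in the sum. -/
theorem Q_mem_invariants (hT : T ∈ X.invariants n) : X.Q T ∈ X.invariants n := by
  intro a b
  have h : ∀ c, X.E a b (X.d c (X.K c T)) = X.d c (X.K c (X.E a b T)) +
      ((if b = c then X.d a (X.K b T) else 0) - if a = c then X.d a (X.K b T) else 0) := by
    intro c
    rw [X.E_d, X.E_K, map_sub]
    split_ifs with h1 h2 h2 <;> simp_all [sub_eq_add_neg]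
  rw [Q_apply, map_sum, Finset.sum_congr rfl fun c _ => h c, Finset.sum_add_distrib,
    Finset.sum_sub_distrib]
  simp only [Finset.sum_ite_eq, Finset.mem_univ, if_true, sub_self, add_zero, ← Q_apply]
  rw [hT]
  split_ifs <;> simp

/-- The operator `∑ d c₁ ⋯ d c_r K c_r ⋯ K c₁`, more generally with `Y` in the middle. -/
def sandwich (X : SuperRep M A) (Y : Module.End ℝ A) : ℕ → Module.End ℝ A
  | 0 => Y
  | r + 1 => ∑ c, X.d c * sandwich X Y r * X.K c

theorem sandwich_succ_apply (Y : Module.End ℝ A) (r : ℕ) (w : A) :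
    X.sandwich Y (r + 1) w = ∑ c, X.d c (X.sandwich Y r (X.K c w)) := by
  simp [sandwich, mul_assoc]

theorem sandwich_mem_dRange (Y : Module.End ℝ A) (r : ℕ) (w : A) :
    X.sandwich Y r w ∈ X.dRange r := by
  induction r generalizing w with
  | zero => exact Submodule.mem_top
  | succ r ih =>
    rw [sandwich_succ_apply]
    exact Submodule.sum_mem _ fun c _ => X.d_mem_dRange c (ih _)

theorem sandwich_Q (r : ℕ) (w : A) : X.sandwich X.Q r w = X.sandwich 1 (r + 1) w := by
  induction r generalizing w with
  | zero => simp [sandwich, Q_apply]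
  | succ r ih => rw [sandwich_succ_apply, sandwich_succ_apply]; simp only [ih]

theorem sandwich_Q_kWord (hT : T ∈ X.invariants n) (r : ℕ) (I : List (Fin M)) :
    X.sandwich X.Q r (X.kWord I T) =
      X.sandwich 1 r (X.kWord I (X.Q T - X.shift n (r + I.length) T)) := by
  induction r generalizing I with
  | zero => simp [sandwich, Q_kWord hT]
  | succ r ih =>
    rw [sandwich_succ_apply, sandwich_succ_apply]
    refine Finset.sum_congr rfl fun c _ => ?_
    rw [← kWord_cons, ih, kWord_cons, List.length_cons, Nat.add_right_comm, ← add_assoc]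

/-- The innermost pair of the sandwich is Q, which can be moved through the K down to T. Iterating,
the sandwich is built from the operators Q - `shift`. -/
theorem sandwich_one_succ (hT : T ∈ X.invariants n) (r : ℕ) :
    X.sandwich 1 (r + 1) T = X.sandwich 1 r (X.Q T - X.shift n r T) := by
  rw [← sandwich_Q]
  simpa using sandwich_Q_kWord hT r []

/-- The invariants that are annihilated by all `k`-fold products of the operators `d c`. -/
def closedInvariants (X : SuperRep M A) (n : ℝ) (k : ℕ) : Submodule ℝ A where
  carrier := {w | w ∈ X.invariants n ∧ ∀ I : List (Fin M), I.length = k → X.dWord I w = 0}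
  zero_mem' := ⟨Submodule.zero_mem _, fun I _ => map_zero _⟩
  add_mem' := fun hv hw => ⟨Submodule.add_mem _ hv.1 hw.1, fun I hI => by
    rw [map_add, hv.2 I hI, hw.2 I hI, add_zero]⟩
  smul_mem' := fun c w hw => ⟨Submodule.smul_mem _ c hw.1, fun I hI => by
    rw [map_smul, hw.2 I hI, smul_zero]⟩

variable {k : ℕ}

theorem L_mem_closedInvariants (hT : T ∈ X.closedInvariants n k) :
    X.L T ∈ X.closedInvariants n k := by
  refine ⟨L_mem_invariants hT.1, fun I hI => ?_⟩
  have h := L_dWord (X := X) I T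
  rw [hT.2 I hI, map_zero, smul_zero, sub_zero] at h
  exact h.symm

theorem Q_mem_closedInvariants (hT : T ∈ X.closedInvariants n k) :
    X.Q T ∈ X.closedInvariants n k := by
  refine ⟨Q_mem_invariants hT.1, fun I hI => ?_⟩
  have h := Q_dWord hT.1 I
  rw [map_add, map_add, map_smul, map_smul, hT.2 I hI,
    (L_mem_closedInvariants hT).2 I hI, map_zero] at h
  simpa using h.symm

theorem Q_sub_shift_mem (hT : T ∈ X.closedInvariants n k) (r : ℕ) :
    X.Q T - X.shift n r T ∈ X.closedInvariants n k := by
  refine Submodule.sub_mem _ (Q_mem_closedInvariants hT) (Submodule.smul_mem _ _ ?_)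
  exact Submodule.add_mem _ (L_mem_closedInvariants hT) (Submodule.smul_mem _ _ hT)

/-- An analogue of Cartan's formula: it trades d K for K d, which is negligible on vectors whose
d-images lie deep in the filtration. -/
theorem Q_add_sum (w : A) :
    X.Q w + ∑ c, X.K c (X.d c w) = (M : ℝ) • X.L w + ∑ c, X.E c c w := by
  rw [Q_apply, ← Finset.sum_add_distrib]
  have h : ∀ c, X.d c (X.K c w) + X.K c (X.d c w) = X.L w + X.E c c w := by
    intro c; rw [X.d_K, if_pos rfl]; abel
  rw [Finset.sum_congr rfl fun c _ => h c, Finset.sum_add_distrib]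
  simp [Nat.cast_smul_eq_nsmul]

theorem sum_E_dWord (hT : T ∈ X.invariants n) (I : List (Fin M)) :
    ∑ c, X.E c c (X.dWord I T) = (M * n + I.length) • X.dWord I T := by
  induction I with
  | nil =>
    have h : ∀ c, X.E c c T = n • T := fun c => by rw [hT, if_pos rfl]
    simp [h, mul_smul, Nat.cast_smul_eq_nsmul]
  | cons x I ih =>
    simp only [dWord_cons, X.E_d, Finset.sum_add_distrib, ← map_sum, ih, Finset.sum_ite_eq',
      Finset.mem_univ, if_true, map_smul, List.length_cons]
    push_cast
    module

/-- By `ih` the vectors d_c d_I T lie in `dRange (l + 1 + j)`, so K takes them into `dRange (l +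
j)`. In the Cartan-type formula only L and scalars remain, and after subtracting `shift` they
factor. -/
theorem dWord_Q_sub_mem {j l : ℕ}
    (ih : ∀ T ∈ X.closedInvariants n k, ∀ I : List (Fin M), I.length = l + 1 →
      X.dWord I T ∈ X.dRange (l + 1 + j))
    (hT : T ∈ X.closedInvariants n k) (I : List (Fin M)) (hI : I.length = l) (r : ℕ) :
    X.dWord I (X.Q T - X.shift n r T) -
      ((M : ℝ) - l - r) • X.dWord I (X.L T + (n + r - l) • T) ∈ X.dRange (l + j) := by
  have h1 := Q_dWord hT.1 I
  have h2 := Q_add_sum (X := X) (X.dWord I T)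
  have h3 := L_dWord (X := X) I T
  rw [sum_E_dWord hT.1, h1, h3, hI] at h2
  have h4 : ∑ c, X.K c (X.d c (X.dWord I T)) ∈ X.dRange (l + j) := by
    refine Submodule.sum_mem _ fun c _ => X.K_mem_dRange c ?_
    rw [← dWord_cons, Nat.add_right_comm]
    exact ih T hT _ (by simp [hI])
  convert Submodule.neg_mem _ h4 using 1
  rw [eq_neg_iff_add_eq_zero]
  simp only [map_add, map_smul, map_sub, shift, LinearMap.smul_apply, LinearMap.add_apply,
    Module.End.one_apply] at h2 ⊢
  have h5 : ∑ c, X.K c (X.d c (X.dWord I T)) = (M : ℝ) • (X.dWord I (X.L T) - (l : ℝ) • X.dWord I T)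
      + ((M : ℝ) * n + l) • X.dWord I T - (X.dWord I (X.Q T) + (l : ℝ) • X.dWord I (X.L T) +
        ((l : ℝ) * (n - l + 1)) • X.dWord I T) := by
    rw [← h2]; abel
  rw [h5]
  module

/-- The product of the operators `L + n + s`, `s < r`. -/
def eulerProd (X : SuperRep M A) (n : ℝ) : ℕ → Module.End ℝ A
  | 0 => 1
  | r + 1 => eulerProd X n r * (X.L + (n + r) • 1)

theorem eulerProd_mem_dRange (n : ℝ) (r : ℕ) {s : ℕ} {w : A} (hw : w ∈ X.dRange s) :
    X.eulerProd n r w ∈ X.dRange s := by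
  induction r generalizing w with
  | zero => exact hw
  | succ r ih =>
    exact ih (Submodule.add_mem _ (X.L_mem_dRange hw) (Submodule.smul_mem _ _ hw))

theorem dWord_sandwich_sub_mem {j l : ℕ}
    (ih : ∀ T ∈ X.closedInvariants n k, ∀ I : List (Fin M), I.length = l + 1 →
      X.dWord I T ∈ X.dRange (l + 1 + j))
    (I : List (Fin M)) (hI : I.length = l) (r : ℕ) (hT : T ∈ X.closedInvariants n k) :
    X.dWord I (X.sandwich 1 r T) - (∏ s ∈ Finset.range r, ((M : ℝ) - l - s)) •
      X.eulerProd n r (X.dWord I T) ∈ X.dRange (l + j) := by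
  induction r generalizing T with
  | zero => simp [sandwich, eulerProd]
  | succ r ihr =>
    have h1 := ihr (Q_sub_shift_mem hT r)
    have h2 := X.eulerProd_mem_dRange n r (dWord_Q_sub_mem ih hT I hI r)
    -- L drops by 1 at each letter, so the offset -l inside the word disappears outside.
    have h3 : X.dWord I (X.L T + (n + r - l) • T) = (X.L + (n + r) • 1) (X.dWord I T) := by
      simp only [map_add, map_smul, LinearMap.add_apply, LinearMap.smul_apply,
        Module.End.one_apply, L_dWord, hI]
      module
    rw [sandwich_one_succ hT.1, Finset.prod_range_succ]
    convert Submodule.add_mem _ h1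
      (Submodule.smul_mem _ (∏ s ∈ Finset.range r, ((M : ℝ) - l - s)) h2) using 1
    generalize X.Q T - X.shift n r T = T₁
    rw [h3, map_sub (X.eulerProd n r), map_smul (X.eulerProd n r), smul_sub, smul_smul, eulerProd,
      Module.End.mul_apply]
    abel

/-- Operators that invert the operators `L + s`, `s ≥ 1`, and whose commutation relations with the
operators `d c` also make sense for the other `s`. -/
structure EulerInverse (X : SuperRep M A) where
  G : ℤ → Module.End ℝ A
  d_G : ∀ c s w, X.d c (G s w) = G (s + 1) (X.d c w)
  E_G : ∀ a b s w, X.E a b (G s w) = G s (X.E a b w)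
  L_G : ∀ s : ℤ, 1 ≤ s → ∀ w, X.L (G s w) + (s : ℝ) • G s w = w

namespace EulerInverse

theorem dWord_G (Y : EulerInverse X) (I : List (Fin M)) (s : ℤ) (w : A) :
    X.dWord I (Y.G s w) = Y.G (s + I.length) (X.dWord I w) := by
  induction I with
  | nil => simp
  | cons c I ih =>
    rw [dWord_cons, ih, Y.d_G, dWord_cons, List.length_cons]
    push_cast
    rw [add_assoc]

theorem G_mem_closedInvariants (Y : EulerInverse X) (s : ℤ) (hT : T ∈ X.closedInvariants n k) :
    Y.G s T ∈ X.closedInvariants n k := by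
  refine ⟨fun a b => ?_, fun I hI => ?_⟩
  · rw [Y.E_G, hT.1]
    split_ifs <;> simp
  · rw [dWord_G, hT.2 I hI, map_zero]

theorem exists_eulerProd_eq (Y : EulerInverse X) {n : ℕ} (hn : 1 ≤ n) (l r : ℕ)
    (hT : T ∈ X.closedInvariants n k) :
    ∃ T' ∈ X.closedInvariants (n : ℝ) k, ∀ I : List (Fin M), I.length = l →
      X.eulerProd n r (X.dWord I T') = X.dWord I T := by
  induction r with
  | zero => exact ⟨T, hT, fun I _ => rfl⟩
  | succ r ih =>
    obtain ⟨T', hT', h⟩ := ih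
    -- The l letters of the word raise the parameter to n + r ≥ 1, where `G` is a true inverse. The
    -- parameter n + r - l itself may be nonpositive, which is why `G` is indexed by all integers.
    refine ⟨Y.G (n + r - l) T', Y.G_mem_closedInvariants _ hT', fun I hI => ?_⟩
    rw [← h I hI, dWord_G, hI, sub_add_cancel]
    have h1 := Y.L_G (n + r) (by omega) (X.dWord I T')
    push_cast at h1
    exact congrArg (X.eulerProd n r) h1

theorem dWord_mem_dRange (Y : EulerInverse X) {n : ℕ} (hn : 1 ≤ n) {j : ℕ} (hj : j + k = M + 1)
    (l : ℕ) (hl : l ≤ k) : ∀ T ∈ X.closedInvariants (n : ℝ) k,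
      ∀ I : List (Fin M), I.length = l → X.dWord I T ∈ X.dRange (l + j) := by
  induction hl using Nat.decreasingInduction with
  | self =>
    intro T hT I hI
    rw [hT.2 I hI]
    exact Submodule.zero_mem _
  | of_succ l hl ih =>
    intro T hT I hI
    obtain ⟨T', hT', h⟩ := Y.exists_eulerProd_eq hn l j hT
    have h1 := dWord_sandwich_sub_mem ih I hI j hT'
    have h2 : X.dWord I (X.sandwich 1 j T') ∈ X.dRange (l + j) := by
      rw [← hI]
      exact X.dWord_mem_dRange I (X.sandwich_mem_dRange 1 j T')
    have h3 := (Submodule.sub_mem_iff_right _ h2).1 h1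
    rw [h I hI] at h3
    -- The factors M - l - s do not vanish: l ≤ k - 1 and s ≤ j - 1 give l + s ≤ M - 1.
    refine (Submodule.smul_mem_iff _ (Finset.prod_ne_zero_iff.2 fun s hs => ?_)).1 h3
    have hs' := Finset.mem_range.1 hs
    have h4 : ((l + s : ℕ) : ℝ) < M := by exact_mod_cast (by omega : l + s < M)
    push_cast at h4
    intro h5
    linarith

end EulerInverse

/-- Exactness: an invariant vector that is annihilated by all `k`-fold products of the operators
`d c` is in the span of the images of their `(M + 1 - k)`-fold products. -/
theorem mem_dRange_of_mem_closedInvariants (Y : EulerInverse X) {n : ℕ} (hn : 1 ≤ n) {j : ℕ}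
    (hj : j + k = M + 1) (hT : T ∈ X.closedInvariants (n : ℝ) k) : T ∈ X.dRange j := by
  simpa using Y.dWord_mem_dRange hn hj 0 (Nat.zero_le k) T hT [] rfl

end SuperRep

/-! ### Smooth functions, radial averages and inverses of Euler operators. -/

/-- The smooth real functions on `ℝ^D`. -/
def Smooth (D : ℕ) : Submodule ℝ ((Fin D → ℝ) → ℝ) where
  carrier := {f | ContDiff ℝ ∞ f}
  zero_mem' := show ContDiff ℝ ∞ fun _ : Fin D → ℝ => (0 : ℝ) from contDiff_const
  add_mem' := fun {f g} (hf : ContDiff ℝ ∞ f) (hg : ContDiff ℝ ∞ g) => hf.add hg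
  smul_mem' := fun _ f (hf : ContDiff ℝ ∞ f) => contDiff_const.smul hf

namespace Smooth

variable {D : ℕ}

theorem contDiff (f : Smooth D) : ContDiff ℝ ∞ f.1 := f.2

theorem differentiable (f : Smooth D) : Differentiable ℝ f.1 :=
  (Smooth.contDiff f).differentiable (by simp)

theorem continuous (f : Smooth D) : Continuous f.1 := (Smooth.contDiff f).continuous

/-- The partial derivative. -/
noncomputable def pd (ν : Fin D) : Module.End ℝ (Smooth D) where
  toFun f := ⟨fun x => fderiv ℝ f.1 x (Pi.single ν 1),
    ((Smooth.contDiff f).fderiv_right (m := ∞) (by simp)).clm_apply contDiff_const⟩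
  map_add' f g := by
    apply Subtype.ext
    funext x
    change fderiv ℝ (f.1 + g.1) x _ = _
    rw [fderiv_add ((Smooth.differentiable f) x) ((Smooth.differentiable g) x)]
    rfl
  map_smul' c f := by
    apply Subtype.ext
    funext x
    change fderiv ℝ (c • f.1) x _ = _
    rw [fderiv_const_smul ((Smooth.differentiable f) x)]
    rfl

/-- The multiplication by a coordinate. -/
def xm (ν : Fin D) : Module.End ℝ (Smooth D) where
  toFun f := ⟨fun x => x ν * f.1 x, (contDiff_apply ℝ ℝ ν).mul (Smooth.contDiff f)⟩
  map_add' f g := by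
    apply Subtype.ext
    funext x
    exact mul_add _ _ _
  map_smul' c f := by
    apply Subtype.ext
    funext x
    exact mul_left_comm _ _ _

theorem pd_apply (ν : Fin D) (f : Smooth D) (x : Fin D → ℝ) :
    (pd ν f).1 x = fderiv ℝ f.1 x (Pi.single ν 1) := rfl

theorem xm_apply (ν : Fin D) (f : Smooth D) (x : Fin D → ℝ) : (xm ν f).1 x = x ν * f.1 x := rfl

theorem fderiv_apply_eq_sum (f : Smooth D) (x v : Fin D → ℝ) :
    fderiv ℝ f.1 x v = ∑ ν, v ν * (pd ν f).1 x := by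
  conv_lhs => rw [pi_eq_sum_univ' v, map_sum]
  refine Finset.sum_congr rfl fun ν _ => ?_
  rw [map_smul, smul_eq_mul, pd_apply]

theorem pd_comm (a b : Fin D) (f : Smooth D) : pd a (pd b f) = pd b (pd a f) := by
  apply Subtype.ext
  funext x
  have h : ∀ c e : Fin D, (pd c (pd e f)).1 x =
      fderiv ℝ (fderiv ℝ f.1) x (Pi.single c 1) (Pi.single e 1) := by
    intro c e
    rw [pd_apply]
    change fderiv ℝ (fun y => fderiv ℝ f.1 y (Pi.single e 1)) x _ = _
    rw [fderiv_clm_apply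
      (((Smooth.contDiff f).fderiv_right (m := ∞) (by simp)).differentiable (by simp) x)
      (differentiableAt_const _)]
    simp
  rw [h, h]
  exact ((Smooth.contDiff f).contDiffAt.isSymmSndFDerivAt (by
    rw [minSmoothness_of_isRCLikeNormedField]
    exact ENat.LEInfty.out)).eq _ _

theorem pd_xm (a b : Fin D) (f : Smooth D) :
    pd a (xm b f) = xm b (pd a f) + if a = b then f else 0 := by
  apply Subtype.ext
  funext x
  rw [pd_apply]
  have h1 : HasFDerivAt (fun y : Fin D → ℝ => y b)
      (ContinuousLinearMap.proj (R := ℝ) (φ := fun _ => ℝ) b) x := hasFDerivAt_apply b x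
  have h : HasFDerivAt (xm b f).1 _ x := h1.mul ((Smooth.differentiable f) x).hasFDerivAt
  rw [h.fderiv]
  by_cases hab : a = b
  · subst hab
    simp [xm_apply, pd_apply]
  · simp [xm_apply, pd_apply, hab]

theorem xm_comm (a b : Fin D) (f : Smooth D) : xm a (xm b f) = xm b (xm a f) := by
  apply Subtype.ext
  funext x
  exact mul_left_comm _ _ _

section Average

/-- The weighted average `∫ t in 0..1, t ^ m * f (t x)`. -/
noncomputable def avgFun (m : ℕ) (f : (Fin D → ℝ) → ℝ) (x : Fin D → ℝ) : ℝ :=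
  ∫ t in (0 : ℝ)..1, t ^ m * f (t • x)

theorem hasFDerivAt_avgFun (m : ℕ) (f : Smooth D) (x : Fin D → ℝ) :
    HasFDerivAt (avgFun m f.1) (∫ t in (0 : ℝ)..1, t ^ (m + 1) • fderiv ℝ f.1 (t • x)) x := by
  have hc : Continuous (fderiv ℝ f.1) := (Smooth.contDiff f).continuous_fderiv (by simp)
  have hcont : Continuous fun z : ℝ × (Fin D → ℝ) => z.1 ^ (m + 1) • fderiv ℝ f.1 (z.1 • z.2) := by
    fun_prop
  obtain ⟨C, hC⟩ := ((isCompact_Icc (a := (0 : ℝ)) (b := 1)).prod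
    (isCompact_closedBall x 1)).exists_bound_of_continuousOn hcont.continuousOn
  have hf := (Smooth.continuous f)
  refine intervalIntegral.hasFDerivAt_integral_of_dominated_of_fderiv_le
    (F := fun y t => t ^ m * f.1 (t • y)) (bound := fun _ => C)
    (F' := fun y t => t ^ (m + 1) • fderiv ℝ f.1 (t • y)) (s := Metric.closedBall x 1)
    (Metric.closedBall_mem_nhds x one_pos) (Filter.Eventually.of_forall fun y => ?_) ?_ ?_ ?_
    intervalIntegrable_const ?_
  · exact (by fun_prop : Continuous fun t : ℝ => t ^ m * f.1 (t • y)).aestronglyMeasurable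
  · exact (by fun_prop : Continuous fun t : ℝ => t ^ m * f.1 (t • x)).intervalIntegrable _ _
  · exact (hcont.comp (by fun_prop : Continuous fun t : ℝ => (t, x))).aestronglyMeasurable
  · refine Filter.Eventually.of_forall fun t ht y hy => ?_
    rw [Set.uIoc_of_le zero_le_one] at ht
    exact hC (t, y) ⟨⟨ht.1.le, ht.2⟩, hy⟩
  · refine Filter.Eventually.of_forall fun t _ y _ => ?_
    have h1 : HasFDerivAt (fun z : Fin D → ℝ => t • z) (t • ContinuousLinearMap.id ℝ _) y :=
      (hasFDerivAt_id y).const_smul t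
    have h2 := (((Smooth.differentiable f) (t • y)).hasFDerivAt.comp y h1).const_mul (t ^ m)
    refine HasFDerivAt.congr_fderiv h2 ?_
    ext v
    simp [pow_succ, mul_assoc]

theorem fderiv_avgFun (m : ℕ) (f : Smooth D) (x v : Fin D → ℝ) :
    fderiv ℝ (avgFun m f.1) x v = ∫ t in (0 : ℝ)..1, t ^ (m + 1) * fderiv ℝ f.1 (t • x) v := by
  have hc : Continuous (fderiv ℝ f.1) := (Smooth.contDiff f).continuous_fderiv (by simp)
  rw [(hasFDerivAt_avgFun m f x).fderiv, ContinuousLinearMap.intervalIntegral_apply]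
  · rfl
  · exact (by fun_prop : Continuous fun t : ℝ =>
      t ^ (m + 1) • fderiv ℝ f.1 (t • x)).intervalIntegrable _ _

/-- A directional derivative of an average is again an average, with exponent m + 1, so the
induction on the order of differentiability must allow all m and f. -/
theorem contDiff_avgFun (m : ℕ) (f : Smooth D) : ContDiff ℝ ∞ (avgFun m f.1) := by
  rw [contDiff_infty]
  intro n
  induction n generalizing m f with
  | zero =>
    exact contDiff_zero.2 (Differentiable.continuous fun x =>
      (hasFDerivAt_avgFun m f x).differentiableAt)
  | succ n ih =>
    push_cast
    rw [contDiff_succ_iff_fderiv_apply]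
    refine ⟨fun x => (hasFDerivAt_avgFun m f x).differentiableAt, by simp, fun v => ?_⟩
    have h : (fun x => fderiv ℝ (avgFun m f.1) x v) =
        avgFun (m + 1) (∑ ν, v ν • pd ν f : Smooth D).1 := by
      funext x
      rw [fderiv_avgFun]
      refine intervalIntegral.integral_congr fun t _ => ?_
      simp [fderiv_apply_eq_sum]
    rw [h]
    exact ih _ _

/-- The weighted average `∫ t in 0..1, t ^ m * f (t x)`, as an operator on smooth functions. -/
noncomputable def avg (m : ℕ) : Module.End ℝ (Smooth D) where
  toFun f := ⟨avgFun m f.1, contDiff_avgFun m f⟩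
  map_add' f g := by
    apply Subtype.ext
    funext x
    have hf := (Smooth.continuous f)
    have hg := (Smooth.continuous g)
    change avgFun m (f.1 + g.1) x = avgFun m f.1 x + avgFun m g.1 x
    rw [avgFun, avgFun, avgFun, ← intervalIntegral.integral_add]
    · simp [mul_add]
    · exact (by fun_prop : Continuous fun t : ℝ => t ^ m * f.1 (t • x)).intervalIntegrable _ _
    · exact (by fun_prop : Continuous fun t : ℝ => t ^ m * g.1 (t • x)).intervalIntegrable _ _
  map_smul' c f := by
    apply Subtype.ext
    funext x
    change avgFun m (c • f.1) x = c * avgFun m f.1 x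
    rw [avgFun, avgFun, ← intervalIntegral.integral_const_mul]
    simp [mul_left_comm]

theorem pd_avg (m : ℕ) (ν : Fin D) (f : Smooth D) : pd ν (avg m f) = avg (m + 1) (pd ν f) := by
  apply Subtype.ext
  funext x
  exact fderiv_avgFun m f x _

/-- The Euler operator. -/
noncomputable def euler : Module.End ℝ (Smooth D) := ∑ ν, xm ν * pd ν

theorem euler_apply (f : Smooth D) : euler f = ∑ ν, xm ν (pd ν f) := by simp [euler]

/-- Integrate the t-derivative of t^(m+1) f(tx) from 0 to 1. -/
theorem euler_avg (m : ℕ) (f : Smooth D) : euler (avg m f) + (m + 1 : ℝ) • avg m f = f := by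
  apply Subtype.ext
  funext x
  have hf := (Smooth.continuous f)
  have hc : Continuous (fderiv ℝ f.1) := (Smooth.contDiff f).continuous_fderiv (by simp)
  have h1 : (euler (avg m f)).1 x = ∫ t in (0 : ℝ)..1, t ^ (m + 1) * fderiv ℝ f.1 (t • x) x := by
    rw [← fderiv_avgFun]
    change _ = fderiv ℝ (avg m f).1 x x
    rw [fderiv_apply_eq_sum, euler_apply]
    simp [xm_apply]
  have h2 : ∀ t : ℝ, HasDerivAt (fun t : ℝ => t ^ (m + 1) * f.1 (t • x))
      ((m + 1 : ℝ) * t ^ m * f.1 (t • x) + t ^ (m + 1) * fderiv ℝ f.1 (t • x) x) t := by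
    intro t
    have h3 : HasDerivAt (fun t : ℝ => t • x) x t := by
      simpa using (hasDerivAt_id t).smul_const x
    have h4 := ((Smooth.differentiable f) (t • x)).hasFDerivAt.comp_hasDerivAt t h3
    exact ((hasDerivAt_pow (m + 1) t).mul h4).congr_deriv (by simp)
  have h5 := intervalIntegral.integral_eq_sub_of_hasDerivAt (a := 0) (b := 1)
    (fun t _ => h2 t) ((by fun_prop : Continuous fun t : ℝ => (m + 1 : ℝ) * t ^ m * f.1 (t • x) +
      t ^ (m + 1) * fderiv ℝ f.1 (t • x) x).intervalIntegrable _ _)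
  rw [intervalIntegral.integral_add
    ((by fun_prop : Continuous fun t : ℝ => (m + 1 : ℝ) * t ^ m * f.1 (t • x)).intervalIntegrable
      _ _)
    ((by fun_prop : Continuous fun t : ℝ =>
      t ^ (m + 1) * fderiv ℝ f.1 (t • x) x).intervalIntegrable _ _)] at h5
  change (euler (avg m f)).1 x + (m + 1 : ℝ) * avgFun m f.1 x = f.1 x
  rw [h1, avgFun, ← intervalIntegral.integral_const_mul]
  simp only [mul_assoc] at h5 ⊢
  rw [add_comm, h5]
  simp

end Average

/-- For m = 0 and f = g ν this is the classical Poincaré formula: the sum is a potential of the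
closed one-form g. -/
theorem pd_sum_xm_avg {m : ℕ} (ν : Fin D) (g : Fin D → Smooth D) (f : Smooth D)
    (hg : ∀ μ, pd ν (g μ) = pd μ f) :
    pd ν (∑ μ, xm μ (avg m (g μ))) = avg m (g ν) + f - avg m f - (m : ℝ) • avg m f := by
  have h1 : ∀ μ, pd ν (xm μ (avg m (g μ))) =
      xm μ (pd μ (avg m f)) + if ν = μ then avg m (g μ) else 0 := by
    intro μ
    rw [pd_xm, pd_avg, hg, pd_avg]
  have h2 := euler_avg m f
  rw [euler_apply] at h2
  rw [map_sum, Finset.sum_congr rfl fun μ _ => h1 μ, Finset.sum_add_distrib]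
  simp only [Finset.sum_ite_eq, Finset.mem_univ, if_true]
  rw [eq_sub_of_add_eq h2]
  module

/-- The operators `eulerInv s`, `s ≤ 1`, numbered by `a = 1 - s`. -/
noncomputable def eulerInvNeg : ℕ → Module.End ℝ (Smooth D)
  | 0 => avg 0
  | a + 1 => ∑ μ, xm μ * avg 0 * eulerInvNeg a * pd μ

/-- Each operator is defined as a potential of the one-form obtained by applying the preceding
operator to the partial derivatives. This one-form is closed because the preceding operator already
satisfies its commutation rule. -/
theorem pd_eulerInvNeg (a : ℕ) (ν : Fin D) (f : Smooth D) :
    pd ν (eulerInvNeg (a + 1) f) = eulerInvNeg a (pd ν f) := by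
  have key : ∀ (a : ℕ) (ν : Fin D) (f : Smooth D),
      (∀ μ, pd ν (eulerInvNeg a (pd μ f)) = pd μ (eulerInvNeg a (pd ν f))) →
      pd ν (eulerInvNeg (a + 1) f) = eulerInvNeg a (pd ν f) := by
    intro a ν f h
    have h3 : eulerInvNeg (a + 1) f = ∑ μ, xm μ (avg 0 (eulerInvNeg a (pd μ f))) := by
      simp [eulerInvNeg]
    rw [h3, pd_sum_xm_avg ν (fun μ => eulerInvNeg a (pd μ f)) (eulerInvNeg a (pd ν f)) h]
    simp
  induction a generalizing ν f with
  | zero => exact key 0 ν f fun μ => by rw [eulerInvNeg, pd_avg, pd_avg, pd_comm]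
  | succ a ih => exact key (a + 1) ν f fun μ => by rw [ih, ih, pd_comm]

/-- Operators that invert `euler + s` for `s ≥ 1`, extended to all integers `s` so as to satisfy
`pd_eulerInv`. -/
noncomputable def eulerInv (s : ℤ) : Module.End ℝ (Smooth D) :=
  if 1 ≤ s then avg (s - 1).toNat else eulerInvNeg (1 - s).toNat

theorem pd_eulerInv (s : ℤ) (ν : Fin D) (f : Smooth D) :
    pd ν (eulerInv s f) = eulerInv (s + 1) (pd ν f) := by
  rcases lt_trichotomy s 0 with h | rfl | h
  · obtain ⟨a, ha⟩ : ∃ a : ℕ, (1 - s).toNat = a + 1 := ⟨(-s).toNat, by omega⟩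
    rw [eulerInv, eulerInv, if_neg (by omega), if_neg (by omega), ha, pd_eulerInvNeg]
    congr 2
    omega
  · exact pd_eulerInvNeg 0 ν f
  · rw [eulerInv, eulerInv, if_pos (by omega), if_pos (by omega), pd_avg]
    congr 2
    omega

theorem euler_eulerInv (s : ℤ) (hs : 1 ≤ s) (f : Smooth D) :
    euler (eulerInv s f) + (s : ℝ) • eulerInv s f = f := by
  obtain ⟨m, rfl⟩ : ∃ m : ℕ, s = m + 1 := ⟨(s - 1).toNat, by omega⟩
  rw [eulerInv, if_pos hs]
  simpa using euler_avg m f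

theorem eq_const_of_pd_eq_zero (f : Smooth D) (h : ∀ ν, pd ν f = 0) (x : Fin D → ℝ) :
    f.1 x = f.1 0 := by
  refine is_const_of_fderiv_eq_zero (Smooth.differentiable f) (fun y => ?_) x 0
  ext v
  rw [fderiv_apply_eq_sum]
  simp [h]

theorem apply_eq_add_sum (f : Smooth D) (x : Fin D → ℝ) :
    f.1 x = f.1 0 + ∑ μ, x μ * (avg 0 (pd μ f)).1 x := by
  have h := eq_const_of_pd_eq_zero (f - ∑ μ, xm μ (avg 0 (pd μ f))) (fun ν => by
    have := pd_eulerInvNeg 0 ν f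
    rw [map_sub, pd_sum_xm_avg ν (fun μ => pd μ f) (pd ν f) (fun μ => pd_comm _ _ _)]
    simp) x
  simp [xm_apply] at h
  linarith

end Smooth

/-! ### Iterated derivatives under Young symmetrizers. -/

section Gradient

variable {D p q M : ℕ}

/-- The tensor of the partial derivatives of the components of a tensor field. -/
noncomputable def grad (T : (Fin p → Fin D) → Smooth D) : (Fin (p + 1) → Fin D) → Smooth D :=
  consTensor fun ν μ => Smooth.pd ν (T μ)

theorem grad_apply (T : (Fin p → Fin D) → Smooth D) (μ : Fin (p + 1) → Fin D) :
    grad T μ = Smooth.pd (μ 0) (T (Fin.tail μ)) := rfl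

theorem grad_add (T U : (Fin p → Fin D) → Smooth D) : grad (T + U) = grad T + grad U := by
  funext μ; simp [grad_apply]

theorem grad_smul (c : ℝ) (T : (Fin p → Fin D) → Smooth D) : grad (c • T) = c • grad T := by
  funext μ; simp [grad_apply]

theorem grad_symSum (f : Fin p → ℕ) (T : (Fin p → Fin D) → Smooth D) :
    grad (symSum f T) = consTensor fun ν => symSum f fun μ => Smooth.pd ν (T μ) := by
  rw [grad]
  congr 1
  funext ν μ
  simp only [symSum_apply, Finset.sum_apply, perm_apply, map_sum]

theorem grad_altSum (f : Fin p → ℕ) (T : (Fin p → Fin D) → Smooth D) :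
    grad (altSum f T) = consTensor fun ν => altSum f fun μ => Smooth.pd ν (T μ) := by
  rw [grad]
  congr 1
  funext ν μ
  simp only [altSum_apply, Finset.sum_apply, Pi.smul_apply, perm_apply, map_sum, map_smul]

theorem perm_liftPerm_grad (σ : Equiv.Perm (Fin p)) (T : (Fin p → Fin D) → Smooth D) :
    perm (liftPerm σ) (grad T) = grad (perm σ T) :=
  perm_liftPerm_consTensor σ _

/-- The tensor of the `j`-th partial derivatives of the components of a tensor field. -/
noncomputable def gradIter :
    (j : ℕ) → ((Fin q → Fin D) → Smooth D) →ₗ[ℝ] ((Fin (q + j) → Fin D) → Smooth D)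
  | 0 => LinearMap.id
  | j + 1 =>
    { toFun := fun T => grad (gradIter j T)
      map_add' := fun T U => by rw [map_add, grad_add]
      map_smul' := fun c T => by rw [map_smul, grad_smul]; rfl }

theorem gradIter_zero (T : (Fin q → Fin D) → Smooth D) : gradIter 0 T = T := rfl

theorem gradIter_succ (j : ℕ) (T : (Fin q → Fin D) → Smooth D) :
    gradIter (j + 1) T = grad (gradIter j T) := rfl

theorem liftPerm_swap (a b : Fin p) : liftPerm (swap a b) = swap a.succ b.succ := by
  ext i
  refine Fin.cases ?_ (fun i => ?_) i
  · rw [liftPerm_zero, Equiv.swap_apply_of_ne_of_ne] <;> simp [Fin.succ_ne_zero, eq_comm]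
  · rw [liftPerm_succ, Equiv.swap_apply_def, Equiv.swap_apply_def]
    simp only [Fin.succ_inj]
    split_ifs <;> rfl

theorem perm_swap_zero_one_grad_grad (T : (Fin p → Fin D) → Smooth D) :
    perm (swap 0 1) (grad (grad T)) = grad (grad T) := by
  funext μ
  rw [perm_apply, grad_apply, grad_apply, grad_apply, grad_apply, Smooth.pd_comm]
  have h1 : (μ ∘ swap (0 : Fin (p + 2)) 1) 0 = Fin.tail μ 0 := by
    rw [Function.comp_apply, Equiv.swap_apply_left]; rfl
  have h2 : Fin.tail (μ ∘ swap (0 : Fin (p + 2)) 1) 0 = μ 0 := by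
    change μ (swap (0 : Fin (p + 2)) 1 (Fin.succ 0)) = μ 0
    rw [Fin.succ_zero_eq_one, Equiv.swap_apply_right]
  have h3 : Fin.tail (Fin.tail (μ ∘ swap (0 : Fin (p + 2)) 1)) = Fin.tail (Fin.tail μ) := by
    funext i
    change μ (swap (0 : Fin (p + 2)) 1 i.succ.succ) = μ i.succ.succ
    rw [Equiv.swap_apply_of_ne_of_ne (Fin.succ_ne_zero _)]
    rw [← Fin.succ_zero_eq_one]
    exact fun h => Fin.succ_ne_zero i (Fin.succ_injective _ h)
  rw [h1, h2, h3]

/-- Partial derivatives commute. -/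
theorem symmetricOn_gradIter (j : ℕ) (T : (Fin q → Fin D) → Smooth D) :
    SymmetricOn (Finset.univ.filter fun x : Fin (q + j) => (x : ℕ) < j) (gradIter j T) := by
  suffices h : ∀ a b : Fin (q + j), (a : ℕ) < j → (b : ℕ) < j →
      perm (swap a b) (gradIter j T) = gradIter j T from
    fun a ha b hb => h a b (by simpa using ha) (by simpa using hb)
  induction j with
  | zero => exact fun a _ ha => absurd ha (Nat.not_lt_zero _)
  | succ j ih =>
    have hs : ∀ a b : Fin (q + j), (a : ℕ) < j → (b : ℕ) < j →
        perm (swap a.succ b.succ) (gradIter (j + 1) T) = gradIter (j + 1) T := by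
      intro a b ha hb
      rw [← liftPerm_swap, gradIter_succ, perm_liftPerm_grad, ih a b ha hb]
    have h0 : ∀ b : Fin (q + j), (b : ℕ) < j →
        perm (swap 0 b.succ) (gradIter (j + 1) T) = gradIter (j + 1) T := by
      intro b hb
      obtain ⟨j, rfl⟩ : ∃ i, j = i + 1 := ⟨j - 1, by omega⟩
      have h01 : perm (swap (0 : Fin (q + j + 2)) 1) (gradIter (j + 1 + 1) T) =
          gradIter (j + 1 + 1) T := perm_swap_zero_one_grad_grad _
      by_cases hb0 : b = (0 : Fin (q + j + 1))
      · subst hb0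
        exact h01
      -- The newest derivative is exchanged with any other by conjugating the exchange of the two
      -- newest ones.
      · have h1 : swap (0 : Fin (q + j + 1 + 1)) b.succ =
            swap (1 : Fin (q + j + 2)) b.succ * swap 0 1 * swap 1 b.succ := by
          rw [Equiv.swap_mul_swap_mul_swap (Fin.zero_ne_one) (Fin.succ_ne_zero b).symm,
            Equiv.swap_comm]
        have h2 : perm (swap (1 : Fin (q + j + 2)) b.succ) (gradIter (j + 1 + 1) T) =
            gradIter (j + 1 + 1) T := by
          rw [← Fin.succ_zero_eq_one]
          exact hs 0 b (Nat.succ_pos _) hb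
        refine (congrArg (fun σ => perm σ (gradIter (j + 1 + 1) T)) h1).trans ?_
        rw [perm_mul, h2, perm_mul, h01, h2]
    intro a b
    refine Fin.cases (fun _ => ?_) (fun a ha => ?_) a
    · refine Fin.cases (fun _ => ?_) (fun b hb => ?_) b
      · rw [Equiv.swap_self]; rfl
      · exact h0 b (by simpa using hb)
    · refine Fin.cases (fun _ => ?_) (fun b hb => ?_) b
      · rw [Equiv.swap_comm]
        exact h0 a (by simpa using ha)
      · exact hs a b (by simpa using ha) (by simpa using hb)

/-- A permutation that fixes the indices of the derivatives permutes the components. -/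
theorem exists_perm_gradIter {j : ℕ} {σ : Equiv.Perm (Fin (q + j))}
    (hσ : ∀ x : Fin (q + j), (x : ℕ) < j → σ x = x) :
    ∃ τ : Equiv.Perm (Fin q), (σ ∈ fiberPerms (rowOf M (q + j)) → τ ∈ fiberPerms (rowOf M q)) ∧
      ∀ T : (Fin q → Fin D) → Smooth D, perm σ (gradIter j T) = gradIter j (perm τ T) := by
  induction j with
  | zero => exact ⟨σ, id, fun T => rfl⟩
  | succ j ih =>
    obtain ⟨σ', rfl⟩ := exists_eq_liftPerm (p := q + j) (hσ 0 (Nat.succ_pos _))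
    obtain ⟨τ, hτ, h⟩ := ih (σ := σ') fun x hx => by
      have h1 := hσ x.succ (by simpa using hx)
      exact Fin.succ_injective _ ((liftPerm_succ σ' x).symm.trans h1)
    refine ⟨τ, fun h1 => hτ ?_, fun T => ?_⟩
    · exact (liftPerm_mem_fiberPerms rowOf_succ).1 h1
    · rw [gradIter_succ, gradIter_succ, ← h, ← perm_liftPerm_grad]

/-- The Young symmetrizer of the diagram with rows of `M` cells, without its normalization. -/
noncomputable def youngOp (M p : ℕ) {D : ℕ} {F : Type} [AddCommGroup F] [Module ℝ F] :
    ((Fin p → Fin D) → F) →ₗ[ℝ] ((Fin p → Fin D) → F) :=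
  altSum (colOf M p) ∘ₗ symSum (rowOf M p)

theorem youngOp_apply {F : Type} [AddCommGroup F] [Module ℝ F] (T : (Fin p → Fin D) → F) :
    youngOp M p T = altSum (colOf M p) (symSum (rowOf M p) T) := rfl

theorem exists_youngOp_youngOp (hM : 0 < M) (p : ℕ) :
    ∃ c : ℝ, c ≠ 0 ∧ ∀ (D : ℕ) (F : Type) [AddCommGroup F] [Module ℝ F]
      (T : (Fin p → Fin D) → F), youngOp M p (youngOp M p T) = c • youngOp M p T :=
  (isFrame_rowOf hM p).exists_idempotent

theorem exists_youngOp_grad_youngOp (hM : 0 < M) (p : ℕ) :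
    ∃ c : ℝ, c ≠ 0 ∧ ∀ (D : ℕ) (T : (Fin p → Fin D) → Smooth D),
      youngOp M (p + 1) (grad (youngOp M p T)) = c • youngOp M (p + 1) (grad T) := by
  obtain ⟨c, hc0, hc⟩ := (isFrame_rowOf hM p).exists_absorb (isFrame_rowOf hM (p + 1)) rowOf_succ
  refine ⟨c, hc0, fun D T => ?_⟩
  have h := hc D (Smooth D) fun ν μ => Smooth.pd ν (T μ)
  have h1 : ∀ ν, (fun μ => Smooth.pd ν (symSum (rowOf M p) T μ)) =
      symSum (rowOf M p) fun μ => Smooth.pd ν (T μ) := by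
    intro ν
    funext μ
    simp only [symSum_apply, Finset.sum_apply, perm_apply, map_sum]
  rw [youngOp_apply, youngOp_apply, youngOp_apply, grad_altSum]
  simp only [h1]
  exact h

/-- A symmetrizer inserted after j derivatives only costs the factor `c'`; this gives access to the
induction hypothesis, and `c'` is cancelled afterwards. -/
theorem exists_youngOp_gradIter_youngOp (hM : 0 < M) (q j : ℕ) :
    ∃ c : ℝ, c ≠ 0 ∧ ∀ (D : ℕ) (T : (Fin q → Fin D) → Smooth D),
      youngOp M (q + j) (gradIter j (youngOp M q T)) = c • youngOp M (q + j) (gradIter j T) := by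
  induction j with
  | zero =>
    obtain ⟨c, hc0, hc⟩ := exists_youngOp_youngOp hM q
    exact ⟨c, hc0, fun D T => hc D _ T⟩
  | succ j ih =>
    obtain ⟨c, hc0, hc⟩ := ih
    obtain ⟨c', hc0', hc'⟩ := exists_youngOp_grad_youngOp hM (q + j)
    refine ⟨c, hc0, fun D T => smul_right_injective _ hc0' ?_⟩
    change c' • youngOp M (q + j + 1) (grad (gradIter j (youngOp M q T))) =
      c' • c • youngOp M (q + j + 1) (grad (gradIter j T))
    rw [← hc', hc, grad_smul, map_smul, hc', smul_comm]

theorem symSum_gradIter_symSum (j : ℕ) (T : (Fin q → Fin D) → Smooth D) :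
    symSum (rowOf M (q + j)) (gradIter j (symSum (rowOf M q) T)) =
      ((fiberPerms (rowOf M q)).card : ℝ) • symSum (rowOf M (q + j)) (gradIter j T) := by
  induction j with
  | zero => exact symSum_symSum T
  | succ j ih =>
    have h : ∀ U : (Fin (q + j) → Fin D) → Smooth D, symSum (rowOf M (q + j + 1)) (grad U) =
        ((fiberPerms (rowOf M (q + j))).card : ℝ)⁻¹ •
          symSum (rowOf M (q + j + 1)) (grad (symSum (rowOf M (q + j)) U)) := by
      intro U
      rw [grad_symSum, symSum_consTensor_symSum rowOf_succ, smul_smul,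
        inv_mul_cancel₀ card_fiberPerms_ne_zero, one_smul]
      rfl
    change symSum (rowOf M (q + j + 1)) (grad (gradIter j _)) =
      _ • symSum (rowOf M (q + j + 1)) (grad (gradIter j T))
    rw [h, ih, grad_smul, map_smul, smul_comm, ← h]

/-- The derivatives of a tensor field of rectangular shape that is symmetric along the rows are
symmetric along the rows, if the indices of the derivatives are put into a new row. -/
theorem perm_gradIter_of_row {n k : ℕ} (hk : k ≤ M) {W : (Fin (M * n) → Fin D) → Smooth D}
    (hW : ∀ τ ∈ fiberPerms (rowOf M (M * n)), perm τ W = W)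
    {τ : Equiv.Perm (Fin (M * n + k))} (hτ : τ ∈ fiberPerms (rowOf M (M * n + k))) :
    perm τ (gradIter k W) = gradIter k W := by
  rcases Nat.eq_zero_or_pos k with rfl | hk0
  · exact hW τ hτ
  -- Cells are numbered backwards, so the k ≤ M derivative indices form row n, below the full
  -- rectangle.
  have hrow : ∀ x : Fin (M * n + k), (x : ℕ) < k ↔ rowOf M (M * n + k) x = n := by
    intro x
    have hx := x.isLt
    rw [rowOf, Fin.val_rev, Nat.div_eq_iff (by omega), mul_comm n M]
    omega
  -- Since derivatives commute, τ may be corrected by transpositions until it fixes all derivative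
  -- indices; it then acts on `W` alone.
  induction h : (Finset.univ.filter fun x : Fin (M * n + k) => (x : ℕ) < k ∧ τ x ≠ x).card
    using Nat.strong_induction_on generalizing τ with
  | _ m ih =>
    by_cases hfix : ∀ x : Fin (M * n + k), (x : ℕ) < k → τ x = x
    · obtain ⟨τ', hτ', h1⟩ := exists_perm_gradIter (D := D) (M := M) hfix
      rw [h1, hW τ' (hτ' hτ)]
    push Not at hfix
    obtain ⟨x, hxk, hx⟩ := hfix
    have hinv : rowOf M (M * n + k) (τ.symm x) = rowOf M (M * n + k) x := by
      rw [← mem_fiberPerms.1 hτ, Equiv.apply_symm_apply]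
    have hyk : (τ.symm x : ℕ) < k := by rw [hrow, hinv, ← hrow]; exact hxk
    have h2 : perm τ (gradIter k W) = perm (τ * swap x (τ.symm x)) (gradIter k W) := by
      rw [perm_mul, symmetricOn_gradIter k W x (by simpa using hxk) _ (by simpa using hyk)]
    rw [h2]
    refine ih _ ?_ (mul_mem_fiberPerms hτ (swap_mem_fiberPerms hinv.symm)) rfl
    rw [← h]
    refine Finset.card_lt_card ⟨fun y hy => ?_, fun hsub => ?_⟩
    · rw [Finset.mem_filter] at hy ⊢
      refine ⟨hy.1, hy.2.1, fun hy' => hy.2.2 ?_⟩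
      rw [Equiv.Perm.mul_apply, Equiv.swap_apply_of_ne_of_ne, hy']
      · rintro rfl; exact hx hy'
      · rintro rfl
        rw [Equiv.apply_symm_apply] at hy'
        exact hx (by conv_lhs => rw [hy', Equiv.apply_symm_apply])
    · refine (Finset.mem_filter.1 (hsub (Finset.mem_filter.2
        ⟨Finset.mem_univ x, hxk, hx⟩))).2.2 ?_
      rw [Equiv.Perm.mul_apply, Equiv.swap_apply_left, Equiv.apply_symm_apply]

/-- For rectangular shapes the kernel of the iterated differential is given by the
antisymmetrization alone. -/
theorem altSum_gradIter_eq_zero {n k : ℕ} (hk : k ≤ M) (hp : p = M * n)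
    {T : (Fin p → Fin D) → Smooth D} (hT : youngOp M (p + k) (gradIter k T) = 0) :
    altSum (colOf M (p + k)) (gradIter k (symSum (rowOf M p) T)) = 0 := by
  subst hp
  have h1 := symSum_gradIter_symSum (M := M) k T
  rw [symSum_of_invariant fun τ hτ =>
    perm_gradIter_of_row hk (fun τ' hτ' => perm_symSum T hτ') hτ] at h1
  have h2 := congrArg (altSum (colOf M (M * n + k))) h1
  rw [map_smul, map_smul, ← youngOp_apply, hT, smul_zero] at h2
  exact (smul_eq_zero.1 h2).resolve_left card_fiberPerms_ne_zero

/-- For rectangular shapes the Young symmetrizer moves the indices of derivatives to the end of the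
last row. -/
theorem youngOp_perm_gradIter_mem_range {n j : ℕ} (hM : 0 < M) (hj : j ≤ M) (hn : 0 < n)
    (hq : q + j = M * n) (σ : Equiv.Perm (Fin (q + j))) (T : (Fin q → Fin D) → Smooth D) :
    youngOp M (q + j) (perm σ (gradIter j T)) ∈
      LinearMap.range (youngOp M (q + j) ∘ₗ gradIter (q := q) (D := D) j) := by
  have hn1 : (n - 1 + 1) * M ≤ q + j := by
    rw [Nat.sub_add_cancel hn, hq, mul_comm]
  have hX : ∀ x ∈ (Finset.univ.filter fun x : Fin (q + j) => (x : ℕ) < j),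
      rowOf M (q + j) x = n - 1 := by
    intro x hx
    have hx1 : (x : ℕ) < j := by simpa using hx
    have hx2 := x.isLt
    rw [add_mul, one_mul] at hn1
    have h3 : (n - 1) * M + M = q + j := by
      rw [hq, Nat.sub_mul, one_mul, mul_comm n M]
      exact Nat.sub_add_cancel (Nat.le_mul_of_pos_right M hn)
    rw [rowOf, Fin.val_rev, Nat.div_eq_iff hM]
    omega
  have h1 := symSum_perm_mem_sup (rowOf M (q + j)) (card_rowOf_eq hM hn1) hX
    (symmetricOn_gradIter j T) σ
  have h2 : overSymmetric M ⊔ Submodule.span ℝ {U | ∃ τ : Equiv.Perm (Fin (q + j)),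
      (∀ x ∈ (Finset.univ.filter fun x : Fin (q + j) => (x : ℕ) < j), τ x = x) ∧
        U = symSum (rowOf M (q + j)) (perm τ (gradIter j T))} ≤
      (LinearMap.range (youngOp M (q + j) ∘ₗ gradIter (q := q) (D := D) j)).comap
        (altSum (colOf M (q + j))) := by
    -- The antisymmetrizer kills the over-symmetric part; the other permutations fix the derivative
    -- indices and can be applied before differentiating.
    refine sup_le (fun U hU => ?_) (Submodule.span_le.2 ?_)
    · rw [Submodule.mem_comap, altSum_eq_zero (isFrame_rowOf hM (q + j)).col_lt hU]
      exact Submodule.zero_mem _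
    · rintro U ⟨τ, hτ, rfl⟩
      obtain ⟨τ', -, h⟩ := exists_perm_gradIter (D := D) (M := M) (σ := τ)
        fun x hx => hτ x (by simpa using hx)
      rw [h]
      exact ⟨perm τ' T, rfl⟩
  exact h2 h1

end Gradient

open scoped TensorProduct

/-! ### Multiforms and the action of gl(1|M) on them. -/

section Fock

variable {M D p q : ℕ}

/-- The exterior algebra on generators labelled by columns and indices. -/
abbrev Fermions (M D : ℕ) : Type := ExteriorAlgebra ℝ (Fin M × Fin D → ℝ)

namespace Fermions

/-- Multiplication by a generator. -/
noncomputable def create (x : Fin M × Fin D) : Module.End ℝ (Fermions M D) :=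
  LinearMap.mulLeft ℝ (ExteriorAlgebra.ι ℝ (Pi.single x 1))

/-- Contraction with a coordinate. -/
noncomputable def annihilate (x : Fin M × Fin D) : Module.End ℝ (Fermions M D) :=
  CliffordAlgebra.contractLeft (LinearMap.proj x)

theorem create_create (x y : Fin M × Fin D) (w : Fermions M D) :
    create x (create y w) = - create y (create x w) := by
  simp only [create, LinearMap.mulLeft_apply, ← mul_assoc, ← neg_mul]
  rw [eq_neg_of_add_eq_zero_left (ExteriorAlgebra.ι_add_mul_swap _ _), neg_mul, neg_mul, neg_mul]

theorem annihilate_annihilate (x y : Fin M × Fin D) (w : Fermions M D) :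
    annihilate x (annihilate y w) = - annihilate y (annihilate x w) :=
  CliffordAlgebra.contractLeft_comm _ _ w

theorem annihilate_create (x y : Fin M × Fin D) (w : Fermions M D) :
    annihilate x (create y w) = (if x = y then w else 0) - create y (annihilate x w) := by
  rw [create, annihilate, LinearMap.mulLeft_apply, LinearMap.mulLeft_apply,
    CliffordAlgebra.contractLeft_ι_mul, LinearMap.proj_apply, Pi.single_apply, ite_smul, one_smul,
    zero_smul]

theorem create_annihilate (x y : Fin M × Fin D) (w : Fermions M D) :
    create x (annihilate y w) = (if x = y then w else 0) - annihilate y (create x w) := by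
  rw [annihilate_create, if_congr eq_comm rfl rfl, sub_sub_cancel]

end Fermions

open Fermions

/-- The exterior algebra with smooth functions as coefficients. -/
abbrev Fock (M D : ℕ) : Type := Smooth D ⊗[ℝ] Fermions M D

namespace Fock

/-- The exterior derivative with respect to the generators of a column. -/
noncomputable def der (a : Fin M) : Module.End ℝ (Fock M D) :=
  ∑ ν, TensorProduct.map (Smooth.pd ν) (create (a, ν))

/-- The contraction of the generators of a column with the Euler vector field. -/
noncomputable def con (a : Fin M) : Module.End ℝ (Fock M D) :=
  ∑ ν, TensorProduct.map (Smooth.xm ν) (annihilate (a, ν))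

/-- The derivation that replaces generators of the column `b` by generators of the column `a`. -/
noncomputable def move (a b : Fin M) : Module.End ℝ (Fock M D) :=
  ∑ ν, TensorProduct.map LinearMap.id (create (a, ν) * annihilate (b, ν))

theorem der_tmul (a : Fin M) (f : Smooth D) (w : Fermions M D) :
    der a (f ⊗ₜ[ℝ] w) = ∑ ν, Smooth.pd ν f ⊗ₜ[ℝ] create (a, ν) w := by
  simp [der]

theorem con_tmul (a : Fin M) (f : Smooth D) (w : Fermions M D) :
    con a (f ⊗ₜ[ℝ] w) = ∑ ν, Smooth.xm ν f ⊗ₜ[ℝ] annihilate (a, ν) w := by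
  simp [con]

theorem move_tmul (a b : Fin M) (f : Smooth D) (w : Fermions M D) :
    move a b (f ⊗ₜ[ℝ] w) = ∑ ν, f ⊗ₜ[ℝ] create (a, ν) (annihilate (b, ν) w) := by
  simp [move]

/-- The action of `gl(1|M)` on the exterior algebra with smooth functions as coefficients. -/
noncomputable def superRep (M D : ℕ) : SuperRep M (Fock M D) where
  d := der
  K := con
  E := move
  L := TensorProduct.map Smooth.euler LinearMap.id
  d_d a b w := by
    induction w using TensorProduct.induction_on with
    | zero => simp
    | add w w' h h' => simp only [map_add, h, h', neg_add]
    | tmul f w =>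
      simp only [der_tmul, map_sum]
      rw [Finset.sum_comm, ← Finset.sum_neg_distrib]
      refine Finset.sum_congr rfl fun ν _ => ?_
      rw [← Finset.sum_neg_distrib]
      refine Finset.sum_congr rfl fun ν' _ => ?_
      rw [Smooth.pd_comm, create_create, TensorProduct.tmul_neg]
  K_K a b w := by
    induction w using TensorProduct.induction_on with
    | zero => simp
    | add w w' h h' => simp only [map_add, h, h', neg_add]
    | tmul f w =>
      simp only [con_tmul, map_sum]
      rw [Finset.sum_comm, ← Finset.sum_neg_distrib]
      refine Finset.sum_congr rfl fun ν _ => ?_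
      rw [← Finset.sum_neg_distrib]
      refine Finset.sum_congr rfl fun ν' _ => ?_
      rw [Smooth.xm_comm, annihilate_annihilate, TensorProduct.tmul_neg]
  d_K a b w := by
    induction w using TensorProduct.induction_on with
    | zero => simp
    | add w w' h h' =>
      simp only [map_add, h, h']
      split_ifs <;> abel
    | tmul f w =>
      -- Of the two corrections for ν' = ν, the one from the generators (if a = b) sums to the Euler
      -- operator, and the one from ∂ and x sums to `move`.
      have h1 : ∀ ν ν', Smooth.pd ν' (Smooth.xm ν f) ⊗ₜ[ℝ] create (a, ν') (annihilate (b, ν) w) =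
          ((if ν' = ν then if a = b then Smooth.xm ν (Smooth.pd ν' f) ⊗ₜ[ℝ] w else 0 else 0) +
            if ν' = ν then f ⊗ₜ[ℝ] create (a, ν') (annihilate (b, ν) w) else 0) -
            Smooth.xm ν (Smooth.pd ν' f) ⊗ₜ[ℝ] annihilate (b, ν) (create (a, ν') w) := by
        intro ν ν'
        rw [Smooth.pd_xm, TensorProduct.add_tmul, create_annihilate]
        by_cases h : ν' = ν
        · subst h
          by_cases h' : a = b
          · subst h'
            simp [TensorProduct.tmul_sub]
            abel
          · simp [h', TensorProduct.tmul_neg]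
            abel
        · simp [h, TensorProduct.tmul_neg]
      simp only [der_tmul, con_tmul, move_tmul, map_sum, h1, Finset.sum_sub_distrib,
        Finset.sum_add_distrib, Finset.sum_ite_eq', Finset.mem_univ, if_true]
      congr 1
      · congr 1
        split_ifs
        · simp [Smooth.euler_apply, TensorProduct.sum_tmul]
        · simp
      · exact Finset.sum_comm
  E_d a b c w := by
    induction w using TensorProduct.induction_on with
    | zero => simp
    | add w w' h h' =>
      simp only [map_add, h, h']
      split_ifs <;> abel
    | tmul f w =>
      have h1 : ∀ ν ν', Smooth.pd ν f ⊗ₜ[ℝ] create (a, ν')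
          (annihilate (b, ν') (create (c, ν) w)) =
          Smooth.pd ν f ⊗ₜ[ℝ] create (c, ν) (create (a, ν') (annihilate (b, ν') w)) +
            if ν' = ν then if b = c then Smooth.pd ν f ⊗ₜ[ℝ] create (a, ν') w else 0 else 0 := by
        intro ν ν'
        rw [annihilate_create, map_sub, create_create (a, ν') (c, ν), sub_neg_eq_add,
          TensorProduct.tmul_add, add_comm]
        congr 1
        by_cases h : ν' = ν <;> by_cases h' : b = c <;> simp [h, h']
      simp only [der_tmul, move_tmul, map_sum, h1,
        Finset.sum_add_distrib, Finset.sum_ite_eq', Finset.mem_univ, if_true]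
      congr 1
      · exact Finset.sum_comm
      · split_ifs
        · rfl
        · simp
  E_K a b c w := by
    induction w using TensorProduct.induction_on with
    | zero => simp
    | add w w' h h' =>
      simp only [map_add, h, h']
      split_ifs <;> abel
    | tmul f w =>
      have h1 : ∀ ν ν', Smooth.xm ν f ⊗ₜ[ℝ] create (a, ν')
          (annihilate (b, ν') (annihilate (c, ν) w)) =
          Smooth.xm ν f ⊗ₜ[ℝ] annihilate (c, ν) (create (a, ν') (annihilate (b, ν') w)) -
            if ν' = ν then if a = c then Smooth.xm ν f ⊗ₜ[ℝ] annihilate (b, ν') w else 0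
              else 0 := by
        intro ν ν'
        rw [annihilate_annihilate, map_neg, create_annihilate, neg_sub,
          TensorProduct.tmul_sub]
        congr 1
        by_cases h : ν' = ν <;> by_cases h' : a = c <;> simp [h, h']
      simp only [con_tmul, move_tmul, map_sum, h1,
        Finset.sum_sub_distrib, Finset.sum_ite_eq', Finset.mem_univ, if_true]
      congr 1
      · exact Finset.sum_comm
      · split_ifs
        · rfl
        · simp
  L_d c w := by
    induction w using TensorProduct.induction_on with
    | zero => simp
    | add w w' h h' => simp only [map_add, h, h']; abel
    | tmul f w =>
      simp only [der_tmul, map_sum, TensorProduct.map_tmul, LinearMap.id_apply,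
        ← Finset.sum_sub_distrib]
      refine Finset.sum_congr rfl fun ν _ => ?_
      have h : Smooth.pd ν (Smooth.euler f) = Smooth.euler (Smooth.pd ν f) + Smooth.pd ν f := by
        simp [Smooth.euler_apply, Smooth.pd_xm, Finset.sum_add_distrib, Smooth.pd_comm ν]
      rw [h, TensorProduct.add_tmul, add_sub_cancel_right]
  L_K c w := by
    induction w using TensorProduct.induction_on with
    | zero => simp
    | add w w' h h' => simp only [map_add, h, h']; abel
    | tmul f w =>
      simp only [con_tmul, map_sum, TensorProduct.map_tmul, LinearMap.id_apply,
        ← Finset.sum_add_distrib]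
      refine Finset.sum_congr rfl fun ν _ => ?_
      have h : Smooth.euler (Smooth.xm ν f) = Smooth.xm ν (Smooth.euler f) + Smooth.xm ν f := by
        have h1 : ∀ ν', Smooth.xm ν' (Smooth.pd ν' (Smooth.xm ν f)) =
            Smooth.xm ν (Smooth.xm ν' (Smooth.pd ν' f)) + if ν' = ν then Smooth.xm ν f else 0 := by
          intro ν'
          rw [Smooth.pd_xm, map_add, Smooth.xm_comm]
          by_cases hν : ν' = ν <;> simp [hν]
        simp [Smooth.euler_apply, h1, Finset.sum_add_distrib]
      rw [h, TensorProduct.add_tmul]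
  L_E a b w := by
    induction w using TensorProduct.induction_on with
    | zero => simp
    | add w w' h h' => simp only [map_add, h, h']
    | tmul f w => simp only [move_tmul, map_sum, TensorProduct.map_tmul, LinearMap.id_apply]

/-- The inverses of the shifted Euler operators act on the coefficients. -/
noncomputable def eulerInverse (M D : ℕ) : SuperRep.EulerInverse (superRep M D) where
  G s := TensorProduct.map (Smooth.eulerInv s) LinearMap.id
  d_G c s w := by
    induction w using TensorProduct.induction_on with
    | zero => simp
    | add w w' h h' => simp only [map_add, h, h']
    | tmul f w =>
      change der c _ = TensorProduct.map _ _ (der c _)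
      simp only [der_tmul, map_sum, TensorProduct.map_tmul, LinearMap.id_apply,
        Smooth.pd_eulerInv]
  E_G a b s w := by
    induction w using TensorProduct.induction_on with
    | zero => simp
    | add w w' h h' => simp only [map_add, h, h']
    | tmul f w =>
      change move a b _ = TensorProduct.map _ _ (move a b _)
      simp only [move_tmul, map_sum, TensorProduct.map_tmul, LinearMap.id_apply]
  L_G s hs w := by
    induction w using TensorProduct.induction_on with
    | zero => simp
    | add w w' h h' =>
      rw [map_add, map_add, smul_add, add_add_add_comm, h, h']
    | tmul f w =>
      change TensorProduct.map Smooth.euler LinearMap.id _ + _ = _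
      rw [TensorProduct.map_tmul, TensorProduct.map_tmul, LinearMap.id_apply,
        TensorProduct.smul_tmul', ← TensorProduct.add_tmul, Smooth.euler_eulerInv s hs]
      rfl

end Fock

end Fock

/-! ### Passage between tensor fields and multiforms. -/

section Embedding

variable {M D p q : ℕ}

namespace Fermions

/-- The product of the generators of the columns `c` with the indices `μ`. -/
noncomputable def monomial (c : Fin p → Fin M) (μ : Fin p → Fin D) : Fermions M D :=
  ExteriorAlgebra.ιMulti ℝ p fun i => Pi.single (c i, μ i) 1

theorem monomial_succ (c : Fin (p + 1) → Fin M) (μ : Fin (p + 1) → Fin D) :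
    monomial c μ = create (c 0, μ 0) (monomial (Fin.tail c) (Fin.tail μ)) :=
  ExteriorAlgebra.ιMulti_succ_apply _

theorem monomial_perm (σ : Equiv.Perm (Fin p)) (c : Fin p → Fin M) (μ : Fin p → Fin D) :
    monomial (c ∘ σ) (μ ∘ σ) = ((Equiv.Perm.sign σ : ℤ) : ℝ) • monomial c μ := by
  have h := (ExteriorAlgebra.ιMulti ℝ p (M := Fin M × Fin D → ℝ)).map_perm
    (fun i => Pi.single (c i, μ i) 1) σ
  rw [Units.smul_def, ← Int.cast_smul_eq_zsmul ℝ] at h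
  exact h

/-- The sum over ν of create-annihilate pairs is a derivation replacing column b by column a. -/
theorem sum_create_annihilate_create (a b c : Fin M) (μ : Fin D) (w : Fermions M D) :
    ∑ ν, create (a, ν) (annihilate (b, ν) (create (c, μ) w)) =
      (if c = b then create (a, μ) w else 0) +
        create (c, μ) (∑ ν, create (a, ν) (annihilate (b, ν) w)) := by
  have h : ∀ ν, create (a, ν) (annihilate (b, ν) (create (c, μ) w)) =
      (if ν = μ then if c = b then create (a, ν) w else 0 else 0) +
        create (c, μ) (create (a, ν) (annihilate (b, ν) w)) := by
    intro ν
    rw [annihilate_create, map_sub, create_create (a, ν) (c, μ), sub_neg_eq_add]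
    congr 1
    rcases eq_or_ne ν μ with h | h <;> rcases eq_or_ne c b with h' | h' <;>
      simp [h, h', Prod.ext_iff, eq_comm (a := b)]
  simp only [h, Finset.sum_add_distrib, Finset.sum_ite_eq', Finset.mem_univ, if_true, map_sum]

theorem sum_create_annihilate_monomial (a b : Fin M) (c : Fin p → Fin M) (μ : Fin p → Fin D) :
    ∑ ν, create (a, ν) (annihilate (b, ν) (monomial c μ)) =
      ∑ i, if c i = b then monomial (Function.update c i a) μ else 0 := by
  induction p with
  | zero =>
    have h : ∀ x : Fin M × Fin D, annihilate x (monomial c μ) = 0 := by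
      intro x
      rw [monomial, ExteriorAlgebra.ιMulti_zero_apply]
      exact CliffordAlgebra.contractLeft_one _ _
    simp [h]
  | succ p ih =>
    rw [monomial_succ, sum_create_annihilate_create, ih, Fin.sum_univ_succ, map_sum]
    congr 1
    · rw [monomial_succ, Function.update_self, Fin.tail_update_zero]
    · refine Finset.sum_congr rfl fun i _ => ?_
      rw [monomial_succ (Function.update c i.succ a), Fin.tail_update_succ,
        Function.update_of_ne (Fin.succ_ne_zero i).symm, apply_ite (create (c 0, μ 0)), map_zero]
      rfl

/-- The coefficient of a product of generators. -/
noncomputable def coeff :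
    {p : ℕ} → (Fin p → Fin M) → (Fin p → Fin D) → (Fermions M D →ₗ[ℝ] ℝ)
  | 0, _, _ => ExteriorAlgebra.algebraMapInv.toLinearMap
  | _ + 1, c, μ => coeff (Fin.tail c) (Fin.tail μ) ∘ₗ annihilate (c 0, μ 0)

theorem coeff_zero_create (c : Fin 0 → Fin M) (μ : Fin 0 → Fin D) (x : Fin M × Fin D)
    (w : Fermions M D) : coeff c μ (create x w) = 0 := by
  change ExteriorAlgebra.algebraMapInv (ExteriorAlgebra.ι ℝ (Pi.single x 1) * w) = 0
  rw [map_mul]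
  simp [ExteriorAlgebra.algebraMapInv]

theorem coeff_succ_create (c : Fin (p + 1) → Fin M) (μ : Fin (p + 1) → Fin D)
    (x : Fin M × Fin D) (w : Fermions M D) :
    coeff c μ (create x w) = (if (c 0, μ 0) = x then coeff (Fin.tail c) (Fin.tail μ) w
      else 0) - coeff (Fin.tail c) (Fin.tail μ) (create x (annihilate (c 0, μ 0) w)) := by
  change coeff (Fin.tail c) (Fin.tail μ) (annihilate (c 0, μ 0) (create x w)) = _
  rw [annihilate_create, map_sub, apply_ite (coeff (Fin.tail c) (Fin.tail μ)), map_zero]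

/-- The Laplace expansion: a generator multiplied in front is contracted with position i, with sign
(-1)^i. Coefficients of monomials are therefore determinants. -/
theorem coeff_create (c : Fin (p + 1) → Fin M) (μ : Fin (p + 1) → Fin D) (x : Fin M × Fin D)
    (w : Fermions M D) :
    coeff c μ (create x w) = ∑ i : Fin (p + 1), (-1 : ℝ) ^ (i : ℕ) *
      (if (c i, μ i) = x then 1 else 0) * coeff (c ∘ i.succAbove) (μ ∘ i.succAbove) w := by
  induction p generalizing w with
  | zero =>
    rw [coeff_succ_create, coeff_zero_create, sub_zero, Fin.sum_univ_one, Fin.val_zero, pow_zero,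
      one_mul, ite_mul, one_mul, zero_mul]
    rfl
  | succ p ih =>
    rw [coeff_succ_create, Fin.sum_univ_succ, sub_eq_add_neg, ih, ← Finset.sum_neg_distrib]
    congr 1
    · rw [Fin.val_zero, pow_zero, one_mul, ite_mul, one_mul, zero_mul]
      rfl
    · refine Finset.sum_congr rfl fun i _ => ?_
      have h2 : ∀ {α : Type} (g : Fin (p + 2) → α),
          Fin.tail (g ∘ i.succ.succAbove) = Fin.tail g ∘ i.succAbove := by
        intro α g
        funext m
        simp [Fin.tail]
      have h3 : coeff (c ∘ i.succ.succAbove) (μ ∘ i.succ.succAbove) w =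
          coeff (Fin.tail c ∘ i.succAbove) (Fin.tail μ ∘ i.succAbove)
            (annihilate (c 0, μ 0) w) := by
        rw [← h2, ← h2]
        change coeff _ _ (annihilate (c (i.succ.succAbove 0), μ (i.succ.succAbove 0)) w) = _
        rw [Fin.succ_succAbove_zero]
      rw [h3, Fin.val_succ, pow_succ, mul_neg_one, neg_mul, neg_mul]
      rfl

theorem coeff_monomial (c c' : Fin p → Fin M) (μ μ' : Fin p → Fin D) :
    coeff c μ (monomial c' μ') =
      (Matrix.of fun i j => if (c i, μ i) = (c' j, μ' j) then (1 : ℝ) else 0).det := by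
  induction p with
  | zero =>
    rw [Matrix.det_isEmpty, monomial, ExteriorAlgebra.ιMulti_zero_apply]
    exact map_one ExteriorAlgebra.algebraMapInv
  | succ p ih =>
    rw [monomial_succ, coeff_create, Matrix.det_succ_column_zero]
    refine Finset.sum_congr rfl fun i _ => ?_
    rw [ih]
    rfl

end Fermions

open Fermions

namespace Fock

/-- The element of the exterior algebra that has a tensor field as coefficients. -/
noncomputable def embed (c : Fin p → Fin M) :
    ((Fin p → Fin D) → Smooth D) →ₗ[ℝ] Fock M D where
  toFun U := ∑ μ, U μ ⊗ₜ[ℝ] monomial c μ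
  map_add' U V := by simp [TensorProduct.add_tmul, Finset.sum_add_distrib]
  map_smul' a U := by simp [Finset.smul_sum, TensorProduct.smul_tmul']

theorem embed_apply (c : Fin p → Fin M) (U : (Fin p → Fin D) → Smooth D) :
    embed c U = ∑ μ, U μ ⊗ₜ[ℝ] monomial c μ := rfl

theorem der_embed (a : Fin M) (c : Fin p → Fin M) (U : (Fin p → Fin D) → Smooth D) :
    der a (embed c U) = embed (Fin.cons a c) (grad U) := by
  rw [embed_apply, embed_apply, map_sum, ← (Fin.consEquiv fun _ => Fin D).sum_comp,
    Fintype.sum_prod_type, Finset.sum_comm]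
  refine Finset.sum_congr rfl fun μ _ => ?_
  rw [der_tmul]
  refine Finset.sum_congr rfl fun ν _ => ?_
  rw [monomial_succ, grad_apply]
  simp [Fin.consEquiv]

theorem move_embed (a b : Fin M) (c : Fin p → Fin M) (U : (Fin p → Fin D) → Smooth D) :
    move a b (embed c U) = ∑ i, if c i = b then embed (Function.update c i a) U else 0 := by
  have h : ∀ μ, move a b (U μ ⊗ₜ[ℝ] monomial c μ) =
      ∑ i, if c i = b then U μ ⊗ₜ[ℝ] monomial (Function.update c i a) μ else 0 := by
    intro μ
    rw [move_tmul, ← TensorProduct.tmul_sum, sum_create_annihilate_monomial,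
      TensorProduct.tmul_sum]
    refine Finset.sum_congr rfl fun i _ => ?_
    split_ifs
    · rfl
    · exact TensorProduct.tmul_zero _ _
  rw [embed_apply, map_sum, Finset.sum_congr rfl fun μ _ => h μ, Finset.sum_comm]
  refine Finset.sum_congr rfl fun i _ => ?_
  split_ifs
  · rfl
  · exact Finset.sum_const_zero

theorem embed_perm (σ : Equiv.Perm (Fin p)) (c : Fin p → Fin M)
    (U : (Fin p → Fin D) → Smooth D) :
    embed c (perm σ U) = ((Equiv.Perm.sign σ : ℤ) : ℝ) • embed (c ∘ σ) U := by
  have h : ∀ μ : Fin p → Fin D, monomial c μ =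
      ((Equiv.Perm.sign σ : ℤ) : ℝ) • monomial (c ∘ σ) (μ ∘ σ) := by
    intro μ
    rw [monomial_perm, smul_smul, sign_mul_self_real, one_smul]
  rw [embed_apply, embed_apply, Finset.smul_sum]
  refine Fintype.sum_equiv (Equiv.arrowCongr σ.symm (Equiv.refl (Fin D))) _ _ fun μ => ?_
  rw [h, TensorProduct.tmul_smul]
  rfl

/-- Generators of one column anticommute, so antisymmetrizing within the columns only multiplies the
multiform by the order of the column group. -/
theorem embed_eq_zero_of_altSum {c : Fin p → Fin M} {U : (Fin p → Fin D) → Smooth D}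
    (h : altSum (fun i => (c i : ℕ)) U = 0) : embed c U = 0 := by
  have h1 : embed c (altSum (fun i => (c i : ℕ)) U) =
      ((fiberPerms fun i => (c i : ℕ)).card : ℝ) • embed c U := by
    rw [altSum_apply, map_sum, Finset.sum_congr rfl fun σ hσ => ?_, Finset.sum_const,
      Nat.cast_smul_eq_nsmul]
    have h2 : c ∘ σ = c := by
      funext i
      exact Fin.ext (mem_fiberPerms.1 hσ i)
    rw [map_smul, embed_perm, smul_smul, sign_mul_self_real, one_smul, h2]
  rw [h, map_zero] at h1
  exact (smul_eq_zero.1 h1.symm).resolve_left card_fiberPerms_ne_zero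

theorem embed_eq_zero_of_swap {c : Fin p → Fin M} {U : (Fin p → Fin D) → Smooth D}
    {i j : Fin p} (hij : i ≠ j) (hU : perm (swap i j) U = U) (hc : c i = c j) :
    embed c U = 0 := by
  have h := embed_perm (swap i j) c U
  have h2 : c ∘ swap i j = c := by
    funext m
    rw [Function.comp_apply, Equiv.swap_apply_def]
    split_ifs with h1 h1
    · rw [h1, hc]
    · rw [h1, hc]
    · rfl
  rw [hU, h2, Equiv.Perm.sign_swap hij] at h
  simp only [Units.val_neg, Units.val_one, Int.cast_neg, Int.cast_one, neg_smul, one_smul] at h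
  have h3 : (2 : ℝ) • embed c U = 0 := by
    rw [two_smul]
    nth_rewrite 2 [h]
    exact add_neg_cancel _
  exact (smul_eq_zero.1 h3).resolve_left two_ne_zero

/-- The tensor field of the coefficients with respect to the products of the generators of given
columns. -/
noncomputable def comp (c : Fin p → Fin M) :
    Fock M D →ₗ[ℝ] ((Fin p → Fin D) → Smooth D) :=
  LinearMap.pi fun μ => TensorProduct.rid ℝ (Smooth D) ∘ₗ LinearMap.lTensor _ (coeff c μ)

theorem comp_tmul (c : Fin p → Fin M) (f : Smooth D) (w : Fermions M D) (μ : Fin p → Fin D) :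
    comp c (f ⊗ₜ[ℝ] w) μ = coeff c μ w • f := by
  simp [comp]

/-- The determinant compares columns as well as indices, so only the permutations preserving `c`
survive. -/
theorem comp_embed (c : Fin p → Fin M) (U : (Fin p → Fin D) → Smooth D) :
    comp c (embed c U) = altSum (fun i => (c i : ℕ)) U := by
  funext μ
  have h : ∀ μ' : Fin p → Fin D, coeff c μ (monomial c μ') =
      ∑ σ ∈ fiberPerms (fun i => (c i : ℕ)), if μ ∘ σ = μ' then
        ((Equiv.Perm.sign σ : ℤ) : ℝ) else 0 := by
    intro μ'
    rw [coeff_monomial, Matrix.det_apply', fiberPerms, Finset.sum_filter]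
    refine Finset.sum_congr rfl fun σ _ => ?_
    simp only [Matrix.of_apply]
    rw [Finset.prod_ite_zero, Finset.prod_const_one]
    simp only [Prod.mk.injEq, Finset.mem_univ, forall_const, forall_and, funext_iff,
      Function.comp_apply, Fin.val_inj]
    split_ifs <;> simp_all
  simp only [embed_apply, map_sum, Finset.sum_apply, comp_tmul, h, altSum_apply, Pi.smul_apply,
    perm_apply, Finset.sum_smul, ite_smul, zero_smul]
  rw [Finset.sum_comm]
  simp

theorem perm_cycleRange_symm_grad (i : Fin (p + 1)) (U : (Fin p → Fin D) → Smooth D)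
    (μ : Fin (p + 1) → Fin D) :
    perm i.cycleRange.symm (grad U) μ = Smooth.pd (μ i) (U (μ ∘ i.succAbove)) := by
  rw [perm_apply, grad_apply, Function.comp_apply, Fin.cycleRange_symm_zero]
  congr 2
  funext m
  exact congrArg μ (Fin.cycleRange_symm_succ i m)

/-- The generator created in front can be read off at any position i of column a; the cycle moves
the derivative index from the front to i. -/
theorem comp_der (a : Fin M) (c : Fin (p + 1) → Fin M) (Z : Fock M D) :
    comp c (der a Z) = ∑ i : Fin (p + 1), if c i = a then
      (-1 : ℝ) ^ (i : ℕ) • perm i.cycleRange.symm (grad (comp (c ∘ i.succAbove) Z)) else 0 := by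
  induction Z using TensorProduct.induction_on with
  | zero =>
    have h : grad (0 : (Fin p → Fin D) → Smooth D) = 0 := (gradIter 1).map_zero
    simp [h]
  | add Z Z' h h' =>
    rw [map_add, map_add, h, h', ← Finset.sum_add_distrib]
    refine Finset.sum_congr rfl fun i _ => ?_
    split_ifs
    · rw [map_add, grad_add, map_add, smul_add]
    · exact add_zero 0
  | tmul f w =>
    funext μ
    have h : ∀ ν, comp c (Smooth.pd ν f ⊗ₜ[ℝ] create (a, ν) w) μ =
        ∑ i : Fin (p + 1), if μ i = ν then if c i = a then (-1 : ℝ) ^ (i : ℕ) •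
          coeff (c ∘ i.succAbove) (μ ∘ i.succAbove) w • Smooth.pd ν f else 0 else 0 := by
      intro ν
      rw [comp_tmul, coeff_create, Finset.sum_smul]
      refine Finset.sum_congr rfl fun i _ => ?_
      by_cases h1 : μ i = ν <;> by_cases h2 : c i = a <;> simp [h1, h2, mul_smul]
    rw [der_tmul, map_sum, Finset.sum_apply, Finset.sum_apply, Finset.sum_congr rfl fun ν _ => h ν,
      Finset.sum_comm]
    refine Finset.sum_congr rfl fun i _ => ?_
    rw [Finset.sum_ite_eq, if_pos (Finset.mem_univ _)]
    split_ifs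
    · rw [Pi.smul_apply, perm_cycleRange_symm_grad, comp_tmul, map_smul]
    · rfl

/-- The components of elements of `dRange` are derivatives. -/
theorem comp_mem_span (j : ℕ) (c : Fin (q + j) → Fin M) {Z : Fock M D}
    (hZ : Z ∈ (superRep M D).dRange j) :
    comp c Z ∈ Submodule.span ℝ {V | ∃ (σ : Equiv.Perm (Fin (q + j)))
      (U : (Fin q → Fin D) → Smooth D), V = perm σ (gradIter j U)} := by
  induction j generalizing Z with
  | zero => exact Submodule.subset_span ⟨1, comp c Z, rfl⟩
  | succ j ih =>
    rw [← Submodule.mem_comap]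
    refine (superRep M D).dRange_succ_induction _ (fun a w hw => ?_) hZ
    rw [Submodule.mem_comap]
    change comp (p := q + j + 1) c (der a w) ∈ _
    rw [comp_der]
    refine Submodule.sum_mem _ fun i _ => ?_
    split_ifs
    · refine Submodule.smul_mem _ _ ?_
      have h1 := ih (c ∘ Fin.succAbove (n := q + j) i) hw
      refine Submodule.span_induction (p := fun V _ => perm i.cycleRange.symm (grad V) ∈ _)
        ?_ ?_ ?_ ?_ h1
      · rintro _ ⟨σ, U, rfl⟩
        refine Submodule.subset_span ⟨i.cycleRange.symm * liftPerm σ, U, ?_⟩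
        rw [← perm_liftPerm_grad]
        rfl
      · rw [← gradIter_zero (0 : (Fin (q + j) → Fin D) → Smooth D), ← gradIter_succ, map_zero,
          map_zero]
        exact Submodule.zero_mem _
      · intro V V' _ _ h h'
        rw [grad_add, map_add]
        exact Submodule.add_mem _ h h'
      · intro r V _ h
        rw [grad_smul, map_smul]
        exact Submodule.smul_mem _ r h
    · exact Submodule.zero_mem _

end Fock

end Embedding

/-! ### Rectangular diagrams: closed tensor fields give closed invariants. -/

section Rectangle

variable {M D n k p : ℕ}

namespace Fock

/-- The columns of the cells, if all of them are less than `M`. -/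
def column (hM : 0 < M) (p : ℕ) (i : Fin p) : Fin M := ⟨colOf M p i, Nat.mod_lt _ hM⟩

theorem exists_dWord_embed (c : Fin p → Fin M) (W : (Fin p → Fin D) → Smooth D)
    (I : List (Fin M)) : ∀ k, I.length = k → ∃ c' : Fin (p + k) → Fin M,
      (∀ i, c' (Fin.addNat i k) = c i) ∧
      (superRep M D).dWord I (embed c W) = embed c' (gradIter k W) := by
  induction I with
  | nil =>
    rintro k rfl
    exact ⟨c, fun i => rfl, rfl⟩
  | cons a I ih =>
    rintro k rfl
    obtain ⟨c', hc', h⟩ := ih _ rfl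
    refine ⟨Fin.cons (n := p + I.length) (α := fun _ => Fin M) a c', hc', ?_⟩
    rw [SuperRep.dWord_cons, h]
    exact der_embed a c' _

/-- This uses the rectangular shape: every row meets every column. -/
theorem exists_row_mate (hM : 0 < M) (i : Fin (M * n)) (a : Fin M) :
    ∃ j, rowOf M (M * n) j = rowOf M (M * n) i ∧ column hM (M * n) j = a := by
  have h1 : M * rowOf M (M * n) i + a < M * n := by
    have h2 : rowOf M (M * n) i < n := Nat.div_lt_of_lt_mul (Fin.rev i).isLt
    calc M * rowOf M (M * n) i + a < M * rowOf M (M * n) i + M := by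
          exact Nat.add_lt_add_left a.isLt _
      _ = M * (rowOf M (M * n) i + 1) := by rw [Nat.mul_succ]
      _ ≤ M * n := Nat.mul_le_mul_left M h2
  refine ⟨Fin.rev ⟨_, h1⟩, ?_, ?_⟩
  · rw [rowOf, Fin.rev_rev, Nat.mul_add_div hM, Nat.div_eq_of_lt a.isLt, add_zero]
  · apply Fin.ext
    change (Fin.rev (Fin.rev _) : ℕ) % M = a
    rw [Fin.rev_rev, Nat.mul_add_mod, Nat.mod_eq_of_lt a.isLt]

theorem card_column_eq (hM : 0 < M) (a : Fin M) :
    (Finset.univ.filter fun i => column hM (M * n) i = a).card = n := by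
  refine Eq.trans ?_ (Finset.card_range n)
  refine Finset.card_bij (fun i _ => rowOf M (M * n) i) (fun i _ => ?_) (fun i hi j hj h => ?_)
    (fun r hr => ?_)
  · exact Finset.mem_range.2 (Nat.div_lt_of_lt_mul (Fin.rev i).isLt)
  · have h1 : colOf M (M * n) i = colOf M (M * n) j :=
      congrArg Fin.val ((Finset.mem_filter.1 hi).2.trans (Finset.mem_filter.1 hj).2.symm)
    have e1 := Nat.div_add_mod (Fin.rev i : ℕ) M
    have e2 := Nat.div_add_mod (Fin.rev j : ℕ) M
    refine Fin.rev_injective (Fin.ext ?_)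
    rw [← e1, ← e2]
    exact congrArg₂ (fun r c => M * r + c) h h1
  · have hr1 := Nat.mul_lt_mul_of_pos_left (Finset.mem_range.1 hr) hM
    obtain ⟨j, h, hja⟩ := exists_row_mate hM (Fin.rev ⟨M * r, hr1⟩) a
    refine ⟨j, Finset.mem_filter.2 ⟨Finset.mem_univ _, hja⟩, h.trans ?_⟩
    rw [rowOf, Fin.rev_rev]
    exact Nat.mul_div_cancel_left r hM

theorem rowOf_addNat (i : Fin p) (k : ℕ) : rowOf M (p + k) (Fin.addNat i k) = rowOf M p i := by
  rw [rowOf, rowOf, Fin.val_rev, Fin.val_rev, Fin.val_addNat]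
  congr 1
  omega

theorem colOf_addNat (i : Fin p) (k : ℕ) : colOf M (p + k) (Fin.addNat i k) = colOf M p i := by
  rw [colOf, colOf, Fin.val_rev, Fin.val_rev, Fin.val_addNat]
  congr 1
  omega

/-- Replacing a column in a row does not contribute, by the symmetry along the rows. -/
theorem embed_update_eq_zero (hM : 0 < M) (hk : k ≤ M) {W : (Fin (M * n) → Fin D) → Smooth D}
    (hW : ∀ τ ∈ fiberPerms (rowOf M (M * n)), perm τ W = W) {c : Fin (M * n + k) → Fin M}
    (hc : ∀ i, c (Fin.addNat i k) = column hM (M * n) i) {a : Fin M} (i : Fin (M * n))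
    (hi : c (Fin.addNat i k) ≠ a) :
    embed (Function.update c (Fin.addNat i k) a) (gradIter k W) = 0 := by
  obtain ⟨j, hj, hja⟩ := exists_row_mate hM i a
  have hij : Fin.addNat i k ≠ Fin.addNat j k := by
    intro h
    rw [h, hc, hja] at hi
    exact hi rfl
  refine embed_eq_zero_of_swap hij ?_ ?_
  · refine perm_gradIter_of_row hk hW (swap_mem_fiberPerms ?_)
    rw [rowOf_addNat, rowOf_addNat, hj]
  · rw [Function.update_self, Function.update_of_ne hij.symm, hc, hja]

theorem colOf_of_lt (hk : k ≤ M) {x : Fin (M * n + k)} (hx : (x : ℕ) < k) :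
    colOf M (M * n + k) x = k - 1 - x := by
  have h : M * n + k - (x + 1) = M * n + (k - 1 - x) := by omega
  rw [colOf, Fin.val_rev, h, Nat.mul_add_mod, Nat.mod_eq_of_lt (by omega)]

theorem exists_addNat_eq {x : Fin (p + k)} (hx : ¬ (x : ℕ) < k) : ∃ i, Fin.addNat i k = x := by
  refine ⟨⟨x - k, by have := x.isLt; omega⟩, Fin.ext ?_⟩
  rw [Fin.val_addNat]
  exact Nat.sub_add_cancel (not_lt.1 hx)

/-- In a vanishing component, the column of the index of a derivative may be changed. -/
theorem embed_update_gradIter_eq_zero (hM : 0 < M) (hk : k ≤ M)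
    {W : (Fin (M * n) → Fin D) → Smooth D}
    (hW : ∀ τ ∈ fiberPerms (rowOf M (M * n)), perm τ W = W) {c : Fin (M * n + k) → Fin M}
    (hc : ∀ i, c (Fin.addNat i k) = column hM (M * n) i) {x : Fin (M * n + k)}
    (hcx : ∀ y : Fin (M * n + k), (y : ℕ) < k → c y = c x → y = x)
    (h0 : embed c (gradIter k W) = 0) (a : Fin M) :
    embed (Function.update c x a) (gradIter k W) = 0 := by
  rcases eq_or_ne (c x) a with h | h
  · rw [← h, Function.update_eq_self, h0]
  -- Moving column c x to a in a zero vector gives a sum of replacements. Old indices contribute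
  -- nothing, and x is the only derivative index in its column, so only the term of x is left.
  have h1 := move_embed a (c x) c (gradIter k W)
  rw [h0, map_zero, Finset.sum_eq_single x] at h1
  · rw [h1, if_pos rfl]
  · intro y _ hy
    split_ifs with h2
    · obtain ⟨i, rfl⟩ := exists_addNat_eq (fun h3 => hy (hcx y h3 h2))
      exact embed_update_eq_zero hM hk hW hc i (h2 ▸ h)
    · rfl
  · exact fun h2 => absurd (Finset.mem_univ _) h2

/-- The hypothesis concerns the derivatives in their standard columns, but a word in the d_a may put
them anywhere. Two derivatives in one column vanish by symmetry; otherwise induct on the number of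
nonstandard columns. -/
theorem embed_gradIter_eq_zero (hM : 0 < M) (hk : k ≤ M)
    {W : (Fin (M * n) → Fin D) → Smooth D}
    (hW : ∀ τ ∈ fiberPerms (rowOf M (M * n)), perm τ W = W)
    (h0 : altSum (colOf M (M * n + k)) (gradIter k W) = 0) {c : Fin (M * n + k) → Fin M}
    (hc : ∀ i, c (Fin.addNat i k) = column hM (M * n) i) :
    embed c (gradIter k W) = 0 := by
  by_cases hinj : ∀ x y : Fin (M * n + k), (x : ℕ) < k → (y : ℕ) < k → c x = c y → x = y
  swap
  · push Not at hinj
    obtain ⟨x, y, hx, hy, hxy, hne⟩ := hinj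
    exact embed_eq_zero_of_swap hne
      (symmetricOn_gradIter k W x (by simpa using hx) y (by simpa using hy)) hxy
  induction h : (Finset.univ.filter fun x => c x ≠ column hM (M * n + k) x).card
    using Nat.strong_induction_on generalizing c with
  | _ m ih =>
  by_cases hcol : ∀ x, c x = column hM (M * n + k) x
  · rw [funext hcol]
    exact embed_eq_zero_of_altSum h0
  push Not at hcol
  obtain ⟨x, hx⟩ := hcol
  have hxk : (x : ℕ) < k := by
    by_contra hxk
    obtain ⟨i, rfl⟩ := exists_addNat_eq hxk
    refine hx ((hc i).trans (Fin.ext ?_))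
    exact (colOf_addNat i k).symm
  have hcolinj : ∀ y : Fin (M * n + k), (y : ℕ) < k → column hM (M * n + k) y = column hM (M * n + k) x →
      y = x := by
    intro y hyk hyx
    have h1 : colOf M (M * n + k) y = colOf M (M * n + k) x := congrArg Fin.val hyx
    rw [colOf_of_lt hk hyk, colOf_of_lt hk hxk] at h1
    exact Fin.ext (by omega)
  -- If another derivative occupies the standard column of x, exchange the two. If not, put x there,
  -- apply the induction hypothesis and move the column back to c x.
  by_cases hy : ∃ y : Fin (M * n + k), (y : ℕ) < k ∧ c y = column hM (M * n + k) x
  · obtain ⟨y, hyk, hy⟩ := hy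
    have hxy : x ≠ y := by
      rintro rfl
      exact hx hy
    have h1 := embed_perm (swap x y) c (gradIter k W)
    rw [symmetricOn_gradIter k W x (by simpa using hxk) y (by simpa using hyk)] at h1
    rw [h1, ih _ _ _ _ rfl, smul_zero]
    · rw [← h]
      refine Finset.card_lt_card ⟨fun z hz => ?_, fun hsub => ?_⟩
      · rw [Finset.mem_filter] at hz ⊢
        refine ⟨hz.1, fun hz' => hz.2 ?_⟩
        rw [Function.comp_apply, Equiv.swap_apply_of_ne_of_ne, hz']
        · rintro rfl; exact hx hz'
        · rintro rfl
          exact hxy (hcolinj _ hyk (hz'.symm.trans hy)).symm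
      · refine (Finset.mem_filter.1 (hsub (Finset.mem_filter.2
          ⟨Finset.mem_univ x, hx⟩))).2 ?_
        rw [Function.comp_apply, Equiv.swap_apply_left, hy]
    · intro i
      rw [Function.comp_apply, Equiv.swap_apply_of_ne_of_ne, hc]
      · rintro rfl; rw [Fin.val_addNat] at hxk; omega
      · rintro rfl; rw [Fin.val_addNat] at hyk; omega
    · have hs : ∀ z : Fin (M * n + k), (z : ℕ) < k → (swap x y z : ℕ) < k := by
        intro z hz
        rw [Equiv.swap_apply_def]
        split_ifs <;> assumption
      intro z z' hz hz' hzz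
      exact (swap x y).injective (hinj _ _ (hs z hz) (hs z' hz') hzz)
  · push Not at hy
    have hc' : ∀ i, Function.update c x (column hM (M * n + k) x) (Fin.addNat i k) =
        column hM (M * n) i := by
      intro i
      rw [Function.update_of_ne, hc]
      rintro rfl; rw [Fin.val_addNat] at hxk; omega
    have hinj' : ∀ z z' : Fin (M * n + k), (z : ℕ) < k → (z' : ℕ) < k →
        Function.update c x (column hM (M * n + k) x) z =
          Function.update c x (column hM (M * n + k) x) z' → z = z' := by
      intro z z' hz hz' hzz
      rcases eq_or_ne z x with h1 | h1 <;> rcases eq_or_ne z' x with h2 | h2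
      · exact h1.trans h2.symm
      · rw [h1, Function.update_self, Function.update_of_ne h2] at hzz
        exact absurd hzz.symm (hy z' hz')
      · rw [h2, Function.update_self, Function.update_of_ne h1] at hzz
        exact absurd hzz (hy z hz)
      · rw [Function.update_of_ne h2, Function.update_of_ne h1] at hzz
        exact hinj z z' hz hz' hzz
    have h1 := embed_update_gradIter_eq_zero hM hk hW hc'
      (fun y hy h => hinj' y x hy hxk h) (ih _ ?_ hc' hinj' rfl) (c x)
    · rwa [Function.update_idem, Function.update_eq_self] at h1
    · rw [← h]
      refine Finset.card_lt_card ⟨fun z hz => ?_, fun hsub => ?_⟩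
      · rw [Finset.mem_filter] at hz ⊢
        refine ⟨hz.1, fun hz' => hz.2 ?_⟩
        rcases eq_or_ne z x with rfl | h1
        · rw [Function.update_self]
        · rw [Function.update_of_ne h1, hz']
      · refine (Finset.mem_filter.1 (hsub (Finset.mem_filter.2
          ⟨Finset.mem_univ x, hx⟩))).2 ?_
        rw [Function.update_self]

/-- The operator E_aa counts the n cells of column a. For a ≠ b, E_ab puts two cells of one row into
the same column, and row symmetry gives zero. -/
theorem embed_mem_closedInvariants (hM : 0 < M) (hk : k ≤ M) (hp : p = M * n)
    {W : (Fin p → Fin D) → Smooth D} (hW : ∀ τ ∈ fiberPerms (rowOf M p), perm τ W = W)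
    (h0 : altSum (colOf M (p + k)) (gradIter k W) = 0) :
    embed (column hM p) W ∈ (superRep M D).closedInvariants n k := by
  subst hp
  refine ⟨fun a b => ?_, fun I hI => ?_⟩
  · refine (move_embed a b _ W).trans ?_
    split_ifs with hab
    · subst hab
      rw [← Finset.sum_filter, Finset.sum_congr rfl fun i hi => ?_, Finset.sum_const,
        card_column_eq, Nat.cast_smul_eq_nsmul]
      rw [← (Finset.mem_filter.1 hi).2, Function.update_eq_self]
    · refine Finset.sum_eq_zero fun i _ => ?_
      split_ifs with hi
      · exact embed_update_eq_zero (k := 0) hM (Nat.zero_le M) hW (fun _ => rfl) i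
          (fun h => hab (h.symm.trans hi))
      · rfl
  · obtain ⟨c', hc', h⟩ := exists_dWord_embed (column hM (M * n)) W I k hI
    rw [h]
    exact embed_gradIter_eq_zero hM hk hW h0 hc'

end Fock

/-- The generalized Poincaré lemma before the projection to the symmetry type. -/
theorem altSum_mem_span (hM : 0 < M) {q j : ℕ} (hn : 1 ≤ n) (hj : j + k = M + 1) (hj1 : 1 ≤ j)
    (hq : q + j = M * n) {W : (Fin (q + j) → Fin D) → Smooth D}
    (hW : ∀ τ ∈ fiberPerms (rowOf M (q + j)), perm τ W = W)
    (h0 : altSum (colOf M (q + j + k)) (gradIter k W) = 0) :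
    altSum (colOf M (q + j)) W ∈
      Submodule.span ℝ {V | ∃ (σ : Equiv.Perm (Fin (q + j)))
        (U : (Fin q → Fin D) → Smooth D), V = perm σ (gradIter j U)} := by
  have h1 := Fock.comp_mem_span j (Fock.column hM (q + j))
    (SuperRep.mem_dRange_of_mem_closedInvariants (Fock.eulerInverse M D) hn hj
      (Fock.embed_mem_closedInvariants hM (by omega) hq hW h0))
  rwa [Fock.comp_embed] at h1

end Rectangle

/-! ### Functions whose derivatives of order k vanish. -/

section Polynomials

variable {D k : ℕ}

/-- The smooth functions whose partial derivatives of order `k` vanish. -/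
noncomputable def derivKer (D : ℕ) : ℕ → Submodule ℝ (Smooth D)
  | 0 => ⊥
  | k + 1 => ⨅ ν, (derivKer D k).comap (Smooth.pd ν)

theorem mem_derivKer_succ {f : Smooth D} :
    f ∈ derivKer D (k + 1) ↔ ∀ ν, Smooth.pd ν f ∈ derivKer D k := by
  rw [derivKer, Submodule.mem_iInf]
  rfl

theorem avg_mem_derivKer {f : Smooth D} (m : ℕ) (hf : f ∈ derivKer D k) :
    Smooth.avg m f ∈ derivKer D k := by
  induction k generalizing f m with
  | zero =>
    rw [derivKer, Submodule.mem_bot] at *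
    rw [hf, map_zero]
  | succ k ih =>
    rw [mem_derivKer_succ] at *
    intro ν
    rw [Smooth.pd_avg]
    exact ih _ (hf ν)

theorem derivKer_le_succ (D k : ℕ) : derivKer D k ≤ derivKer D (k + 1) := by
  induction k with
  | zero => exact bot_le
  | succ k ih =>
    intro f hf
    rw [mem_derivKer_succ] at *
    exact fun ν => ih (hf ν)

theorem xm_mem_derivKer {f : Smooth D} (ν : Fin D) (hf : f ∈ derivKer D k) :
    Smooth.xm ν f ∈ derivKer D (k + 1) := by
  induction k generalizing f with
  | zero =>
    rw [derivKer, Submodule.mem_bot] at hf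
    rw [hf, map_zero]
    exact Submodule.zero_mem _
  | succ k ih =>
    rw [mem_derivKer_succ]
    intro a
    rw [Smooth.pd_xm]
    refine Submodule.add_mem _ (ih (mem_derivKer_succ.1 hf a)) ?_
    split_ifs
    · exact hf
    · exact Submodule.zero_mem _

/-- In f = f(0) + ∑ x_ν avg(∂_ν f) the averages have vanishing derivatives of one order less, so
each summand is a coordinate times a polynomial of lower degree. -/
theorem val_mem_polyFunctions {f : Smooth D} (hf : f ∈ derivKer D k) :
    f.1 ∈ polyFunctions D k := by
  induction k generalizing f with
  | zero =>
    rw [derivKer, Submodule.mem_bot] at hf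
    rw [hf]
    exact Submodule.zero_mem _
  | succ k ih =>
    have h1 : f.1 = (fun _ => f.1 0) +
        ∑ ν, fun x : Fin D → ℝ => x ν * (Smooth.avg 0 (Smooth.pd ν f)).1 x := by
      funext x
      rw [Pi.add_apply, Finset.sum_apply]
      exact Smooth.apply_eq_add_sum f x
    rw [h1]
    refine Submodule.add_mem _ ⟨MvPolynomial.C (f.1 0), fun m hm => ?_, fun x => by simp⟩
      (Submodule.sum_mem _ fun ν _ => ?_)
    · rw [MvPolynomial.mem_support_iff, MvPolynomial.coeff_C] at hm
      have hm0 : m = 0 := by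
        by_contra h
        exact hm (if_neg (Ne.symm h))
      simp [hm0]
    · obtain ⟨P, hP, h⟩ := ih (avg_mem_derivKer 0 (mem_derivKer_succ.1 hf ν))
      refine ⟨MvPolynomial.X ν * P, fun m hm => ?_, fun x => by simp [h]⟩
      rw [MvPolynomial.support_X_mul, Finset.mem_map] at hm
      obtain ⟨m', hm', rfl⟩ := hm
      have h2 := hP m' hm'
      simp only [addLeftEmbedding_apply, map_add, Finsupp.degree_single]
      omega

theorem const_mem_derivKer (f : Smooth D) (h : ∀ x, f.1 x = f.1 0) : f ∈ derivKer D 1 := by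
  rw [mem_derivKer_succ]
  intro ν
  rw [derivKer, Submodule.mem_bot]
  apply Subtype.ext
  funext x
  rw [Smooth.pd_apply]
  have h1 : f.1 = fun _ => f.1 0 := funext h
  rw [h1]
  simp

theorem contDiff_eval (P : MvPolynomial (Fin D) ℝ) :
    ContDiff ℝ ∞ fun x : Fin D → ℝ => MvPolynomial.eval x P :=
  (AnalyticOnNhd.eval_mvPolynomial P).contDiff

theorem mem_derivKer_of_eval {f : Smooth D} (m : Fin D →₀ ℕ) (a : ℝ)
    (hf : ∀ x, f.1 x = MvPolynomial.eval x (MvPolynomial.monomial m a)) :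
    f ∈ derivKer D (m.degree + 1) := by
  induction h : m.degree generalizing m f with
  | zero =>
    rw [Finsupp.degree_eq_zero_iff] at h
    refine const_mem_derivKer f fun x => ?_
    rw [hf, hf, h]
    simp
  | succ r ih =>
    obtain ⟨ν, hν⟩ : ∃ ν, m ν ≠ 0 := by
      by_contra! hm
      have h0 : m = 0 := Finsupp.ext hm
      simp [h0] at h
    have hm : m = Finsupp.single ν 1 + (m - Finsupp.single ν 1) := by
      rw [add_tsub_cancel_of_le]
      rw [Finsupp.single_le_iff]
      omega
    set m' := m - Finsupp.single ν 1
    let g : Smooth D := ⟨fun x => MvPolynomial.eval x (MvPolynomial.monomial m' a),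
      contDiff_eval _⟩
    have hg : f = Smooth.xm ν g := by
      apply Subtype.ext
      funext x
      rw [hf, Smooth.xm_apply, hm, MvPolynomial.monomial_single_add, map_mul]
      simp [g]
    have hdeg : m'.degree = r := by
      rw [hm, map_add, Finsupp.degree_single] at h
      omega
    rw [hg]
    exact xm_mem_derivKer ν (ih m' (fun x => rfl) hdeg)

theorem mem_derivKer_iff {f : Smooth D} : f ∈ derivKer D k ↔ f.1 ∈ polyFunctions D k := by
  refine ⟨val_mem_polyFunctions, fun hf => ?_⟩
  obtain ⟨P, hP, h⟩ := hf
  have h1 : f = ∑ m ∈ P.support, (⟨_, contDiff_eval (MvPolynomial.monomial m (P.coeff m))⟩ :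
      Smooth D) := by
    apply Subtype.ext
    funext x
    rw [h, Submodule.coe_sum, Finset.sum_apply]
    conv_lhs => rw [P.as_sum, map_sum]
  rw [h1]
  refine Submodule.sum_mem _ fun m hm => ?_
  exact monotone_nat_of_le_succ (derivKer_le_succ D) (Nat.succ_le_of_lt (hP m hm))
    (mem_derivKer_of_eval m _ fun x => rfl)

end Polynomials

/-! ### Return to the complex and its cohomology. -/

section Components

variable {N D p q k : ℕ}

/-- The components of a tensor field. -/
noncomputable def components : Omega N D p →ₗ[ℝ] ((Fin p → Fin D) → Smooth D) where
  toFun T μ := ⟨fun x => T.1 x μ, contDiff_pi.1 T.2.1 μ⟩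
  map_add' _ _ := rfl
  map_smul' _ _ := rfl

theorem components_apply (T : Omega N D p) (μ : Fin p → Fin D) (x : Fin D → ℝ) :
    (components T μ).1 x = T.1 x μ := rfl

theorem components_injective : Function.Injective (components (N := N) (D := D) (p := p)) := by
  intro T U h
  apply Subtype.ext
  funext x μ
  exact congrFun (congrArg Subtype.val (congrFun h μ)) x

/-- The product of the hook lengths does not vanish. -/
theorem prod_hookLength_ne_zero (μ : YoungDiagram) :
    ((∏ c ∈ μ.cells, hookLength μ c : ℕ) : ℝ) ≠ 0 := by
  rw [Nat.cast_ne_zero, Finset.prod_ne_zero_iff]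
  rintro ⟨i, j⟩ hc
  have h1 := YoungDiagram.mem_iff_lt_rowLen.1 (YoungDiagram.mem_cells _ |>.1 hc)
  have h2 := YoungDiagram.mem_iff_lt_colLen.1 (YoungDiagram.mem_cells _ |>.1 hc)
  rw [hookLength]
  dsimp only
  omega

/-- Every later identity holds up to a nonzero scalar, so of the hook product only its nonvanishing
matters. -/
theorem exists_symY_eq (N p : ℕ) : ∃ a : ℝ, a ≠ 0 ∧ ∀ (D : ℕ) (t : Tensor D p),
    symY N D p t = a • youngOp (N - 1) p t := by
  refine ⟨_, inv_ne_zero (prod_hookLength_ne_zero (diagram N p)), fun D t => ?_⟩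
  have h1 : rowPerms (numbering N p) = fiberPerms (rowOf (N - 1) p) := rfl
  have h2 : colPerms (numbering N p) = fiberPerms (colOf (N - 1) p) := rfl
  rw [symY, youngSymmetrizer, h1, h2]
  rfl

theorem map_youngOp {F F' : Type} [AddCommGroup F] [Module ℝ F] [AddCommGroup F'] [Module ℝ F']
    (φ : F →ₗ[ℝ] F') (M : ℕ) (T : (Fin p → Fin D) → F) (μ : Fin p → Fin D) :
    φ (youngOp M p T μ) = youngOp M p (fun μ => φ (T μ)) μ := by
  simp only [youngOp_apply, altSum_apply, symSum_apply, Finset.sum_apply, Pi.smul_apply,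
    perm_apply, map_sum, map_smul]

theorem youngOp_val (M : ℕ) (T : (Fin p → Fin D) → Smooth D) (μ : Fin p → Fin D)
    (x : Fin D → ℝ) : (youngOp M p T μ).1 x = youngOp M p (fun μ => (T μ).1 x) μ :=
  map_youngOp (LinearMap.proj x ∘ₗ (Smooth D).subtype) M T μ

theorem exists_components_d (N p : ℕ) : ∃ a : ℝ, a ≠ 0 ∧ ∀ (D : ℕ) (T : Omega N D p),
    components (d N D p T) = a • youngOp (N - 1) (p + 1) (grad (components T)) := by
  obtain ⟨a, ha, h⟩ := exists_symY_eq N (p + 1)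
  refine ⟨a, ha, fun D T => ?_⟩
  funext μ
  apply Subtype.ext
  funext x
  have h1 : partialD T.1 x = fun μ => (grad (components T) μ).1 x := by
    funext μ
    have h2 := (hasFDerivAt_pi'.1 (T.2.1.differentiable (by simp) x).hasFDerivAt)
      (Fin.tail μ)
    rw [grad_apply, Smooth.pd_apply]
    exact (congrArg (fun L => L (Pi.single (μ 0) 1)) h2.fderiv).symm
  change symY N D (p + 1) (partialD T.1 x) μ = a • (youngOp (N - 1) (p + 1) (grad (components T)) μ).1 x
  rw [h, h1, youngOp_val]
  rfl

theorem exists_youngOp_components (hN : 0 < N - 1) (p : ℕ) : ∃ a : ℝ, a ≠ 0 ∧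
    ∀ (D : ℕ) (T : Omega N D p), components T = a • youngOp (N - 1) p (components T) := by
  obtain ⟨a, ha, h⟩ := exists_symY_eq N p
  obtain ⟨c, hc, h'⟩ := exists_youngOp_youngOp hN p
  refine ⟨c⁻¹, inv_ne_zero hc, fun D T => ?_⟩
  funext μ
  apply Subtype.ext
  funext x
  change T.1 x μ = c⁻¹ • (youngOp (N - 1) p (components T) μ).1 x
  rw [youngOp_val]
  change T.1 x μ = c⁻¹ • (youngOp (N - 1) p (T.1 x)) μ
  obtain ⟨t, ht⟩ := T.2.2 x
  rw [← ht, h, map_smul, h', smul_comm a]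
  exact (congrFun (inv_smul_smul₀ hc _) μ).symm

theorem exists_components_eq (N : ℕ) (U : (Fin p → Fin D) → Smooth D) :
    ∃ T : Omega N D p, components T = youngOp (N - 1) p U := by
  obtain ⟨a, ha, h⟩ := exists_symY_eq N p
  refine ⟨⟨fun x μ => (youngOp (N - 1) p U μ).1 x, contDiff_pi.2 fun μ => Smooth.contDiff _,
    fun x => ⟨a⁻¹ • fun μ => (U μ).1 x, ?_⟩⟩, rfl⟩
  rw [h, map_smul, smul_smul, mul_inv_cancel₀ ha, one_smul]
  funext μ
  exact (youngOp_val (N - 1) U μ x).symm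

/-- By absorption the intermediate projections disappear, so kernels and images of d^j involve a
single symmetrizer. For j = 0 it is there because the values of `T` have the symmetry type. -/
theorem exists_components_dPow (hN : 0 < N - 1) (q j : ℕ) : ∃ a : ℝ, a ≠ 0 ∧
    ∀ (D : ℕ) (T : Omega N D q), components (dPow N D q j T) =
      a • youngOp (N - 1) (q + j) (gradIter j (components T)) := by
  induction j with
  | zero => exact exists_youngOp_components hN q
  | succ j ih =>
    obtain ⟨a, ha, h⟩ := ih
    obtain ⟨b, hb, h'⟩ := exists_components_d N (q + j)
    obtain ⟨c, hc, h''⟩ := exists_youngOp_grad_youngOp hN (q + j)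
    refine ⟨b * (a * c), mul_ne_zero hb (mul_ne_zero ha hc), fun D T => ?_⟩
    change components (d N D (q + j) (dPow N D q j T)) = _
    rw [h', h, grad_smul, map_smul, h'', smul_smul, smul_smul, mul_assoc]
    rfl

theorem mem_kerPow_iff (hN : 0 < N - 1) {T : Omega N D p} :
    T ∈ kerPow N D k p ↔ youngOp (N - 1) (p + k) (gradIter k (components T)) = 0 := by
  obtain ⟨a, ha, h⟩ := exists_components_dPow hN p k
  rw [kerPow, LinearMap.mem_ker, ← components_injective.eq_iff, h, map_zero, smul_eq_zero]
  exact or_iff_right ha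

/-- The generalized Poincaré lemma. -/
theorem kerPow_le_range_dPow (hN : 0 < N - 1) {n j : ℕ} (hn : 1 ≤ n) (hk : 1 ≤ k)
    (hj1 : 1 ≤ j) (hj : j + k = N - 1 + 1) (hq : q + j = (N - 1) * n) :
    kerPow N D k (q + j) ≤ LinearMap.range (dPow N D q j) := by
  intro T hT
  rw [mem_kerPow_iff hN] at hT
  obtain ⟨a, ha, h1⟩ := exists_youngOp_components hN (q + j)
  obtain ⟨b, hb, h2⟩ := exists_youngOp_gradIter_youngOp hN q j
  obtain ⟨c, hc, h3⟩ := exists_components_dPow hN q j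
  have h4 := altSum_mem_span hN hn hj hj1 hq (fun τ hτ => perm_symSum (components T) hτ)
    (altSum_gradIter_eq_zero (by omega) hq hT)
  have h5 : youngOp (N - 1) (q + j) (youngOp (N - 1) (q + j) (components T)) ∈
      LinearMap.range (youngOp (N - 1) (q + j) ∘ₗ gradIter (q := q) (D := D) j) := by
    rw [← Submodule.mem_comap]
    refine Submodule.span_le.2 ?_ h4
    rintro _ ⟨σ, U, rfl⟩
    exact youngOp_perm_gradIter_mem_range hN (by omega) hn hq σ U
  obtain ⟨U, hU⟩ := h5
  obtain ⟨S, hS⟩ := exists_components_eq N U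
  -- The symmetrizer was applied twice to `T`, hence a * a; c and b come from d^j and from the
  -- symmetrizer contained in `S`.
  refine ⟨(c⁻¹ * b⁻¹ * (a * a)) • S, components_injective ?_⟩
  have h6 : components T = (a * a) • youngOp (N - 1) (q + j) (gradIter j U) := by
    refine Eq.trans ?_ (congrArg ((a * a) • ·) hU.symm)
    rw [mul_smul, ← map_smul, ← h1, ← h1]
  have h7 := h3 D S
  rw [hS, h2] at h7
  rw [map_smul, map_smul, h7, h6, smul_smul, smul_smul, mul_right_comm _ (a * a)]
  congr 1
  field_simp

theorem kerPow_le_imPow {n : ℕ} (hn : 1 ≤ n) (hk : 1 ≤ k) (hkN : k ≤ N - 1) :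
    kerPow N D k ((N - 1) * n) ≤ imPow N D (N - k) ((N - 1) * n) := by
  -- The source degree is nonnegative, as N - k ≤ N - 1 ≤ (N - 1) n.
  obtain ⟨q, hq⟩ : ∃ q, q + (N - k) = (N - 1) * n := by
    have h := Nat.le_mul_of_pos_right (N - 1) hn
    exact ⟨(N - 1) * n - (N - k), by omega⟩
  have h := kerPow_le_range_dPow (N := N) (D := D) (k := k) (by omega) hn hk
    (by omega) (by omega) hq
  rw [imPow]
  revert h
  rw [← hq]
  exact fun h => h.trans (le_iSup₂_of_le q rfl le_rfl)

theorem imPow_eq_bot {j : ℕ} (hj : 1 ≤ j) : imPow N D j 0 = ⊥ := by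
  rw [imPow, eq_bot_iff]
  exact iSup₂_le fun q h => absurd h (by omega)

/-- `gradIter` adds its last derivative outermost while `derivKer` peels off the innermost one; they
match because derivatives commute. -/
theorem gradIter_const_eq_zero_iff (g : (Fin 0 → Fin D) → Smooth D) :
    gradIter k g = 0 ↔ g Fin.elim0 ∈ derivKer D k := by
  induction k generalizing g with
  | zero =>
    rw [derivKer, Submodule.mem_bot, gradIter_zero]
    refine ⟨fun h => congrFun h _, fun h => funext fun μ => ?_⟩
    rw [Subsingleton.elim μ Fin.elim0, h]
    rfl
  | succ k ih =>
    have h1 : ∀ ν μ, gradIter k (fun μ => Smooth.pd ν (g μ)) μ =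
        Smooth.pd ν (gradIter k g μ) := by
      intro ν
      clear ih
      induction k with
      | zero => exact fun μ => rfl
      | succ k ih =>
        intro μ
        rw [gradIter_succ, gradIter_succ, grad_apply, grad_apply, ih, Smooth.pd_comm]
    rw [mem_derivKer_succ, gradIter_succ]
    have h2 : ∀ ν, Smooth.pd ν (g Fin.elim0) ∈ derivKer D k ↔
        gradIter k (fun μ => Smooth.pd ν (g μ)) = 0 := fun ν =>
      (ih fun μ => Smooth.pd ν (g μ)).symm
    simp only [h2]
    refine ⟨fun h ν => funext fun μ => ?_, fun h => funext fun μ => ?_⟩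
    · rw [h1]
      have h3 := congrFun h (Fin.cons ν μ)
      rwa [grad_apply, Fin.cons_zero, Fin.tail_cons] at h3
    · rw [grad_apply, ← h1, h]
      rfl

/-- The k ≤ N - 1 derivative indices lie in distinct columns, so the column group is trivial and the
rectangular kernel criterion with n = 0 gives the full tensor of k-th derivatives. -/
theorem mem_kerPow_zero_iff (hk : 1 ≤ k) (hkN : k ≤ N - 1) {T : Omega N D 0} :
    T ∈ kerPow N D k 0 ↔ (fun x => T.1 x Fin.elim0) ∈ polyFunctions D k := by
  have h1 : altSum (colOf (N - 1) (0 + k)) (gradIter k (components T)) =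
      gradIter k (components T) := by
    have h2 : fiberPerms (colOf (N - 1) (0 + k)) = {1} := by
      ext σ
      rw [mem_fiberPerms, Finset.mem_singleton]
      refine ⟨fun h => Equiv.ext fun i => ?_, fun h i => by rw [h]; rfl⟩
      have h3 := h i
      have h4 := (Fin.rev i).isLt
      have h5 := (Fin.rev (σ i)).isLt
      rw [colOf, colOf, Nat.mod_eq_of_lt (by omega), Nat.mod_eq_of_lt (by omega)] at h3
      exact Fin.rev_injective (Fin.ext h3)
    rw [altSum_apply, h2]
    simp [perm_one]
  have h3 : components T Fin.elim0 ∈ derivKer D k ↔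
      (fun x => T.1 x Fin.elim0) ∈ polyFunctions D k := mem_derivKer_iff
  rw [← h3, ← gradIter_const_eq_zero_iff, mem_kerPow_iff (by omega)]
  refine ⟨fun h => ?_, fun h => by rw [h, map_zero]⟩
  have h4 := altSum_gradIter_eq_zero hkN (Nat.mul_zero (N - 1)).symm h
  rw [symSum_of_invariant fun τ _ => by rw [Subsingleton.elim τ 1, perm_one], map_smul, map_smul,
    h1] at h4
  exact (smul_eq_zero.1 h4).resolve_left card_fiberPerms_ne_zero

theorem exists_omega_zero_eq (N : ℕ) {f : (Fin D → ℝ) → ℝ} (hf : ContDiff ℝ ∞ f) :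
    ∃ T : Omega N D 0, ∀ x, T.1 x Fin.elim0 = f x := by
  obtain ⟨T, hT⟩ := exists_components_eq (D := D) N fun _ : Fin 0 → Fin D => (⟨f, hf⟩ : Smooth D)
  refine ⟨T, fun x => ?_⟩
  rw [← components_apply, hT, youngOp_val, youngOp_apply, altSum_apply, Finset.sum_apply]
  have h : ∀ g : Fin 0 → ℕ, fiberPerms g = {1} := fun g =>
    Finset.eq_singleton_iff_unique_mem.2 ⟨one_mem_fiberPerms, fun τ _ => Subsingleton.elim τ 1⟩
  simp [symSum_apply, h, perm_one]

/-- The closed tensor fields of degree zero are the polynomials. -/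
theorem exists_kerPow_zero_equiv (hk : 1 ≤ k) (hkN : k ≤ N - 1) :
    ∃ e : kerPow N D k 0 ≃ₗ[ℝ] polyFunctions D k, ∀ f x, (e f).1 x = f.1.1 x Fin.elim0 := by
  refine ⟨LinearEquiv.ofBijective
    { toFun := fun f => ⟨fun x => f.1.1 x Fin.elim0, (mem_kerPow_zero_iff hk hkN).1 f.2⟩
      map_add' := fun _ _ => rfl
      map_smul' := fun _ _ => rfl } ⟨fun f g h => ?_, fun f => ?_⟩, fun f x => rfl⟩
  · apply Subtype.ext
    apply Subtype.ext
    funext x μ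
    rw [Subsingleton.elim μ Fin.elim0]
    exact congrFun (congrArg Subtype.val h) x
  · obtain ⟨P, hP, h⟩ := f.2
    obtain ⟨T, hT⟩ := exists_omega_zero_eq N (contDiff_eval P)
    have h1 : (fun x => T.1 x Fin.elim0) = f.1 := funext fun x => (hT x).trans (h x).symm
    exact ⟨⟨T, (mem_kerPow_zero_iff hk hkN).2 (h1 ▸ f.2)⟩, Subtype.ext h1⟩

end Components
end YoungComplex

theorem theorem1 (N D k : ℕ) (hN : 2 ≤ N) (hk : 1 ≤ k) (hkN : k ≤ N - 1) :
    (∀ n : ℕ, 1 ≤ n → Subsingleton (YoungComplex.Cohomology N D k ((N - 1) * n))) ∧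
    ∃ e : YoungComplex.Cohomology N D k 0 ≃ₗ[ℝ] YoungComplex.polyFunctions D k,
      ∀ (f : YoungComplex.kerPow N D k 0) (x : Fin D → ℝ),
        (e (YoungComplex.toCohomology N D k 0 f)).1 x = f.1.1 x Fin.elim0 := by
  refine ⟨fun n hn => ?_, ?_⟩
  · rw [YoungComplex.Cohomology, Submodule.Quotient.subsingleton_iff,
      Submodule.submoduleOf_eq_top]
    exact YoungComplex.kerPow_le_imPow hn hk hkN
  · obtain ⟨e, he⟩ := YoungComplex.exists_kerPow_zero_equiv (D := D) hk hkN
    have h : (YoungComplex.imPow N D (N - k) 0).submoduleOf (YoungComplex.kerPow N D k 0) = ⊥ := by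
      rw [YoungComplex.imPow_eq_bot (by omega), Submodule.submoduleOf, Submodule.comap_bot,
        Submodule.ker_subtype]
    exact ⟨(Submodule.quotEquivOfEqBot _ h).trans e, fun f x => he f x⟩
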